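/- Consider a two-player extensive-form game with perfect information: a finite rooted tree with decision nodes $H$ and terminal nodes $Z$, each decision node having a nonempty finite set of children and belonging either to the leader $L$ or to the follower $F$, together with payoff functions $U_L,U_F\colon Z\to\mathbb R$. The leader commits to a behavioral strategy $\delta_L\in\Delta_L$ (a probability distribution over the children at each of her nodes), and the follower answers with a pure strategy $\pi_F\in\Pi_F$; let $p_{(\delta_L,\pi_F)}\in\Delta(Z)$ be the resulting distribution on terminal nodes, and write $U(p)=\sum_{z\in Z}U(z)p(z)$. For a follower payoff function $V\colon Z\to\mathbb R$ let $\mathrm{BR}_V(\delta_L)=\arg\max_{\pi_F\in\Pi_F}V(p_{(\delta_L,\pi_F)})$. A strong Stackelberg equilibrium (with behavioral commitment) of $(U_L,V)$ is a pair $(\delta_L,\pi_F)$ with $\pi_F\in \mathrm{BR}_V(\delta_L)$ that maximizes $U_L(p_{(\delta_L,\pi_F)})$ among all pairs $(\delta_L',\pi_F')$ with $\pi_F'\in \mathrm{BR}_V(\delta_L')$. A payoff function $V$ strongly induces $p\in\Delta(Z)$ if every strong Stackelberg equilibrium $(\delta_L,\pi_F)$ of $(U_L,V)$ satisfies $p_{(\delta_L,\pi_F)}=p$;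 $p$ is strongly inducible if some $V$ strongly induces it. Let $SP$ be the set of strongly inducible distributions; $p^*\in SP$ is optimal if $U_F(p^*)\ge U_F(p)$ for all $p\in SP$. Given such a game as input, the following can be done in time polynomial in $|H|+|Z|$ on a random access machine on which each arithmetic operation on, and each comparison of, real numbers takes one step: (1) decide whether $SP\neq\emptyset$; (2) if $SP\ne\emptyset$, decide whether an optimal strongly inducible distribution exists; (3) if an optimal strongly inducible distribution exists, find one, together with a payoff function that strongly induces it; if $SP\neq\emptyset$ but no optimal one exists, then, given any $\epsilon>0$ as a further input, find some $p^*\in SP$ with $$U_F(p^*)\ \ge\ \sup_{p\in SP}U_F(p)-\epsilon,$$ together with a payoff function that strongly induces it (with a polynomial time bound that does not depend on $\epsilon$). -/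

import Mathlib

namespace Stackelberg

/-! ### Two-player extensive-form games with perfect information -/

inductive Player
  | leader
  | follower
  deriving DecidableEq

/-- Finite rooted game trees.  A decision node carries the player who moves there and its
nonempty family of children; terminal nodes are `leaf`. -/
inductive GameTree : Type
  | leaf : GameTree
  | node (owner : Player) (k : ℕ) (child : Fin (k + 1) → GameTree) : GameTree

/-- The terminal nodes of a tree. -/
def GameTree.Leaf : GameTree → Type
  | .leaf => Unit
  | .node _ _ child => Σ j, (child j).Leaf

instance GameTree.fintypeLeaf : (T : GameTree) → Fintype T.Leaf
  | .leaf => inferInstanceAs (Fintype Unit)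
  | .node _ _ child =>
    letI : ∀ j, Fintype (child j).Leaf := fun j => GameTree.fintypeLeaf (child j)
    inferInstanceAs (Fintype (Σ j, (child j).Leaf))

/-- The number of nodes (decision nodes and terminal nodes). -/
def GameTree.size : GameTree → ℕ
  | .leaf => 1
  | .node _ _ child => 1 + ∑ j, (child j).size

/-- A pure strategy of player `i`: one child at each decision node of `i`. -/
def GameTree.Pure (i : Player) : GameTree → Type
  | .leaf => Unit
  | .node o k child => (o = i → Fin (k + 1)) × (∀ j, (child j).Pure i)

/-- A behavioral strategy of player `i`: a probability distribution over the children at each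
decision node of `i`. -/
def GameTree.Behavioral (i : Player) : GameTree → Type
  | .leaf => Unit
  | .node o k child => (o = i → stdSimplex ℝ (Fin (k + 1))) × (∀ j, (child j).Behavioral i)

/-- The probability that play ends in a given terminal node, when the leader plays the behavioral
strategy `δ` and the follower plays the pure strategy `π`. -/
def GameTree.outcome : (T : GameTree) → T.Behavioral .leader → T.Pure .follower → T.Leaf → ℝ
  | .leaf, _, _, _ => 1
  | .node .leader _ child, δ, π, ⟨j, z⟩ =>
    (δ.1 rfl : Fin _ → ℝ) j * (child j).outcome (δ.2 j) (π.2 j) z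
  | .node .follower _ child, δ, π, ⟨j, z⟩ =>
    (if π.1 rfl = j then 1 else 0) * (child j).outcome (δ.2 j) (π.2 j) z

/-- Expected utility of the payoff function `u` under the distribution `p` on terminal nodes. -/
def GameTree.expect {T : GameTree} (u p : T.Leaf → ℝ) : ℝ := ∑ z, u z * p z

/-- The follower's pure best responses to `δ`, when his payoff function is `uF`. -/
def GameTree.bestResponses {T : GameTree} (uF : T.Leaf → ℝ) (δ : T.Behavioral .leader) :
    Set (T.Pure .follower) :=
  {π | ∀ π', expect uF (T.outcome δ π') ≤ expect uF (T.outcome δ π)}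

/-- `(δ, π)` is a strong Stackelberg equilibrium with behavioral commitment of the game with
payoff functions `uL`, `uF`. -/
def GameTree.IsSSE {T : GameTree} (uL uF : T.Leaf → ℝ) (δ : T.Behavioral .leader)
    (π : T.Pure .follower) : Prop :=
  π ∈ bestResponses uF δ ∧
    ∀ δ', ∀ π' ∈ bestResponses uF δ',
      expect uL (T.outcome δ' π') ≤ expect uL (T.outcome δ π)

/-- Reporting the payoff function `v` makes `p` the outcome of every strong Stackelberg
equilibrium with behavioral commitment. -/
def GameTree.StronglyInduces {T : GameTree} (uL v : T.Leaf → ℝ) (p : T.Leaf → ℝ) : Prop :=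
  ∀ δ π, IsSSE uL v δ π → T.outcome δ π = p

/-- A game: a tree with the true payoff functions of the leader and of the follower. -/
structure Game where
  tree : GameTree
  uL : tree.Leaf → ℝ
  uF : tree.Leaf → ℝ

/-- The set of strongly inducible distributions (with behavioral commitment). -/
def Game.SP (G : Game) : Set (G.tree.Leaf → ℝ) :=
  {p | p ∈ stdSimplex ℝ G.tree.Leaf ∧ ∃ v, GameTree.StronglyInduces G.uL v p}

/-- `p` is an optimal strongly inducible distribution for the follower. -/
def Game.IsOptimal (G : Game) (p : G.tree.Leaf → ℝ) : Prop :=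
  p ∈ G.SP ∧ ∀ q ∈ G.SP, GameTree.expect G.uF q ≤ GameTree.expect G.uF p

/-- `p` is an `ε`-optimal strongly inducible distribution for the follower. -/
def Game.IsNearOptimal (G : Game) (ε : ℝ) (p : G.tree.Leaf → ℝ) : Prop :=
  p ∈ G.SP ∧ sSup (GameTree.expect G.uF '' G.SP) - ε ≤ GameTree.expect G.uF p

/-! ### The random access machine

A random access machine over the reals, programmed by while programs.  The memory consists of
banks of cells that hold natural numbers (used for counting and for addressing) and of banks of
cells that hold real numbers; a program mentions only finitely many banks.  Every elementary
operation (reading or writing a cell, a constant, an arithmetic operation, a comparison) takes one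
step.  There is no multiplication of natural numbers and no rounding of real numbers. -/

structure Memory where
  nat : ℕ → ℕ → ℕ
  real : ℕ → ℕ → ℝ

inductive NatExpr : Type
  | const (n : ℕ)
  | cell (bank : ℕ) (i : NatExpr)
  | add (e f : NatExpr)
  | sub (e f : NatExpr)

def NatExpr.eval (m : Memory) : NatExpr → ℕ
  | .const n => n
  | .cell a i => m.nat a (i.eval m)
  | .add e f => e.eval m + f.eval m
  | .sub e f => e.eval m - f.eval m

def NatExpr.cost : NatExpr → ℕ
  | .const _ => 1
  | .cell _ i => i.cost + 1
  | .add e f => e.cost + f.cost + 1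
  | .sub e f => e.cost + f.cost + 1

inductive RealExpr : Type
  | const (q : ℚ)
  | cell (bank : ℕ) (i : NatExpr)
  | add (e f : RealExpr)
  | sub (e f : RealExpr)
  | mul (e f : RealExpr)
  | div (e f : RealExpr)

noncomputable def RealExpr.eval (m : Memory) : RealExpr → ℝ
  | .const q => (q : ℝ)
  | .cell a i => m.real a (i.eval m)
  | .add e f => e.eval m + f.eval m
  | .sub e f => e.eval m - f.eval m
  | .mul e f => e.eval m * f.eval m
  | .div e f => e.eval m / f.eval m

def RealExpr.cost : RealExpr → ℕ
  | .const _ => 1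
  | .cell _ i => i.cost + 1
  | .add e f => e.cost + f.cost + 1
  | .sub e f => e.cost + f.cost + 1
  | .mul e f => e.cost + f.cost + 1
  | .div e f => e.cost + f.cost + 1

/-- The memory after writing `n` into cell `i` of bank `a` of natural numbers. -/
def Memory.writeNat (m : Memory) (a i n : ℕ) : Memory :=
  { m with nat := Function.update m.nat a (Function.update (m.nat a) i n) }

/-- The memory after writing `x` into cell `i` of bank `a` of real numbers. -/
def Memory.writeReal (m : Memory) (a i : ℕ) (x : ℝ) : Memory :=
  { m with real := Function.update m.real a (Function.update (m.real a) i x) }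

inductive Prog : Type
  | skip
  | setNat (bank : ℕ) (i e : NatExpr)
  | setReal (bank : ℕ) (i : NatExpr) (e : RealExpr)
  | seq (P Q : Prog)
  /-- if `e ≤ f` then `P` else `Q` -/
  | iteNat (e f : NatExpr) (P Q : Prog)
  /-- if `e ≤ f` then `P` else `Q` -/
  | iteReal (e f : RealExpr) (P Q : Prog)
  /-- while `e < f` do `P` -/
  | loop (e f : NatExpr) (P : Prog)

/-- `Exec P m c m'`: started in memory `m`, the program `P` halts after exactly `c` steps, in
memory `m'`. -/
inductive Exec : Prog → Memory → ℕ → Memory → Prop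
  | skip (m) : Exec .skip m 1 m
  | setNat (m a i e) :
      Exec (.setNat a i e) m (i.cost + e.cost + 1) (m.writeNat a (i.eval m) (e.eval m))
  | setReal (m a i e) :
      Exec (.setReal a i e) m (i.cost + e.cost + 1) (m.writeReal a (i.eval m) (e.eval m))
  | seq {P Q m c m' d m''} : Exec P m c m' → Exec Q m' d m'' → Exec (.seq P Q) m (c + d) m''
  | iteNat_true {e f P Q m c m'} : e.eval m ≤ f.eval m → Exec P m c m' →
      Exec (.iteNat e f P Q) m (e.cost + f.cost + 1 + c) m'
  | iteNat_false {e f P Q m c m'} : ¬ e.eval m ≤ f.eval m → Exec Q m c m' →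
      Exec (.iteNat e f P Q) m (e.cost + f.cost + 1 + c) m'
  | iteReal_true {e f P Q m c m'} : e.eval m ≤ f.eval m → Exec P m c m' →
      Exec (.iteReal e f P Q) m (e.cost + f.cost + 1 + c) m'
  | iteReal_false {e f P Q m c m'} : ¬ e.eval m ≤ f.eval m → Exec Q m c m' →
      Exec (.iteReal e f P Q) m (e.cost + f.cost + 1 + c) m'
  | loop_done {e f P m} : ¬ e.eval m < f.eval m →
      Exec (.loop e f P) m (e.cost + f.cost + 1) m
  | loop_step {e f P m c m' d m''} : e.eval m < f.eval m → Exec P m c m' →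
      Exec (.loop e f P) m' d m'' →
      Exec (.loop e f P) m (e.cost + f.cost + 1 + c + d) m''

/-- One program, with one polynomial time bound in the size of the instance, turns the input of
every instance `x` that satisfies `pre x` into a memory that satisfies `post x`. -/
def SolvableInPolyTime {I : Type} (input : I → Memory) (size : I → ℕ) (pre : I → Prop)
    (post : I → Memory → Prop) : Prop :=
  ∃ (P : Prog) (q : Polynomial ℕ), ∀ x, pre x →
    ∃ c m, Exec P (input x) c m ∧ c ≤ q.eval (size x) ∧ post x m

/-! ### Input and output formats

The nodes of a tree are numbered `0, 1, 2, …` in preorder, the root being node `0`. -/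

/-- The record of one node: its kind (`0` terminal, `1` leader, `2` follower), the number of its
parent, and the two payoffs (`0` at decision nodes). -/
structure Row where
  kind : ℕ
  parent : ℕ
  uL : ℝ
  uF : ℝ

def Player.code : Player → ℕ
  | .leader => 1
  | .follower => 2

/-- The number of the `j`-th child relative to its parent: the parent and the subtrees of the
earlier children come first. -/
def GameTree.childPos {k : ℕ} (child : Fin (k + 1) → GameTree) (j : Fin (k + 1)) : ℕ :=
  1 + ∑ l ∈ Finset.univ.filter (· < j), (child l).size

/-- The records, in preorder, of a tree whose root has number `pos` and parent `par`. -/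
noncomputable def GameTree.rows : (T : GameTree) → (uL uF : T.Leaf → ℝ) → (pos par : ℕ) → List Row
  | .leaf, uL, uF, _, par => [⟨0, par, uL (), uF ()⟩]
  | .node o _ child, uL, uF, pos, par =>
    ⟨o.code, par, 0, 0⟩ ::
      (List.ofFn fun j => (child j).rows (fun z => uL ⟨j, z⟩) (fun z => uF ⟨j, z⟩)
        (pos + childPos child j) pos).flatten

/-- The number of a terminal node. -/
def GameTree.leafPos : (T : GameTree) → T.Leaf → ℕ
  | .leaf, _ => 0
  | .node _ _ child, ⟨j, z⟩ => childPos child j + (child j).leafPos z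

/-- The number of nodes of the game tree. -/
def Game.size (G : Game) : ℕ := G.tree.size

/-- The record of node `i`; by convention a zero record beyond the last node. -/
noncomputable def Game.row (G : Game) (i : ℕ) : Row :=
  (G.tree.rows G.uL G.uF 0 0).getD i ⟨0, 0, 0, 0⟩

/-- The initial memory for the game `G` and the real parameter `ε`.  Banks of natural numbers:
bank `0`, cell `0` holds the number of nodes; banks `1` and `2` hold kinds and parents.  Banks of
real numbers: banks `0` and `1` hold the payoffs of the leader and of the follower; bank `2`,
cell `0` holds `ε`.  All other cells are `0`. -/
noncomputable def Game.input (G : Game) (ε : ℝ) : Memory where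
  nat
    | 0, 0 => G.size
    | 1, i => (G.row i).kind
    | 2, i => (G.row i).parent
    | _, _ => 0
  real
    | 0, i => (G.row i).uL
    | 1, i => (G.row i).uF
    | 2, 0 => ε
    | _, _ => 0

/-- The answer to a decision problem is `1` (yes) or `0` (no), in cell `0` of bank `3` of natural
numbers. -/
def Memory.Answers (m : Memory) (Q : Prop) : Prop :=
  (Q → m.nat 3 0 = 1) ∧ (¬ Q → m.nat 3 0 = 0)

/-- The distribution that is output: the probability of each terminal node is in the cell of that
node in bank `3` of real numbers. -/
def Memory.outDist (m : Memory) (T : GameTree) : T.Leaf → ℝ := fun z => m.real 3 (T.leafPos z)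

/-- The payoff function that is output, in bank `4` of real numbers. -/
def Memory.outPayoff (m : Memory) (T : GameTree) : T.Leaf → ℝ := fun z => m.real 4 (T.leafPos z)

end Stackelberg

namespace Stackelberg

/-! ### Programs with bounded loops -/

/-! A reported payoff function helps the follower in two ways. In a subtree where his payoff is a
constant minus the leader's, a best response holds her to at most her maximin value there, and a
subtree with a very low constant payoff is one he never enters. The maximin value is computed by
backward induction, since it is the value of a zero-sum game of perfect information.

Necessity. Let `p` be strongly induced and give the leader `s`. At a leader node `p` lies below a
single child, is strongly induced there, and every other child has maximin value below `s`
(`StronglyInduces.leader_child`). At a follower node `p` lies below one child `j`, and either `p` is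
strongly induced there or some sibling `i` has maximin value below `s`
(`StronglyInduces.follower_child`). The descent thus ends at a node `c` that is terminal or has a
sibling `i` usable as a threat, and `s` exceeds the maximin values of `i` and of all children of
leader nodes that hang off the path to `c` (`Arrays.exists_switch`).

Two terminal nodes suffice. In the plane of the two payoffs, a distribution is dominated by a
mixture of two points of its support (`exists_pair_dominating`). Two terminal nodes in the support
of one outcome part at a leader node, because the follower plays a pure strategy
(`Arrays.forks_of_outcome_pos`), so the leader can realise their mixtures.

Sufficiency. A mixture of such `a`, `b` below `c` that gives the leader `up` is enforced by paying
the follower `up` minus her payoff at `a` and `b`, making `i` and the off-path children zero-sum,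
and paying a low constant elsewhere (`Arrays.IsThreat.stronglyInduces`). Unless he gets at least `0`
below `c`, he moves to `i`. The sum of both payoffs below `c` is at most `up`, with equality only at
`a` and `b`.

Optimisation. For fixed `c`, `i` the only constraint left is that the leader's payoff exceed a
threshold strictly. Along a segment from `a` to `b` the follower's supremum is reached either at a
single terminal node above the threshold (`LeafTarget`), or in the limit at the point where the
leader gets exactly the threshold, which is not allowed itself (`PairTarget`). Hence `SP` is
nonempty iff a leaf target exists, and an optimum exists iff no pair value exceeds the best leaf
value; otherwise mixtures close to the best limit point are near-optimal.

Computation. In preorder every subtree is an interval, so all conditions are comparisons of table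
entries, and nested loops over the nodes examine all candidates. All loops are bounded by the number
of nodes, so the polynomial time bound can be read off the program (`Cmd.exec`). -/

/-- Programs whose only loops are `for x < n`, where `n` is the number in cell `0` of bank `0` and
`x` is kept in cell `0` of its own bank. -/
inductive Cmd : Type
  | skip
  | setNat (bank : ℕ) (i e : NatExpr)
  | setReal (bank : ℕ) (i : NatExpr) (e : RealExpr)
  | seq (C D : Cmd)
  | iteNat (e f : NatExpr) (C D : Cmd)
  | iteReal (e f : RealExpr) (C D : Cmd)
  | loop (x : ℕ) (C : Cmd)

namespace Cmd

def toProg : Cmd → Prog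
  | skip => .skip
  | setNat a i e => .setNat a i e
  | setReal a i e => .setReal a i e
  | seq C D => .seq C.toProg D.toProg
  | iteNat e f C D => .iteNat e f C.toProg D.toProg
  | iteReal e f C D => .iteReal e f C.toProg D.toProg
  | loop x C => .seq (.setNat x (.const 0) (.const 0))
      (.loop (.cell x (.const 0)) (.cell 0 (.const 0))
        (.seq C.toProg (.setNat x (.const 0) (.add (.cell x (.const 0)) (.const 1)))))

end Cmd

/-- Increment cell `0` of bank `x`. -/
def Memory.tick (x : ℕ) (m : Memory) : Memory := m.writeNat x 0 (m.nat x 0 + 1)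

namespace Cmd

noncomputable def run : Cmd → Memory → Memory
  | skip, m => m
  | setNat a i e, m => m.writeNat a (i.eval m) (e.eval m)
  | setReal a i e, m => m.writeReal a (i.eval m) (e.eval m)
  | seq C D, m => D.run (C.run m)
  | iteNat e f C D, m => if e.eval m ≤ f.eval m then C.run m else D.run m
  | iteReal e f C D, m => if e.eval m ≤ f.eval m then C.run m else D.run m
  | loop x C, m => (fun m => (C.run m).tick x)^[m.nat 0 0] (m.writeNat x 0 0)

/-- The banks of natural numbers that a program writes to. -/
def natBanks : Cmd → List ℕ
  | skip => []
  | setNat a _ _ => [a]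
  | setReal _ _ _ => []
  | seq C D => C.natBanks ++ D.natBanks
  | iteNat _ _ C D => C.natBanks ++ D.natBanks
  | iteReal _ _ C D => C.natBanks ++ D.natBanks
  | loop x C => x :: C.natBanks

/-- The banks of real numbers that a program writes to. -/
def realBanks : Cmd → List ℕ
  | skip => []
  | setNat _ _ _ => []
  | setReal a _ _ => [a]
  | seq C D => C.realBanks ++ D.realBanks
  | iteNat _ _ C D => C.realBanks ++ D.realBanks
  | iteReal _ _ C D => C.realBanks ++ D.realBanks
  | loop _ C => C.realBanks

/-- No loop body writes to the loop counter, and the loop bound is written to only at the end. -/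
def WellFormed : Cmd → Prop
  | seq C D => 0 ∉ C.natBanks ∧ C.WellFormed ∧ D.WellFormed
  | iteNat _ _ C D => C.WellFormed ∧ D.WellFormed
  | iteReal _ _ C D => C.WellFormed ∧ D.WellFormed
  | loop x C => x ≠ 0 ∧ x ∉ C.natBanks ∧ 0 ∉ C.natBanks ∧ C.WellFormed
  | _ => True

instance decidableWellFormed : (C : Cmd) → Decidable C.WellFormed
  | skip => isTrue trivial
  | setNat _ _ _ => isTrue trivial
  | setReal _ _ _ => isTrue trivial
  | seq C D =>
    letI := decidableWellFormed C
    letI := decidableWellFormed D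
    inferInstanceAs (Decidable (0 ∉ C.natBanks ∧ C.WellFormed ∧ D.WellFormed))
  | iteNat _ _ C D => @instDecidableAnd _ _ (decidableWellFormed C) (decidableWellFormed D)
  | iteReal _ _ C D => @instDecidableAnd _ _ (decidableWellFormed C) (decidableWellFormed D)
  | loop x C =>
    letI := decidableWellFormed C
    inferInstanceAs (Decidable (x ≠ 0 ∧ x ∉ C.natBanks ∧ 0 ∉ C.natBanks ∧ C.WellFormed))

/-- A bound for the running time, as a polynomial in the loop bound. -/
noncomputable def timeBound : Cmd → Polynomial ℕ
  | skip => 1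
  | setNat _ i e => ((i.cost + e.cost + 1 : ℕ) : Polynomial ℕ)
  | setReal _ i e => ((i.cost + e.cost + 1 : ℕ) : Polynomial ℕ)
  | seq C D => C.timeBound + D.timeBound
  | iteNat e f C D => ((e.cost + f.cost + 1 : ℕ) : Polynomial ℕ) + (C.timeBound + D.timeBound)
  | iteReal e f C D => ((e.cost + f.cost + 1 : ℕ) : Polynomial ℕ) + (C.timeBound + D.timeBound)
  -- Resetting the counter takes `3` steps and the final test `5`; each round takes `5` for the test
  -- and `6` for the increment.
  | loop _ C => 8 + Polynomial.X * (C.timeBound + 11)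

end Cmd

@[simp] theorem Memory.writeNat_nat (m : Memory) (a i n b j : ℕ) :
    (m.writeNat a i n).nat b j = if b = a ∧ j = i then n else m.nat b j := by
  unfold Memory.writeNat
  by_cases h : b = a
  · subst h
    by_cases h' : j = i
    · subst h'; simp
    · simp [h']
  · simp [h]

@[simp] theorem Memory.writeNat_real (m : Memory) (a i n : ℕ) :
    (m.writeNat a i n).real = m.real := rfl

@[simp] theorem Memory.writeReal_nat (m : Memory) (a i : ℕ) (x : ℝ) :
    (m.writeReal a i x).nat = m.nat := rfl

@[simp] theorem Memory.writeReal_real (m : Memory) (a i : ℕ) (x : ℝ) (b j : ℕ) :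
    (m.writeReal a i x).real b j = if b = a ∧ j = i then x else m.real b j := by
  unfold Memory.writeReal
  by_cases h : b = a
  · subst h
    by_cases h' : j = i
    · subst h'; simp
    · simp [h']
  · simp [h]

@[simp] theorem Memory.tick_real (x : ℕ) (m : Memory) : (m.tick x).real = m.real := rfl

@[simp] theorem Memory.tick_nat (x : ℕ) (m : Memory) (b j : ℕ) :
    (m.tick x).nat b j = if b = x ∧ j = 0 then m.nat x 0 + 1 else m.nat b j := by
  simp [Memory.tick]

namespace Cmd

theorem run_nat_of_notMem (C : Cmd) : ∀ {b : ℕ}, b ∉ C.natBanks → ∀ (m : Memory),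
    (C.run m).nat b = m.nat b := by
  induction C with
  | skip => intros; rfl
  | setNat a i e =>
    intro b hb m
    funext j
    have : b ≠ a := by simpa [natBanks] using hb
    simp [run, this]
  | setReal a i e => intros; rfl
  | seq C D hC hD =>
    intro b hb m
    simp only [natBanks, List.mem_append, not_or] at hb
    simp [run, hD hb.2, hC hb.1]
  | iteNat e f C D hC hD =>
    intro b hb m
    simp only [natBanks, List.mem_append, not_or] at hb
    unfold run
    split_ifs
    exacts [hC hb.1 m, hD hb.2 m]
  | iteReal e f C D hC hD =>
    intro b hb m
    simp only [natBanks, List.mem_append, not_or] at hb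
    unfold run
    split_ifs
    exacts [hC hb.1 m, hD hb.2 m]
  | loop x C hC =>
    intro b hb m
    simp only [natBanks, List.mem_cons, not_or] at hb
    have key : ∀ k m', ((fun m => (C.run m).tick x)^[k] m').nat b = m'.nat b := by
      intro k
      induction k with
      | zero => intro m'; rfl
      | succ k ih =>
        intro m'
        rw [Function.iterate_succ_apply, ih]
        funext j
        simp [hb.1, hC hb.2]
    unfold run
    rw [key]
    funext j
    simp [hb.1]

theorem run_real_of_notMem (C : Cmd) : ∀ {b : ℕ}, b ∉ C.realBanks → ∀ (m : Memory),
    (C.run m).real b = m.real b := by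
  induction C with
  | skip => intros; rfl
  | setNat a i e => intros; rfl
  | setReal a i e =>
    intro b hb m
    funext j
    have : b ≠ a := by simpa [realBanks] using hb
    simp [run, this]
  | seq C D hC hD =>
    intro b hb m
    simp only [realBanks, List.mem_append, not_or] at hb
    simp [run, hD hb.2, hC hb.1]
  | iteNat e f C D hC hD =>
    intro b hb m
    simp only [realBanks, List.mem_append, not_or] at hb
    unfold run
    split_ifs
    exacts [hC hb.1 m, hD hb.2 m]
  | iteReal e f C D hC hD =>
    intro b hb m
    simp only [realBanks, List.mem_append, not_or] at hb
    unfold run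
    split_ifs
    exacts [hC hb.1 m, hD hb.2 m]
  | loop x C hC =>
    intro b hb m
    have key : ∀ k m', ((fun m => (C.run m).tick x)^[k] m').real b = m'.real b := by
      intro k
      induction k with
      | zero => intro m'; rfl
      | succ k ih =>
        intro m'
        rw [Function.iterate_succ_apply, ih]
        simp [hC hb]
    unfold run
    rw [key]
    simp

/-- Since no loop body writes to its counter or to the common bound, each loop makes exactly as many
rounds as the bound says, and the bounds for the bodies may all be evaluated at the same number. -/
theorem exec (C : Cmd) : C.WellFormed → ∀ m : Memory,
    ∃ c, c ≤ C.timeBound.eval (m.nat 0 0) ∧ Exec C.toProg m c (C.run m) := by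
  induction C with
  | skip => intro _ m; exact ⟨1, by simp [timeBound], .skip m⟩
  | setNat a i e => intro _ m; exact ⟨_, by simp [timeBound], .setNat m a i e⟩
  | setReal a i e => intro _ m; exact ⟨_, by simp [timeBound], .setReal m a i e⟩
  | seq C D hC hD =>
    intro hw m
    obtain ⟨c, hc, hx⟩ := hC hw.2.1 m
    obtain ⟨d, hd, hy⟩ := hD hw.2.2 (C.run m)
    rw [C.run_nat_of_notMem hw.1] at hd
    refine ⟨c + d, ?_, .seq hx hy⟩
    simp only [timeBound, Polynomial.eval_add]
    omega
  | iteNat e f C D hC hD =>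
    intro hw m
    by_cases h : e.eval m ≤ f.eval m
    · obtain ⟨c, hc, hx⟩ := hC hw.1 m
      refine ⟨e.cost + f.cost + 1 + c, ?_, ?_⟩
      rotate_left
      · unfold run; rw [if_pos h]; exact .iteNat_true h hx
      · simp only [timeBound, Polynomial.eval_add, Polynomial.eval_natCast, Nat.cast_id]; omega
    · obtain ⟨c, hc, hx⟩ := hD hw.2 m
      refine ⟨e.cost + f.cost + 1 + c, ?_, ?_⟩
      rotate_left
      · unfold run; rw [if_neg h]; exact .iteNat_false h hx
      · simp only [timeBound, Polynomial.eval_add, Polynomial.eval_natCast, Nat.cast_id]; omega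
  | iteReal e f C D hC hD =>
    intro hw m
    by_cases h : e.eval m ≤ f.eval m
    · obtain ⟨c, hc, hx⟩ := hC hw.1 m
      refine ⟨e.cost + f.cost + 1 + c, ?_, ?_⟩
      rotate_left
      · unfold run; rw [if_pos h]; exact .iteReal_true h hx
      · simp only [timeBound, Polynomial.eval_add, Polynomial.eval_natCast, Nat.cast_id]; omega
    · obtain ⟨c, hc, hx⟩ := hD hw.2 m
      refine ⟨e.cost + f.cost + 1 + c, ?_, ?_⟩
      rotate_left
      · unfold run; rw [if_neg h]; exact .iteReal_false h hx
      · simp only [timeBound, Polynomial.eval_add, Polynomial.eval_natCast, Nat.cast_id]; omega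
  | loop x C hC =>
    intro hw m
    obtain ⟨hx0, hxC, h0C, hwC⟩ := hw
    have key : ∀ k m', m'.nat x 0 + k = m'.nat 0 0 →
        ∃ c, c ≤ 5 + k * (C.timeBound.eval (m'.nat 0 0) + 11) ∧
          Exec (.loop (.cell x (.const 0)) (.cell 0 (.const 0))
            (.seq C.toProg (.setNat x (.const 0) (.add (.cell x (.const 0)) (.const 1))))) m' c
            ((fun m => (C.run m).tick x)^[k] m') := by
      intro k
      induction k with
      | zero =>
        intro m' h
        refine ⟨_, ?_, .loop_done ?_⟩
        · simp [NatExpr.cost]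
        · simp [NatExpr.eval]; omega
      | succ k ih =>
        intro m' h
        obtain ⟨c, hc, hx⟩ := hC hwC m'
        have h0 : ((C.run m').tick x).nat 0 0 = m'.nat 0 0 := by
          simp [hx0.symm, C.run_nat_of_notMem h0C]
        have h1 : ((C.run m').tick x).nat x 0 = m'.nat x 0 + 1 := by
          simp [C.run_nat_of_notMem hxC]
        obtain ⟨d, hd, hy⟩ := ih ((C.run m').tick x) (by rw [h0, h1]; omega)
        refine ⟨_, ?_, .loop_step ?_ (.seq hx (.setNat _ _ _ _)) hy⟩
        · simp only [NatExpr.cost]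
          rw [h0] at hd
          rw [add_one_mul]
          omega
        · simp [NatExpr.eval]; omega
    obtain ⟨c, hc, hx⟩ := key (m.nat 0 0) (m.writeNat x 0 0) (by simp [hx0.symm])
    refine ⟨_, ?_, .seq (.setNat _ _ _ _) hx⟩
    have h0 : (m.writeNat x 0 0).nat 0 0 = m.nat 0 0 := by simp [hx0.symm]
    rw [h0] at hc
    simp only [timeBound, NatExpr.cost, Polynomial.eval_add, Polynomial.eval_mul,
      Polynomial.eval_X, Polynomial.eval_ofNat]
    omega

/-- The loop rule. -/
theorem run_loop {x : ℕ} {C : Cmd} (hw : (loop x C).WellFormed) (m : Memory)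
    (I : ℕ → Memory → Prop) (h0 : I 0 (m.writeNat x 0 0))
    (hs : ∀ i m', i < m.nat 0 0 → m'.nat 0 0 = m.nat 0 0 → m'.nat x 0 = i → I i m' →
      I (i + 1) ((C.run m').tick x)) : I (m.nat 0 0) ((loop x C).run m) := by
  obtain ⟨hx0, hxC, h0C, -⟩ := hw
  have key : ∀ k, k ≤ m.nat 0 0 →
      (((fun m => (C.run m).tick x)^[k] (m.writeNat x 0 0)).nat 0 0 = m.nat 0 0 ∧
      ((fun m => (C.run m).tick x)^[k] (m.writeNat x 0 0)).nat x 0 = k) ∧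
      I k ((fun m => (C.run m).tick x)^[k] (m.writeNat x 0 0)) := by
    intro k
    induction k with
    | zero => intro _; exact ⟨by simp [hx0.symm], h0⟩
    | succ k ih =>
      intro hk
      obtain ⟨⟨h1, h2⟩, h3⟩ := ih (by omega)
      rw [Function.iterate_succ_apply']
      refine ⟨⟨?_, ?_⟩, hs k _ (by omega) h1 h2 h3⟩
      · simp [hx0.symm, C.run_nat_of_notMem h0C, h1]
      · simp [C.run_nat_of_notMem hxC, h2]
  exact (key _ le_rfl).2

end Cmd

end Stackelberg

namespace Stackelberg

namespace GameTree

/-! ### Strategies, outcomes and expected payoffs -/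

theorem expect_leaf (u p : GameTree.leaf.Leaf → ℝ) : expect u p = u () * p () := by
  exact Finset.sum_singleton (fun z : Unit => u z * p z) ()

theorem expect_node {o : Player} {k : ℕ} {child : Fin (k + 1) → GameTree}
    (u p : (node o k child).Leaf → ℝ) :
    expect u p = ∑ j, expect (T := child j) (fun z => u ⟨j, z⟩) (fun z => p ⟨j, z⟩) :=
  Fintype.sum_sigma (fun x : Σ j, (child j).Leaf => u x * p x)

theorem expect_const_mul {T : GameTree} (u p : T.Leaf → ℝ) (c : ℝ) :
    expect u (fun z => c * p z) = c * expect u p := by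
  simp only [expect, Finset.mul_sum]
  exact Finset.sum_congr rfl fun z _ => by ring

theorem expect_zero {T : GameTree} (u : T.Leaf → ℝ) : expect u (fun _ => 0) = 0 := by
  simp [expect]

/-- The probabilities with which the leader moves to the children of a node of hers. -/
noncomputable def weight {k : ℕ} {child : Fin (k + 1) → GameTree}
    (δ : (node .leader k child).Behavioral .leader) (j : Fin (k + 1)) : ℝ :=
  (δ.1 rfl : Fin (k + 1) → ℝ) j

theorem weight_nonneg {k : ℕ} {child : Fin (k + 1) → GameTree}
    (δ : (node .leader k child).Behavioral .leader) (j : Fin (k + 1)) : 0 ≤ weight δ j :=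
  (δ.1 rfl).2.1 j

theorem sum_weight {k : ℕ} {child : Fin (k + 1) → GameTree}
    (δ : (node .leader k child).Behavioral .leader) : ∑ j, weight δ j = 1 :=
  (δ.1 rfl).2.2

theorem expect_leader {k : ℕ} {child : Fin (k + 1) → GameTree}
    (u : (node .leader k child).Leaf → ℝ) (δ : (node .leader k child).Behavioral .leader)
    (π : (node .leader k child).Pure .follower) :
    expect u ((node .leader k child).outcome δ π) =
      ∑ j, weight δ j *
        expect (fun z => u ⟨j, z⟩) ((child j).outcome (δ.2 j) (π.2 j)) := by
  rw [expect_node]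
  exact Finset.sum_congr rfl fun j _ => by rw [← expect_const_mul]; rfl

theorem expect_follower {k : ℕ} {child : Fin (k + 1) → GameTree}
    (u : (node .follower k child).Leaf → ℝ) (δ : (node .follower k child).Behavioral .leader)
    (π : (node .follower k child).Pure .follower) :
    expect u ((node .follower k child).outcome δ π) =
      expect (fun z => u ⟨π.1 rfl, z⟩)
        ((child (π.1 rfl)).outcome (δ.2 (π.1 rfl)) (π.2 (π.1 rfl))) := by
  rw [expect_node, Finset.sum_eq_single (π.1 rfl)]
  · refine congrArg _ (funext fun z => ?_)
    simp [outcome]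
  · intro j _ hj
    rw [← expect_zero]
    refine congrArg _ (funext fun z => ?_)
    simp [outcome, hj.symm]
  · simp

/-- The total mass is the expectation of the constant payoff `1`, so the recursion for `expect`
computes it. -/
theorem outcome_mem_stdSimplex : (T : GameTree) → (δ : T.Behavioral .leader) →
    (π : T.Pure .follower) → T.outcome δ π ∈ stdSimplex ℝ T.Leaf
  | .leaf, δ, π => by
    refine ⟨fun z => zero_le_one, ?_⟩
    have := expect_leaf (fun _ => 1) (leaf.outcome δ π)
    simpa [expect, outcome] using this
  | .node .leader k child, δ, π => by
    refine ⟨?_, ?_⟩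
    · rintro ⟨j, z⟩
      exact mul_nonneg (weight_nonneg δ j) ((outcome_mem_stdSimplex (child j) _ _).1 z)
    · have := expect_leader (fun _ => 1) δ π
      have h : ∀ j, expect (fun _ => (1 : ℝ)) ((child j).outcome (δ.2 j) (π.2 j)) = 1 := by
        intro j
        simpa [expect] using (outcome_mem_stdSimplex (child j) (δ.2 j) (π.2 j)).2
      simp only [h, mul_one] at this
      rw [sum_weight] at this
      simpa [expect] using this
  | .node .follower k child, δ, π => by
    refine ⟨?_, ?_⟩
    · rintro ⟨j, z⟩
      refine mul_nonneg ?_ ((outcome_mem_stdSimplex (child j) _ _).1 z)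
      split_ifs <;> norm_num
    · have := expect_follower (fun _ => 1) δ π
      have h : ∀ j, expect (fun _ => (1 : ℝ)) ((child j).outcome (δ.2 j) (π.2 j)) = 1 := by
        intro j
        simpa [expect] using (outcome_mem_stdSimplex (child j) (δ.2 j) (π.2 j)).2
      rw [h] at this
      simpa [expect] using this

theorem expect_sub_const {T : GameTree} (u : T.Leaf → ℝ) (c : ℝ) (δ : T.Behavioral .leader)
    (π : T.Pure .follower) :
    expect (fun z => c - u z) (T.outcome δ π) = c - expect u (T.outcome δ π) := by
  simp only [expect, sub_mul, Finset.sum_sub_distrib, ← Finset.mul_sum,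
    (outcome_mem_stdSimplex T δ π).2, mul_one]

theorem expect_const {T : GameTree} (c : ℝ) (δ : T.Behavioral .leader) (π : T.Pure .follower) :
    expect (fun _ => c) (T.outcome δ π) = c := by
  simp only [expect, ← Finset.mul_sum, (outcome_mem_stdSimplex T δ π).2, mul_one]

noncomputable instance nonemptyBehavioral : (T : GameTree) → (i : Player) →
    Nonempty (T.Behavioral i)
  | .leaf, _ => ⟨()⟩
  | .node _ _ child, i =>
    ⟨(fun _ => ⟨Pi.single 0 1, single_mem_stdSimplex ℝ 0⟩,
      fun j => (nonemptyBehavioral (child j) i).some)⟩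

instance nonemptyPure : (T : GameTree) → (i : Player) → Nonempty (T.Pure i)
  | .leaf, _ => ⟨()⟩
  | .node _ _ child, i => ⟨(fun _ => 0, fun j => (nonemptyPure (child j) i).some)⟩

instance finitePure : (T : GameTree) → (i : Player) → Finite (T.Pure i)
  | .leaf, _ => inferInstanceAs (Finite Unit)
  | .node o k child, i =>
    letI : ∀ j, Finite ((child j).Pure i) := fun j => finitePure (child j) i
    inferInstanceAs (Finite ((o = i → Fin (k + 1)) × (∀ j, (child j).Pure i)))

/-- The behavioral strategy of the leader at a node of hers. -/
def leaderMix {k : ℕ} {child : Fin (k + 1) → GameTree} (s : stdSimplex ℝ (Fin (k + 1)))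
    (d : ∀ j, (child j).Behavioral .leader) : (node .leader k child).Behavioral .leader :=
  (fun _ => s, d)

/-- The behavioral strategy of the leader that moves to child `j` with probability one. -/
def leaderMove {k : ℕ} {child : Fin (k + 1) → GameTree} (j : Fin (k + 1))
    (d : ∀ j, (child j).Behavioral .leader) : (node .leader k child).Behavioral .leader :=
  leaderMix ⟨Pi.single j 1, single_mem_stdSimplex ℝ j⟩ d

/-- The behavioral strategy of the leader at a node of the follower. -/
def leaderWait {k : ℕ} {child : Fin (k + 1) → GameTree}
    (d : ∀ j, (child j).Behavioral .leader) : (node .follower k child).Behavioral .leader :=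
  ((fun h => nomatch h), d)

def followerMove {k : ℕ} {child : Fin (k + 1) → GameTree} (j : Fin (k + 1))
    (f : ∀ j, (child j).Pure .follower) : (node .follower k child).Pure .follower :=
  (fun _ => j, f)

def followerWait {k : ℕ} {child : Fin (k + 1) → GameTree}
    (f : ∀ j, (child j).Pure .follower) : (node .leader k child).Pure .follower :=
  ((fun h => nomatch h), f)

theorem weight_leaderMix {k : ℕ} {child : Fin (k + 1) → GameTree}
    (s : stdSimplex ℝ (Fin (k + 1))) (d : ∀ j, (child j).Behavioral .leader) (j : Fin (k + 1)) :
    weight (leaderMix s d) j = s j := rfl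

theorem weight_leaderMove {k : ℕ} {child : Fin (k + 1) → GameTree}
    (d : ∀ j, (child j).Behavioral .leader) (j i : Fin (k + 1)) :
    weight (leaderMove j d) i = if i = j then 1 else 0 :=
  Pi.single_apply j (1 : ℝ) i

theorem outcome_leader {k : ℕ} {child : Fin (k + 1) → GameTree}
    (δ : (node .leader k child).Behavioral .leader)
    (π : (node .leader k child).Pure .follower) (j : Fin (k + 1)) (z : (child j).Leaf) :
    (node .leader k child).outcome δ π ⟨j, z⟩ =
      weight δ j * (child j).outcome (δ.2 j) (π.2 j) z := rfl

theorem expect_leaderMove {k : ℕ} {child : Fin (k + 1) → GameTree}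
    (u : (node .leader k child).Leaf → ℝ) (j : Fin (k + 1))
    (d : ∀ j, (child j).Behavioral .leader) (π : (node .leader k child).Pure .follower) :
    expect u ((node .leader k child).outcome (leaderMove j d) π) =
      expect (fun z => u ⟨j, z⟩) ((child j).outcome (d j) (π.2 j)) := by
  rw [expect_leader, Finset.sum_eq_single j]
  · rw [weight_leaderMove, if_pos rfl, one_mul]; rfl
  · intro i _ hi
    rw [weight_leaderMove, if_neg hi, zero_mul]
  · simp

theorem outcome_leaderMove {k : ℕ} {child : Fin (k + 1) → GameTree} (j : Fin (k + 1))
    (d : ∀ j, (child j).Behavioral .leader) (π : (node .leader k child).Pure .follower)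
    (i : Fin (k + 1)) (z : (child i).Leaf) :
    (node .leader k child).outcome (leaderMove j d) π ⟨i, z⟩ =
      if i = j then (child i).outcome (d i) (π.2 i) z else 0 := by
  rw [outcome_leader, weight_leaderMove, ite_mul, one_mul, zero_mul]; rfl

theorem outcome_follower {k : ℕ} {child : Fin (k + 1) → GameTree}
    (δ : (node .follower k child).Behavioral .leader)
    (π : (node .follower k child).Pure .follower) (i : Fin (k + 1)) (z : (child i).Leaf) :
    (node .follower k child).outcome δ π ⟨i, z⟩ =
      if i = π.1 rfl then (child i).outcome (δ.2 i) (π.2 i) z else 0 := by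
  by_cases h : i = π.1 rfl
  · simp [outcome, h.symm]
  · simp [outcome, h, Ne.symm h]

/-! ### Best responses -/

theorem exists_bestResponse {T : GameTree} (v : T.Leaf → ℝ) (δ : T.Behavioral .leader) :
    ∃ π, π ∈ bestResponses v δ := by
  obtain ⟨π, hπ⟩ := Finite.exists_max fun π => expect v (T.outcome δ π)
  exact ⟨π, hπ⟩

theorem bestResponse_leaderMove {k : ℕ} {child : Fin (k + 1) → GameTree}
    {v : (node .leader k child).Leaf → ℝ} {j : Fin (k + 1)}
    {d : ∀ j, (child j).Behavioral .leader} {f : ∀ j, (child j).Pure .follower}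
    (h : f j ∈ bestResponses (fun z => v ⟨j, z⟩) (d j)) :
    followerWait f ∈ bestResponses v (leaderMove j d) := by
  intro π'
  rw [expect_leaderMove, expect_leaderMove]
  exact h (π'.2 j)

/-- A change of plan in child `j` alone affects one summand of the expected payoff, and its positive
factor cancels. In a child of weight zero the follower's plan is arbitrary. -/
theorem bestResponse_of_leader {k : ℕ} {child : Fin (k + 1) → GameTree}
    {v : (node .leader k child).Leaf → ℝ} {δ : (node .leader k child).Behavioral .leader}
    {π : (node .leader k child).Pure .follower} (h : π ∈ bestResponses v δ) (j : Fin (k + 1))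
    (hj : 0 < weight δ j) :
    π.2 j ∈ bestResponses (fun z => v ⟨j, z⟩) (δ.2 j) := by
  intro π'
  have := h (followerWait (Function.update π.2 j π'))
  rw [expect_leader, expect_leader, ← sub_nonneg, ← Finset.sum_sub_distrib,
    Finset.sum_eq_single j] at this
  · simp only [followerWait, Function.update_self] at this
    rw [← mul_sub] at this
    exact sub_nonneg.1 (nonneg_of_mul_nonneg_right this hj)
  · intro i _ hi
    simp [followerWait, hi]
  · simp

/-- Only the child moved to counts: the plans in the other children need not be optimal there. -/
theorem mem_bestResponses_follower {k : ℕ} {child : Fin (k + 1) → GameTree}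
    {v : (node .follower k child).Leaf → ℝ} {δ : (node .follower k child).Behavioral .leader}
    {π : (node .follower k child).Pure .follower} :
    π ∈ bestResponses v δ ↔ ∀ i π', expect (fun z => v ⟨i, z⟩) ((child i).outcome (δ.2 i) π') ≤
      expect (fun z => v ⟨π.1 rfl, z⟩)
        ((child (π.1 rfl)).outcome (δ.2 (π.1 rfl)) (π.2 (π.1 rfl))) := by
  constructor
  · intro h i π'
    have := h (followerMove i (Function.update π.2 i π'))
    rw [expect_follower, expect_follower] at this
    simpa [followerMove] using this
  · intro h π'
    rw [expect_follower, expect_follower]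
    exact h _ _

/-! ### Existence of equilibria -/

/-- One probability distribution over the children at every decision node. -/
def Mixing : GameTree → Type
  | .leaf => Unit
  | .node _ k child => stdSimplex ℝ (Fin (k + 1)) × (∀ j, (child j).Mixing)

/-- A product of simplices over all nodes is compact and maps onto the behavioral strategies; the
superfluous distributions at follower nodes do no harm. -/
noncomputable instance topologicalSpaceMixing : (T : GameTree) → TopologicalSpace T.Mixing
  | .leaf => inferInstanceAs (TopologicalSpace Unit)
  | .node _ k child =>
    letI : ∀ j, TopologicalSpace (child j).Mixing := fun j => topologicalSpaceMixing (child j)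
    inferInstanceAs (TopologicalSpace (stdSimplex ℝ (Fin (k + 1)) × (∀ j, (child j).Mixing)))

instance compactSpaceMixing : (T : GameTree) → CompactSpace T.Mixing
  | .leaf => inferInstanceAs (CompactSpace Unit)
  | .node _ k child =>
    letI : ∀ j, CompactSpace (child j).Mixing := fun j => compactSpaceMixing (child j)
    letI : CompactSpace (stdSimplex ℝ (Fin (k + 1))) :=
      isCompact_iff_compactSpace.1 (isCompact_stdSimplex ℝ _)
    inferInstanceAs (CompactSpace (stdSimplex ℝ (Fin (k + 1)) × (∀ j, (child j).Mixing)))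

def Mixing.behavioral : {T : GameTree} → T.Mixing → T.Behavioral .leader
  | .leaf, _ => ()
  | .node _ _ _, s => (fun _ => s.1, fun j => (s.2 j).behavioral)

theorem Mixing.exists_behavioral_eq : (T : GameTree) → (δ : T.Behavioral .leader) →
    ∃ s : T.Mixing, s.behavioral = δ
  | .leaf, _ => ⟨(), rfl⟩
  | .node .leader _ child, δ => by
    choose s hs using fun j => exists_behavioral_eq (child j) (δ.2 j)
    exact ⟨(δ.1 rfl, s), Prod.ext rfl (funext hs)⟩
  | .node .follower _ child, δ => by
    choose s hs using fun j => exists_behavioral_eq (child j) (δ.2 j)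
    exact ⟨(⟨Pi.single 0 1, single_mem_stdSimplex ℝ 0⟩, s),
      Prod.ext (funext fun h => nomatch h) (funext hs)⟩

theorem continuous_outcome : (T : GameTree) → (π : T.Pure .follower) → (z : T.Leaf) →
    Continuous fun s : T.Mixing => T.outcome s.behavioral π z
  | .leaf, _, _ => continuous_const
  | .node o k child, π, ⟨j, z⟩ => by
    have h := continuous_outcome (child j) (π.2 j) z
    have h1 : Continuous fun s : stdSimplex ℝ (Fin (k + 1)) × (∀ j, (child j).Mixing) =>
        s.1.1 j :=
      (continuous_apply j).comp (continuous_subtype_val.comp continuous_fst)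
    have h2 : Continuous fun s : stdSimplex ℝ (Fin (k + 1)) × (∀ j, (child j).Mixing) => s.2 j :=
      (continuous_apply j).comp continuous_snd
    cases o with
    | leader => exact h1.mul (h.comp h2)
    | follower => exact continuous_const.mul (h.comp h2)

theorem continuous_expect_outcome {T : GameTree} (u : T.Leaf → ℝ) (π : T.Pure .follower) :
    Continuous fun s : T.Mixing => expect u (T.outcome s.behavioral π) :=
  continuous_finsetSum _ fun z _ => continuous_const.mul (continuous_outcome T π z)

/-- For each of the finitely many pure strategies, the commitments to which it is a best response
form a closed, hence compact set, on which the leader's payoff has a maximum. The largest of these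
maxima is an equilibrium payoff. -/
theorem exists_isSSE {T : GameTree} (u v : T.Leaf → ℝ) : ∃ δ π, IsSSE (T := T) u v δ π := by
  have hc : ∀ π, IsCompact {s : T.Mixing | ∀ π', expect v (T.outcome s.behavioral π') ≤
      expect v (T.outcome s.behavioral π)} := by
    intro π
    refine IsClosed.isCompact ?_
    simp only [Set.ofPred_forall]
    exact isClosed_iInter fun π' =>
      isClosed_le (continuous_expect_outcome v π') (continuous_expect_outcome v π)
  have hm : ∀ π : {π : T.Pure .follower // ∃ s : T.Mixing, π ∈ bestResponses v s.behavioral},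
      ∃ s : T.Mixing, π.1 ∈ bestResponses v s.behavioral ∧
        ∀ s' : T.Mixing, π.1 ∈ bestResponses v s'.behavioral →
          expect u (T.outcome s'.behavioral π.1) ≤ expect u (T.outcome s.behavioral π.1) := by
    rintro ⟨π, hπ⟩
    obtain ⟨s, h1, h2⟩ := (hc π).exists_isMaxOn hπ (continuous_expect_outcome u π).continuousOn
    exact ⟨s, h1, fun s' h' => h2 h'⟩
  choose d hd hdm using hm
  obtain ⟨δ₀⟩ := nonemptyBehavioral T .leader
  obtain ⟨π₀, h₀⟩ := exists_bestResponse v δ₀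
  obtain ⟨s₀, rfl⟩ := Mixing.exists_behavioral_eq T δ₀
  have : Nonempty {π : T.Pure .follower // ∃ s : T.Mixing, π ∈ bestResponses v s.behavioral} :=
    ⟨⟨π₀, s₀, h₀⟩⟩
  obtain ⟨π, hπ⟩ := Finite.exists_max fun
    π : {π : T.Pure .follower // ∃ s : T.Mixing, π ∈ bestResponses v s.behavioral} =>
      expect u (T.outcome (d π).behavioral π.1)
  refine ⟨(d π).behavioral, π.1, hd π, fun δ' π' h' => ?_⟩
  obtain ⟨s', rfl⟩ := Mixing.exists_behavioral_eq T δ'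
  exact (hdm ⟨π', s', h'⟩ s' h').trans (hπ ⟨π', s', h'⟩)

/-! ### The maximin value -/

/-- By the next two lemmas this backward induction gives exactly what the leader can guarantee with
behavioral strategies against every reply. -/
noncomputable def maximin : (T : GameTree) → (T.Leaf → ℝ) → ℝ
  | .leaf, u => u ()
  | .node .leader _ child, u =>
    Finset.univ.sup' Finset.univ_nonempty fun j => (child j).maximin fun z => u ⟨j, z⟩
  | .node .follower _ child, u =>
    Finset.univ.inf' Finset.univ_nonempty fun j => (child j).maximin fun z => u ⟨j, z⟩

theorem exists_maximin_le : (T : GameTree) → (u : T.Leaf → ℝ) →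
    ∃ δ : T.Behavioral .leader, ∀ π, T.maximin u ≤ expect u (T.outcome δ π)
  | .leaf, u => ⟨(), fun π => by rw [expect_leaf]; simp [maximin, outcome]⟩
  | .node .leader k child, u => by
    choose d hd using fun j => exists_maximin_le (child j) fun z => u ⟨j, z⟩
    obtain ⟨j, -, hj⟩ := Finset.exists_mem_eq_sup' Finset.univ_nonempty
      fun j => (child j).maximin fun z => u ⟨j, z⟩
    refine ⟨leaderMove j d, fun π => ?_⟩
    rw [expect_leaderMove, maximin, hj]
    exact hd j _
  | .node .follower k child, u => by
    choose d hd using fun j => exists_maximin_le (child j) fun z => u ⟨j, z⟩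
    refine ⟨leaderWait d, fun π => ?_⟩
    rw [expect_follower, maximin]
    exact (Finset.inf'_le _ (Finset.mem_univ (π.1 rfl))).trans (hd _ _)

theorem exists_le_maximin : (T : GameTree) → (u : T.Leaf → ℝ) → (δ : T.Behavioral .leader) →
    ∃ π, expect u (T.outcome δ π) ≤ T.maximin u
  | .leaf, u, _ => ⟨(), by rw [expect_leaf]; simp [maximin, outcome]⟩
  | .node .leader k child, u, δ => by
    choose f hf using fun j => exists_le_maximin (child j) (fun z => u ⟨j, z⟩) (δ.2 j)
    refine ⟨followerWait f, ?_⟩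
    rw [expect_leader, maximin]
    set M := Finset.univ.sup' Finset.univ_nonempty fun j => (child j).maximin fun z => u ⟨j, z⟩
    calc _ ≤ ∑ j, weight δ j * M := by
          refine Finset.sum_le_sum fun j _ => mul_le_mul_of_nonneg_left ?_ (weight_nonneg δ j)
          exact (hf j).trans (Finset.le_sup' (fun j => (child j).maximin fun z => u ⟨j, z⟩)
            (Finset.mem_univ j))
      _ = M := by rw [← Finset.sum_mul, sum_weight, one_mul]
  | .node .follower k child, u, δ => by
    choose f hf using fun j => exists_le_maximin (child j) (fun z => u ⟨j, z⟩) (δ.2 j)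
    obtain ⟨j, -, hj⟩ := Finset.exists_mem_eq_inf' Finset.univ_nonempty
      fun j => (child j).maximin fun z => u ⟨j, z⟩
    refine ⟨followerMove j f, ?_⟩
    rw [expect_follower, maximin, hj]
    exact hf j

end GameTree

end Stackelberg

namespace Stackelberg

namespace GameTree

/-! ### What strongly inducible distributions look like -/

/-- `StronglyInduces` quantifies over all equilibria; their existence keeps it from being vacuous.
-/
theorem StronglyInduces.exists_isSSE {T : GameTree} {u v p : T.Leaf → ℝ}
    (h : StronglyInduces u v p) : ∃ δ π, IsSSE u v δ π ∧ T.outcome δ π = p := by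
  obtain ⟨δ, π, hS⟩ := GameTree.exists_isSSE u v
  exact ⟨δ, π, hS, h δ π hS⟩

theorem StronglyInduces.mem_stdSimplex {T : GameTree} {u v p : T.Leaf → ℝ}
    (h : StronglyInduces u v p) : p ∈ stdSimplex ℝ T.Leaf := by
  obtain ⟨δ, π, -, rfl⟩ := h.exists_isSSE
  exact outcome_mem_stdSimplex T δ π

/-- A commitment of the leader that does at least as well as the equilibria leads to their
outcome. -/
theorem StronglyInduces.outcome_eq {T : GameTree} {u v p : T.Leaf → ℝ}
    (h : StronglyInduces u v p) {δ : T.Behavioral .leader} {π : T.Pure .follower}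
    (hπ : π ∈ bestResponses v δ) (hp : expect u p ≤ expect u (T.outcome δ π)) :
    T.outcome δ π = p := by
  obtain ⟨δ₀, π₀, hS, rfl⟩ := h.exists_isSSE
  exact h δ π ⟨hπ, fun δ' π' h' => (hS.2 δ' π' h').trans hp⟩

theorem StronglyInduces.expect_le {T : GameTree} {u v p : T.Leaf → ℝ}
    (h : StronglyInduces u v p) {δ : T.Behavioral .leader} {π : T.Pure .follower}
    (hπ : π ∈ bestResponses v δ) : expect u (T.outcome δ π) ≤ expect u p := by
  obtain ⟨δ₀, π₀, hS, rfl⟩ := h.exists_isSSE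
  exact hS.2 δ π hπ

/-- A distribution that is the outcome of some best response and is the only outcome of best
responses that is as good for the leader is strongly induced. -/
theorem stronglyInduces_of_unique {T : GameTree} {u v p : T.Leaf → ℝ}
    (h1 : ∃ δ π, π ∈ bestResponses v δ ∧ T.outcome δ π = p)
    (h2 : ∀ δ π, π ∈ bestResponses v δ → expect u p ≤ expect u (T.outcome δ π) →
      T.outcome δ π = p) : StronglyInduces u v p := by
  obtain ⟨δ₀, π₀, hb, rfl⟩ := h1
  exact fun δ π hS => h2 δ π hS.1 (hS.2 δ₀ π₀ hb)

theorem exists_pos_of_mem_stdSimplex {T : GameTree} {p : T.Leaf → ℝ}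
    (h : p ∈ stdSimplex ℝ T.Leaf) : ∃ z, 0 < p z := by
  by_contra! hn
  have : ∑ z, p z ≤ 0 := Finset.sum_nonpos fun z _ => hn z
  linarith [h.2]

theorem expect_eq_of_support {o : Player} {k : ℕ} {child : Fin (k + 1) → GameTree}
    {j : Fin (k + 1)} {p : (node o k child).Leaf → ℝ} (hp : ∀ i ≠ j, ∀ z, p ⟨i, z⟩ = 0)
    (u : (node o k child).Leaf → ℝ) :
    expect u p = expect (T := child j) (fun z => u ⟨j, z⟩) (fun z => p ⟨j, z⟩) := by
  rw [expect_node, Finset.sum_eq_single j]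
  · intro i _ hi
    simp [hp i hi, expect]
  · simp

/-- Some child `j` reached with positive probability gives the leader at least the average. Moving
there for certain is then as good as the equilibrium, so it leads to the same outcome `p`, which
therefore lives below `j`. If another child had a maximin value of at least her payoff, moving there
and playing safe would also have to lead to `p`. -/
theorem StronglyInduces.leader_child {k : ℕ} {child : Fin (k + 1) → GameTree}
    {u v p : (node .leader k child).Leaf → ℝ} (h : StronglyInduces u v p) :
    ∃ j, (∀ i ≠ j, ∀ z, p ⟨i, z⟩ = 0) ∧
      StronglyInduces (T := child j) (fun z => u ⟨j, z⟩) (fun z => v ⟨j, z⟩)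
        (fun z => p ⟨j, z⟩) ∧
      ∀ i ≠ j, (child i).maximin (fun z => u ⟨i, z⟩) < expect u p := by
  obtain ⟨δ, π, hS, hp⟩ := h.exists_isSSE
  -- some child in the support is optimal for the leader
  obtain ⟨j, hj, hju⟩ : ∃ j, 0 < weight δ j ∧ expect u p ≤
      expect (fun z => u ⟨j, z⟩) ((child j).outcome (δ.2 j) (π.2 j)) := by
    by_contra! hn
    have hs : ∑ j, weight δ j * (expect u p -
        expect (fun z => u ⟨j, z⟩) ((child j).outcome (δ.2 j) (π.2 j))) = 0 := by
      simp only [mul_sub, Finset.sum_sub_distrib]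
      rw [← expect_leader, ← Finset.sum_mul, sum_weight, hp]
      ring
    obtain ⟨j, -, hj⟩ : ∃ j ∈ Finset.univ, weight δ j ≠ 0 := by
      refine Finset.exists_ne_zero_of_sum_ne_zero ?_
      rw [sum_weight]; exact one_ne_zero
    have hj := (weight_nonneg δ j).lt_of_ne' hj
    refine absurd hs (ne_of_gt (Finset.sum_pos' (fun i _ => ?_) ⟨j, Finset.mem_univ j, ?_⟩))
    · rcases (weight_nonneg δ i).eq_or_lt with h0 | h0
      · rw [← h0, zero_mul]
      · exact mul_nonneg h0.le (sub_nonneg.2 (hn i h0).le)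
    · exact mul_pos hj (sub_pos.2 (hn j hj))
  -- strategies in the child are strategies in the tree
  have lift : ∀ i (d : (child i).Behavioral .leader) (f : (child i).Pure .follower),
      f ∈ bestResponses (fun z => v ⟨i, z⟩) d →
      expect u p ≤ expect (fun z => u ⟨i, z⟩) ((child i).outcome d f) →
      ∀ i' z, p ⟨i', z⟩ = if hi : i' = i then (child i).outcome d f (hi ▸ z) else 0 := by
    intro i d f hf hu i' z
    have hb : followerWait (Function.update π.2 i f) ∈
        bestResponses v (leaderMove i (Function.update δ.2 i d)) :=
      bestResponse_leaderMove (by simpa using hf)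
    have hE := h.outcome_eq hb (by rw [expect_leaderMove]; simpa [followerWait] using hu)
    rw [← hE, outcome_leaderMove]
    by_cases hi : i' = i
    · subst hi; simp [followerWait]
    · simp [hi]
  have hπ := bestResponse_of_leader hS.1 j hj
  have hpj := lift j (δ.2 j) (π.2 j) hπ hju
  have hsupp : ∀ i ≠ j, ∀ z, p ⟨i, z⟩ = 0 := fun i hi z => by rw [hpj, dif_neg hi]
  have hpj' : (child j).outcome (δ.2 j) (π.2 j) = fun z => p ⟨j, z⟩ := by
    funext z; rw [hpj, dif_pos rfl]
  refine ⟨j, hsupp, ?_, ?_⟩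
  · intro d f hdf
    have := lift j d f hdf.1 (hju.trans (hdf.2 _ _ hπ))
    funext z
    rw [this, dif_pos rfl]
  · intro i hi
    by_contra! hle
    obtain ⟨d, hd⟩ := exists_maximin_le (child i) fun z => u ⟨i, z⟩
    obtain ⟨f, hf⟩ := exists_bestResponse (fun z => v ⟨i, z⟩) d
    have hpi := lift i d f hf (hle.trans (hd f))
    obtain ⟨z, hz⟩ := exists_pos_of_mem_stdSimplex (outcome_mem_stdSimplex (child i) d f)
    have := hpi i z
    rw [dif_pos rfl, hsupp i hi] at this
    exact hz.ne this

/-- Consider the child `i` in which the leader is least able to hold the follower down. By holding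
him down in all other children she makes moving to `i` a best response, whatever she does in `i`. If
`i = j`, equilibria of child `j` thus extend to the tree. If `i ≠ j`, safe play in `i` must give her
less than `p` does, since it leads to another outcome. -/
theorem StronglyInduces.follower_child {k : ℕ} {child : Fin (k + 1) → GameTree}
    {u v p : (node .follower k child).Leaf → ℝ} (h : StronglyInduces u v p) :
    ∃ j, (∀ i ≠ j, ∀ z, p ⟨i, z⟩ = 0) ∧
      (∃ δ π, (child j).outcome δ π = fun z => p ⟨j, z⟩) ∧
      (StronglyInduces (T := child j) (fun z => u ⟨j, z⟩) (fun z => v ⟨j, z⟩)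
        (fun z => p ⟨j, z⟩) ∨
      ∃ i ≠ j, (child i).maximin (fun z => u ⟨i, z⟩) < expect u p) := by
  obtain ⟨δ, π, hS, hp⟩ := h.exists_isSSE
  set j := π.1 rfl with hj
  have hsupp : ∀ i ≠ j, ∀ z, p ⟨i, z⟩ = 0 := fun i hi z => by
    rw [← hp, outcome_follower, if_neg hi]
  have hpj : (child j).outcome (δ.2 j) (π.2 j) = fun z => p ⟨j, z⟩ := by
    funext z; rw [← hp, outcome_follower, if_pos hj]
  refine ⟨j, hsupp, ⟨_, _, hpj⟩, ?_⟩
  by_contra! hn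
  obtain ⟨hnS, hnm⟩ := hn
  -- the payoff to which the leader can hold the follower down in child `i`
  set t : Fin (k + 1) → ℝ := fun i => -(child i).maximin fun z => -v ⟨i, z⟩ with ht
  have hneg : ∀ i (d : (child i).Behavioral .leader) f, expect (fun z => -v ⟨i, z⟩)
      ((child i).outcome d f) = -expect (fun z => v ⟨i, z⟩) ((child i).outcome d f) := by
    intro i d f
    simp [expect]
  have hlow : ∀ i, ∃ d : (child i).Behavioral .leader, ∀ f,
      expect (fun z => v ⟨i, z⟩) ((child i).outcome d f) ≤ t i := by
    intro i
    obtain ⟨d, hd⟩ := exists_maximin_le (child i) fun z => -v ⟨i, z⟩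
    refine ⟨d, fun f => ?_⟩
    have := hd f
    rw [hneg] at this
    simp only [ht]; linarith
  have hhigh : ∀ i (d : (child i).Behavioral .leader) f,
      f ∈ bestResponses (fun z => v ⟨i, z⟩) d →
      t i ≤ expect (fun z => v ⟨i, z⟩) ((child i).outcome d f) := by
    intro i d f hf
    obtain ⟨f', hf'⟩ := exists_le_maximin (child i) (fun z => -v ⟨i, z⟩) d
    rw [hneg] at hf'
    have := hf f'
    simp only [ht]; linarith
  choose low hlow using hlow
  -- In the other children the leader uses `low`, so that each is worth at most `t i` to the
  -- follower, and he can get that much in child `i` against any `d`.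
  have lift : ∀ i (d : (child i).Behavioral .leader) (f : (child i).Pure .follower),
      (∀ i', t i' ≤ t i) → f ∈ bestResponses (fun z => v ⟨i, z⟩) d →
      expect u p ≤ expect (fun z => u ⟨i, z⟩) ((child i).outcome d f) →
      ∀ i' z, p ⟨i', z⟩ = if hi : i' = i then (child i).outcome d f (hi ▸ z) else 0 := by
    intro i d f hti hf hu i' z
    have hb : followerMove i (Function.update π.2 i f) ∈
        bestResponses v (leaderWait (Function.update low i d)) := by
      rw [mem_bestResponses_follower]
      intro l f'
      simp only [followerMove, leaderWait, Function.update_self]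
      by_cases hl : l = i
      · subst hl
        rw [Function.update_self]
        exact hf f'
      · rw [Function.update_of_ne hl]
        exact (hlow l f').trans ((hti l).trans (hhigh i d f hf))
    have hE := h.outcome_eq hb (by
      rw [expect_follower]
      simpa [followerMove, leaderWait] using hu)
    rw [← hE, outcome_follower]
    by_cases hi : i' = i
    · subst hi; simp [followerMove, leaderWait]
    · simp [followerMove, hi]
  obtain ⟨i, hi⟩ := Finite.exists_max t
  by_cases hij : i = j
  · subst hij
    refine hnS fun d f hdf => ?_
    have hpu := expect_eq_of_support hsupp u
    have hbj : π.2 j ∈ bestResponses (fun z => v ⟨j, z⟩) (δ.2 j) := fun f' =>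
      mem_bestResponses_follower.1 hS.1 j f'
    have := lift j d f hi hdf.1 (by rw [hpu, ← hpj]; exact hdf.2 _ _ hbj)
    funext z
    rw [this, dif_pos rfl]
  · obtain ⟨d, hd⟩ := exists_maximin_le (child i) fun z => u ⟨i, z⟩
    obtain ⟨f, hf⟩ := exists_bestResponse (fun z => v ⟨i, z⟩) d
    have hpi := lift i d f hi hf ((hnm i hij).trans (hd f))
    obtain ⟨z, hz⟩ := exists_pos_of_mem_stdSimplex (outcome_mem_stdSimplex (child i) d f)
    have := hpi i z
    rw [dif_pos rfl, hsupp i hij] at this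
    exact hz.ne this

/-! ### Payoff functions that strongly induce a distribution -/

/-- Whatever the leader commits to, the follower can get more than `c`. -/
def Secures {T : GameTree} (v : T.Leaf → ℝ) (c : ℝ) : Prop :=
  ∀ δ : T.Behavioral .leader, ∃ π, c < expect v (T.outcome δ π)

/-- In the children other than `j` the game is zero-sum up to a constant, so a best response holds
the leader to their maximin values, which are too small; in child `j` she gets at most what `p`
gives. An average as good as `p` must put all its weight on `j`. -/
theorem stronglyInduces_leader {k : ℕ} {child : Fin (k + 1) → GameTree}
    {u v p : (node .leader k child).Leaf → ℝ} {j : Fin (k + 1)}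
    (hsupp : ∀ i ≠ j, ∀ z, p ⟨i, z⟩ = 0)
    (hj : StronglyInduces (T := child j) (fun z => u ⟨j, z⟩) (fun z => v ⟨j, z⟩)
      (fun z => p ⟨j, z⟩))
    (hv : ∀ i ≠ j, ∃ c, ∀ z, v ⟨i, z⟩ = c - u ⟨i, z⟩)
    (hm : ∀ i ≠ j, (child i).maximin (fun z => u ⟨i, z⟩) < expect u p) :
    StronglyInduces u v p := by
  have hpu := expect_eq_of_support hsupp u
  refine stronglyInduces_of_unique ?_ ?_
  · obtain ⟨d, f, hS, hp⟩ := hj.exists_isSSE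
    obtain ⟨d'⟩ : Nonempty (∀ i, (child i).Behavioral .leader) := inferInstance
    obtain ⟨f'⟩ : Nonempty (∀ i, (child i).Pure .follower) := inferInstance
    refine ⟨leaderMove j (Function.update d' j d), followerWait (Function.update f' j f),
      bestResponse_leaderMove (by simpa using hS.1), ?_⟩
    funext ⟨i, z⟩
    rw [outcome_leaderMove]
    by_cases hi : i = j
    · subst hi
      simpa [followerWait] using congrFun hp z
    · rw [if_neg hi, hsupp i hi]
  · intro δ π hπ hle
    have hlt : ∀ i ≠ j, 0 < weight δ i →
        expect (fun z => u ⟨i, z⟩) ((child i).outcome (δ.2 i) (π.2 i)) < expect u p := by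
      intro i hi hw
      obtain ⟨c, hc⟩ := hv i hi
      obtain ⟨f, hf⟩ := exists_le_maximin (child i) (fun z => u ⟨i, z⟩) (δ.2 i)
      have := bestResponse_of_leader hπ i hw f
      simp only [hc, expect_sub_const] at this
      linarith [hm i hi]
    have hlej : 0 < weight δ j →
        expect (fun z => u ⟨j, z⟩) ((child j).outcome (δ.2 j) (π.2 j)) ≤ expect u p := by
      intro hw
      rw [hpu]
      exact hj.expect_le (bestResponse_of_leader hπ j hw)
    have hterm : ∀ i, 0 ≤ weight δ i * (expect u p -
        expect (fun z => u ⟨i, z⟩) ((child i).outcome (δ.2 i) (π.2 i))) := by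
      intro i
      rcases (weight_nonneg δ i).eq_or_lt with h0 | h0
      · rw [← h0, zero_mul]
      · refine mul_nonneg h0.le (sub_nonneg.2 ?_)
        by_cases hi : i = j
        · subst hi; exact hlej h0
        · exact (hlt i hi h0).le
    have hsum : ∑ i, weight δ i * (expect u p -
        expect (fun z => u ⟨i, z⟩) ((child i).outcome (δ.2 i) (π.2 i))) = 0 := by
      refine le_antisymm ?_ (Finset.sum_nonneg fun i _ => hterm i)
      simp only [mul_sub, Finset.sum_sub_distrib]
      rw [← expect_leader, ← Finset.sum_mul, sum_weight]
      linarith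
    have hzero := (Finset.sum_eq_zero_iff_of_nonneg fun i _ => hterm i).1 hsum
    have hw0 : ∀ i ≠ j, weight δ i = 0 := by
      intro i hi
      by_contra hne
      have hpos := (weight_nonneg δ i).lt_of_ne' hne
      rcases mul_eq_zero.1 (hzero i (Finset.mem_univ i)) with h0 | h0
      · exact hne h0
      · linarith [hlt i hi hpos]
    have hw1 : weight δ j = 1 := by
      rw [← sum_weight δ, Finset.sum_eq_single j (fun i _ hi => hw0 i hi) (by simp)]
    have hEj : (child j).outcome (δ.2 j) (π.2 j) = fun z => p ⟨j, z⟩ := by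
      refine hj.outcome_eq (bestResponse_of_leader hπ j (by rw [hw1]; exact one_pos)) ?_
      have := hzero j (Finset.mem_univ j)
      rw [hw1, one_mul] at this
      rw [← hpu]
      linarith
    funext ⟨i, z⟩
    rw [outcome_leader]
    by_cases hi : i = j
    · subst hi
      rw [hw1, one_mul, hEj]
    · rw [hw0 i hi, zero_mul, hsupp i hi]

theorem Secures.leader {k : ℕ} {child : Fin (k + 1) → GameTree}
    {v : (node .leader k child).Leaf → ℝ} {c : ℝ}
    (h : ∀ j, Secures (T := child j) (fun z => v ⟨j, z⟩) c) : Secures v c := by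
  intro δ
  choose f hf using fun j => h j (δ.2 j)
  refine ⟨followerWait f, ?_⟩
  rw [expect_leader, ← sub_pos]
  have : ∑ j, weight δ j * (expect (fun z => v ⟨j, z⟩) ((child j).outcome (δ.2 j) (f j)) - c)
      = (∑ j, weight δ j * expect (fun z => v ⟨j, z⟩) ((child j).outcome (δ.2 j) (f j))) - c := by
    simp only [mul_sub, Finset.sum_sub_distrib]
    rw [← Finset.sum_mul, sum_weight, one_mul]
  refine lt_of_lt_of_eq ?_ this
  obtain ⟨j, -, hj⟩ : ∃ j ∈ Finset.univ, weight δ j ≠ 0 := by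
    refine Finset.exists_ne_zero_of_sum_ne_zero ?_
    rw [sum_weight]; exact one_ne_zero
  exact Finset.sum_pos' (fun i _ => mul_nonneg (weight_nonneg δ i) (sub_pos.2 (hf i)).le)
    ⟨j, Finset.mem_univ j, mul_pos ((weight_nonneg δ j).lt_of_ne' hj) (sub_pos.2 (hf j))⟩

theorem Secures.follower {k : ℕ} {child : Fin (k + 1) → GameTree}
    {v : (node .follower k child).Leaf → ℝ} {c : ℝ} {j : Fin (k + 1)}
    (h : Secures (T := child j) (fun z => v ⟨j, z⟩) c) : Secures v c := by
  intro δ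
  obtain ⟨f, hf⟩ := h (δ.2 j)
  refine ⟨followerMove j (fun i => if hi : i = j then hi ▸ f
    else (nonemptyPure (child i) .follower).some), ?_⟩
  rw [expect_follower]
  simpa [followerMove] using hf

/-- The subtraction from the maximin value normalises the zero-sum game so that the follower can
always get at least `0`. -/
theorem secures_of_sub {T : GameTree} {u v : T.Leaf → ℝ} {c : ℝ}
    (hv : ∀ z, v z = T.maximin u - u z) (hc : c < 0) : Secures v c := by
  intro δ
  obtain ⟨f, hf⟩ := exists_le_maximin T u δ
  refine ⟨f, ?_⟩
  rw [show v = fun z => T.maximin u - u z from funext hv, expect_sub_const]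
  linarith

/-- Against every commitment the follower can get more than `c` in child `j`, whereas the siblings
pay exactly `c`. He always moves to `j`, and the siblings play no role. -/
theorem stronglyInduces_follower {k : ℕ} {child : Fin (k + 1) → GameTree}
    {u v p : (node .follower k child).Leaf → ℝ} {j : Fin (k + 1)} {c : ℝ}
    (hsupp : ∀ i ≠ j, ∀ z, p ⟨i, z⟩ = 0)
    (hj : StronglyInduces (T := child j) (fun z => u ⟨j, z⟩) (fun z => v ⟨j, z⟩)
      (fun z => p ⟨j, z⟩))
    (hs : Secures (T := child j) (fun z => v ⟨j, z⟩) c)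
    (hv : ∀ i ≠ j, ∀ z, v ⟨i, z⟩ = c) : StronglyInduces u v p := by
  have hpu := expect_eq_of_support hsupp u
  have hvc : ∀ i ≠ j, ∀ d f, expect (fun z => v ⟨i, z⟩) ((child i).outcome d f) = c := by
    intro i hi d f
    simp only [hv i hi, expect_const]
  refine stronglyInduces_of_unique ?_ ?_
  · obtain ⟨d, f, hS, hp⟩ := hj.exists_isSSE
    obtain ⟨d'⟩ : Nonempty (∀ i, (child i).Behavioral .leader) := inferInstance
    obtain ⟨f'⟩ : Nonempty (∀ i, (child i).Pure .follower) := inferInstance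
    refine ⟨leaderWait (Function.update d' j d), followerMove j (Function.update f' j f), ?_, ?_⟩
    · rw [mem_bestResponses_follower]
      intro i f''
      simp only [followerMove, leaderWait, Function.update_self]
      by_cases hi : i = j
      · subst hi
        rw [Function.update_self]
        exact hS.1 f''
      · rw [hvc i hi]
        obtain ⟨f₁, hf₁⟩ := hs d
        exact hf₁.le.trans (hS.1 f₁)
    · funext ⟨i, z⟩
      rw [outcome_follower]
      by_cases hi : i = j
      · subst hi
        simpa [followerMove, leaderWait] using congrFun hp z
      · rw [if_neg (by simpa [followerMove] using hi), hsupp i hi]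
  · intro δ π hπ hle
    rw [mem_bestResponses_follower] at hπ
    have hπj : π.1 rfl = j := by
      by_contra hne
      obtain ⟨f, hf⟩ := hs (δ.2 j)
      have := hπ j f
      rw [hvc _ hne] at this
      linarith
    have hb : π.2 j ∈ bestResponses (fun z => v ⟨j, z⟩) (δ.2 j) := by
      intro f'
      have := hπ j f'
      rw [hπj] at this
      exact this
    rw [expect_follower, hπj, hpu] at hle
    have hEj := hj.outcome_eq hb hle
    funext ⟨i, z⟩
    rw [outcome_follower, hπj]
    by_cases hi : i = j
    · subst hi
      rw [if_pos rfl, hEj]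
    · rw [if_neg hi, hsupp i hi]

/-- The follower threatens to move to child `i`, where his interests are opposed to those of the
leader, unless he gets a nonnegative payoff in child `j`. -/
theorem stronglyInduces_threat {k : ℕ} {child : Fin (k + 1) → GameTree}
    {u v p : (node .follower k child).Leaf → ℝ} {i j : Fin (k + 1)} {c : ℝ}
    (hij : i ≠ j) (hc : c < 0)
    (hsupp : ∀ l ≠ j, ∀ z, p ⟨l, z⟩ = 0)
    (hp : ∃ d f, (child j).outcome d f = (fun z => p ⟨j, z⟩) ∧
      expect (fun z => v ⟨j, z⟩) ((child j).outcome d f) = 0 ∧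
      ∀ f', expect (fun z => v ⟨j, z⟩) ((child j).outcome d f') ≤ 0)
    (hj : ∀ d f, 0 ≤ expect (fun z => v ⟨j, z⟩) ((child j).outcome d f) →
      expect u p ≤ expect (fun z => u ⟨j, z⟩) ((child j).outcome d f) →
      (child j).outcome d f = fun z => p ⟨j, z⟩)
    (hi : ∀ z, v ⟨i, z⟩ = (child i).maximin (fun z => u ⟨i, z⟩) - u ⟨i, z⟩)
    (hm : (child i).maximin (fun z => u ⟨i, z⟩) < expect u p)
    (hl : ∀ l, l ≠ i → l ≠ j → ∀ z, v ⟨l, z⟩ = c) : StronglyInduces u v p := by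
  have hvc : ∀ l, l ≠ i → l ≠ j → ∀ d f,
      expect (fun z => v ⟨l, z⟩) ((child l).outcome d f) = c := by
    intro l hli hlj d f
    simp only [hl l hli hlj, expect_const]
  have hvi : ∀ d f, expect (fun z => v ⟨i, z⟩) ((child i).outcome d f) =
      (child i).maximin (fun z => u ⟨i, z⟩) -
        expect (fun z => u ⟨i, z⟩) ((child i).outcome d f) := by
    intro d f
    simp only [hi, expect_sub_const]
  refine stronglyInduces_of_unique ?_ ?_
  · obtain ⟨d, f, hE, h0, hf⟩ := hp
    -- With maximin strategies elsewhere, the follower gets at most `0` in child `i`, so that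
    -- staying in `j` with payoff `0` is a best response.
    choose d' hd' using fun l => exists_maximin_le (child l) fun z => u ⟨l, z⟩
    obtain ⟨f'⟩ : Nonempty (∀ i, (child i).Pure .follower) := inferInstance
    refine ⟨leaderWait (Function.update d' j d), followerMove j (Function.update f' j f), ?_, ?_⟩
    · rw [mem_bestResponses_follower]
      intro l f''
      simp only [followerMove, leaderWait, Function.update_self, h0]
      by_cases hlj : l = j
      · subst hlj
        rw [Function.update_self]
        exact hf f''
      · rw [Function.update_of_ne hlj]
        by_cases hli : l = i
        · subst hli
          rw [hvi]
          linarith [hd' l f'']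
        · rw [hvc l hli hlj]
          exact hc.le
    · funext ⟨l, z⟩
      rw [outcome_follower]
      by_cases hlj : l = j
      · subst hlj
        simpa [followerMove, leaderWait] using congrFun hE z
      · rw [if_neg (by simpa [followerMove] using hlj), hsupp l hlj]
  · intro δ π hπ hle
    rw [mem_bestResponses_follower] at hπ
    rw [expect_follower] at hle
    -- Child `i` offers the follower at least `0` against any commitment. So a best response that
    -- moves to `j` is covered by `hj`, one that moves to `i` holds the leader to the maximin value,
    -- and a third child with payoff `c < 0` is out of the question.
    obtain ⟨f, hf⟩ := exists_le_maximin (child i) (fun z => u ⟨i, z⟩) (δ.2 i)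
    have h0 := hπ i f
    rw [hvi] at h0
    by_cases hπj : π.1 rfl = j
    · rw [hπj] at h0 hle
      have hEj := hj _ _ (by linarith) hle
      funext ⟨l, z⟩
      rw [outcome_follower, hπj]
      by_cases hlj : l = j
      · subst hlj
        rw [if_pos rfl, hEj]
      · rw [if_neg hlj, hsupp l hlj]
    · exfalso
      by_cases hπi : π.1 rfl = i
      · rw [hπi, hvi] at h0
        rw [hπi] at hle
        linarith
      · rw [hvc _ hπi hπj] at h0
        linarith

end GameTree

end Stackelberg

namespace Stackelberg

/-! ### Mixtures of two points -/

/-- A convex combination of points in the plane is dominated by a convex combination of at most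
two of them. -/
theorem exists_pair_dominating {ι : Type*} [Fintype ι] {w : ι → ℝ} (hw : w ∈ stdSimplex ℝ ι)
    (x y : ι → ℝ) : ∃ i j, 0 < w i ∧ 0 < w j ∧ ∃ t : ℝ, 0 ≤ t ∧ t ≤ 1 ∧
      ∑ k, x k * w k ≤ t * x i + (1 - t) * x j ∧ ∑ k, y k * w k ≤ t * y i + (1 - t) * y j := by
  classical
  obtain ⟨hw0, hw1⟩ := hw
  set X := ∑ k, x k * w k with hX
  set Y := ∑ k, y k * w k with hY
  by_contra! hn
  have h1 : ∀ k, 0 < w k → X ≤ x k → y k < Y := by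
    intro k hk hxk
    have := hn k k hk hk 1 zero_le_one le_rfl (by linarith)
    linarith
  -- The mixture of `i` and `j` whose first coordinate is exactly `X` must have a second coordinate
  -- below `Y`; the inequality is this statement without the denominator.
  have h2 : ∀ i j, 0 < w i → 0 < w j → X ≤ x i → x j < X →
      (y i - Y) * (X - x j) + (y j - Y) * (x i - X) < 0 := by
    intro i j hi hj hxi hxj
    have hd : 0 < x i - x j := by linarith
    have := hn i j hi hj ((X - x j) / (x i - x j)) (by apply div_nonneg <;> linarith)
      (by rw [div_le_one hd]; linarith) (le_of_eq (by field_simp; ring))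
    have h3 : (X - x j) / (x i - x j) * y i + (1 - (X - x j) / (x i - x j)) * y j - Y =
      ((y i - Y) * (X - x j) + (y j - Y) * (x i - X)) / (x i - x j) := by field_simp; ring
    by_contra! h4
    have := div_nonneg h4 hd.le
    linarith
  have hsx : ∑ k, w k * (x k - X) = 0 := by
    simp only [mul_sub, Finset.sum_sub_distrib, ← Finset.sum_mul, hw1]
    simp only [mul_comm (w _)]; linarith
  have hsy : ∑ k, w k * (y k - Y) = 0 := by
    simp only [mul_sub, Finset.sum_sub_distrib, ← Finset.sum_mul, hw1]
    simp only [mul_comm (w _)]; linarith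
  obtain ⟨k₀, -, hk₀⟩ : ∃ k ∈ Finset.univ, w k ≠ 0 :=
    Finset.exists_ne_zero_of_sum_ne_zero (by rw [hw1]; exact one_ne_zero)
  have hk₀ := (hw0 k₀).lt_of_ne' hk₀
  obtain ⟨i₀, hi₀, hxi₀⟩ : ∃ i, 0 < w i ∧ X ≤ x i := by
    by_contra! h
    refine absurd hsx (ne_of_lt (Finset.sum_neg' (fun k _ => ?_) ⟨k₀, Finset.mem_univ _, ?_⟩))
    · rcases (hw0 k).eq_or_lt with h0 | h0
      · rw [← h0, zero_mul]
      · exact (mul_neg_of_pos_of_neg h0 (by linarith [h k h0])).le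
    · exact mul_neg_of_pos_of_neg hk₀ (by linarith [h k₀ hk₀])
  obtain ⟨j₀, hj₀, hxj₀⟩ : ∃ j, 0 < w j ∧ x j < X := by
    by_contra! h
    refine absurd hsy (ne_of_lt (Finset.sum_neg' (fun k _ => ?_) ⟨k₀, Finset.mem_univ _, ?_⟩))
    · rcases (hw0 k).eq_or_lt with h0 | h0
      · rw [← h0, zero_mul]
      · exact (mul_neg_of_pos_of_neg h0 (by linarith [h1 k h0 (h k h0)])).le
    · exact mul_neg_of_pos_of_neg hk₀ (by linarith [h1 k₀ hk₀ (h k₀ hk₀)])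
  set A := Finset.univ.filter fun k => X ≤ x k with hA
  set D := Finset.univ.filter fun k => ¬ X ≤ x k with hD
  -- Deviations from the mean sum to zero, so over `A` and `D` they have opposite sums in each
  -- coordinate, and the double sum of the cross terms cancels. By `h2` it ought to be negative.
  have hzero : ∑ i ∈ A, ∑ j ∈ D,
      w i * w j * ((y i - Y) * (X - x j) + (y j - Y) * (x i - X)) = 0 := by
    have e : ∀ i j, w i * w j * ((y i - Y) * (X - x j) + (y j - Y) * (x i - X)) =
        w i * (x i - X) * (w j * (y j - Y)) - w i * (y i - Y) * (w j * (x j - X)) := by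
      intro i j; ring
    simp only [e, Finset.sum_sub_distrib, ← Finset.mul_sum, ← Finset.sum_mul]
    rw [← Finset.sum_filter_add_sum_filter_not Finset.univ fun k => X ≤ x k] at hsx hsy
    rw [← hA, ← hD] at hsx hsy
    rw [eq_neg_of_add_eq_zero_right hsx, eq_neg_of_add_eq_zero_right hsy]
    ring
  have hterm : ∀ i ∈ A, ∀ j ∈ D,
      w i * w j * ((y i - Y) * (X - x j) + (y j - Y) * (x i - X)) ≤ 0 := by
    intro i hi j hj
    simp only [hA, hD, Finset.mem_filter, Finset.mem_univ, true_and, not_le] at hi hj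
    rcases (hw0 i).eq_or_lt with h0 | h0
    · rw [← h0, zero_mul, zero_mul]
    rcases (hw0 j).eq_or_lt with h0' | h0'
    · rw [← h0', mul_zero, zero_mul]
    exact (mul_neg_of_pos_of_neg (mul_pos h0 h0') (h2 i j h0 h0' hi hj)).le
  refine absurd hzero (ne_of_lt (Finset.sum_neg' (fun i hi => Finset.sum_nonpos (hterm i hi))
    ⟨i₀, by simp [hA, hxi₀], Finset.sum_neg' (hterm i₀ (by simp [hA, hxi₀]))
      ⟨j₀, by simp [hD, hxj₀], ?_⟩⟩))
  exact mul_neg_of_pos_of_neg (mul_pos hi₀ hj₀) (h2 i₀ j₀ hi₀ hj₀ hxi₀ hxj₀)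

namespace GameTree

/-- The follower cannot increase the probability of a terminal node that he allows. -/
theorem outcome_le_of_pos : (T : GameTree) → (δ : T.Behavioral .leader) →
    (π π' : T.Pure .follower) → (z : T.Leaf) → 0 < T.outcome δ π z →
    T.outcome δ π' z ≤ T.outcome δ π z
  -- If `z` has positive probability, then the follower's choices on the path all lead to `z`, and
  -- its probability is the product of the leader's weights. Any other reply gives this product or
  -- `0`.
  | .leaf, _, _, _, _, _ => le_rfl
  | .node .leader k child, δ, π, π', ⟨j, z⟩, h => by
    rw [outcome_leader] at h ⊢
    rw [outcome_leader]
    refine mul_le_mul_of_nonneg_left (outcome_le_of_pos (child j) _ _ _ z ?_) (weight_nonneg δ j)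
    exact pos_of_mul_pos_right h (weight_nonneg δ j)
  | .node .follower k child, δ, π, π', ⟨j, z⟩, h => by
    rw [outcome_follower] at h ⊢
    rw [outcome_follower]
    by_cases h1 : j = π.1 rfl
    · rw [if_pos h1] at h ⊢
      split_ifs
      · exact outcome_le_of_pos (child j) _ _ _ z h
      · exact h.le
    · rw [if_neg h1] at h
      exact absurd h (lt_irrefl _)

/-! ### Positions in a tree -/

section Positions

variable {o : Player} {k : ℕ} {child : Fin (k + 1) → GameTree}

theorem size_pos : (T : GameTree) → 0 < T.size
  | .leaf => one_pos
  | .node _ _ _ => by simp only [size]; omega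

theorem one_le_childPos (child : Fin (k + 1) → GameTree) (j : Fin (k + 1)) :
    1 ≤ childPos child j := by
  unfold childPos; omega

theorem childPos_add_size (child : Fin (k + 1) → GameTree) (j : Fin (k + 1)) :
    childPos child j + (child j).size =
      1 + ∑ l ∈ Finset.univ.filter (· ≤ j), (child l).size := by
  have : Finset.univ.filter (· ≤ j) = insert j (Finset.univ.filter (· < j)) := by
    ext l; simp [le_iff_eq_or_lt]
  rw [this, Finset.sum_insert (by simp), childPos]
  omega

theorem childPos_add_size_le (child : Fin (k + 1) → GameTree) {i j : Fin (k + 1)} (h : i < j) :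
    childPos child i + (child i).size ≤ childPos child j := by
  rw [childPos_add_size, childPos]
  refine Nat.add_le_add_left (Finset.sum_le_sum_of_subset fun l hl => ?_) 1
  simp only [Finset.mem_filter, Finset.mem_univ, true_and] at hl ⊢
  exact lt_of_le_of_lt hl h

theorem childPos_add_size_le_size (o : Player) (child : Fin (k + 1) → GameTree)
    (j : Fin (k + 1)) : childPos child j + (child j).size ≤ (node o k child).size := by
  rw [childPos_add_size, size]
  exact Nat.add_le_add_left (Finset.sum_le_sum_of_subset (Finset.filter_subset _ _)) 1

/-- The last child that starts no later than `r` is the right one, because the intervals of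
consecutive children abut. -/
theorem exists_childPos_le {r : ℕ} (h0 : 0 < r) (hr : r < (node o k child).size) :
    ∃ j, childPos child j ≤ r ∧ r < childPos child j + (child j).size := by
  have hne : (Finset.univ.filter fun j => childPos child j ≤ r).Nonempty :=
    by
    refine ⟨0, Finset.mem_filter.2 ⟨Finset.mem_univ _, ?_⟩⟩
    rw [childPos, Finset.filter_false_of_mem fun l _ => Fin.not_lt_zero l]
    simpa using Nat.succ_le_of_lt h0
  obtain ⟨j, hj, hmax⟩ := Finset.exists_max_image _ id hne
  simp only [Finset.mem_filter, Finset.mem_univ, true_and, id] at hj hmax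
  refine ⟨j, hj, ?_⟩
  by_contra! hle
  rw [childPos_add_size] at hle
  by_cases hlast : j = Fin.last k
  · subst hlast
    rw [Finset.filter_true_of_mem fun l _ => Fin.le_last l] at hle
    simp only [size] at hr
    omega
  · have hlt : j.1 < k := Fin.val_lt_last hlast
    have hs : childPos child ⟨j.1 + 1, by omega⟩ =
        1 + ∑ l ∈ Finset.univ.filter (· ≤ j), (child l).size := by
      rw [childPos]
      congr 2
      ext l
      simp only [Finset.mem_filter, Finset.mem_univ, true_and, Fin.lt_def, Fin.le_def]
      omega
    have := hmax ⟨j.1 + 1, by omega⟩ (by rw [hs]; exact hle)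
    rw [Fin.le_def] at this
    simp at this

theorem leafPos_lt_size : (T : GameTree) → (z : T.Leaf) → T.leafPos z < T.size
  | .leaf, _ => one_pos
  | .node o k child, ⟨j, z⟩ => by
    have h1 := leafPos_lt_size (child j) z
    have h2 := childPos_add_size_le_size o child j
    simp only [leafPos]
    omega

theorem leafPos_injective : (T : GameTree) → Function.Injective T.leafPos
  | .leaf => fun _ _ _ => rfl
  | .node o k child => by
    rintro ⟨i, z⟩ ⟨j, z'⟩ h
    simp only [leafPos] at h
    have h1 := leafPos_lt_size (child i) z
    have h2 := leafPos_lt_size (child j) z'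
    rcases lt_trichotomy i j with hij | rfl | hij
    · have := childPos_add_size_le child hij; omega
    · rw [leafPos_injective (child i) (by omega : (child i).leafPos z = (child i).leafPos z')]
    · have := childPos_add_size_le child hij; omega

/-- The restriction of a function of positions to the terminal nodes of a tree whose root is at
position `pos`. -/
def atLeaves {α : Type*} (f : ℕ → α) (T : GameTree) (pos : ℕ) : T.Leaf → α :=
  fun z => f (pos + T.leafPos z)

theorem atLeaves_child {α : Type*} (f : ℕ → α) (pos : ℕ) (j : Fin (k + 1)) :
    (fun z => atLeaves f (node o k child) pos ⟨j, z⟩) =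
      atLeaves f (child j) (pos + childPos child j) := by
  funext z
  simp [atLeaves, leafPos, add_assoc]

theorem atLeaves_node {α : Type*} (f : ℕ → α) (pos : ℕ) (j : Fin (k + 1)) (z : (child j).Leaf) :
    atLeaves f (node o k child) pos ⟨j, z⟩ = f (pos + childPos child j + (child j).leafPos z) :=
  congrFun (atLeaves_child f pos j) z

end Positions

end GameTree

/-! ### Game trees in arrays -/

/-- The kinds and parents of nodes, the position behind the last node of a subtree, the payoffs of
the leader at terminal nodes, and her maximin values. -/
structure Arrays where
  kind : ℕ → ℕ
  parent : ℕ → ℕ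
  past : ℕ → ℕ
  pay : ℕ → ℝ
  value : ℕ → ℝ

namespace Arrays

open GameTree

/-- The arrays describe, from position `pos` on, the given tree. -/
def Fits (A : Arrays) : GameTree → ℕ → Prop
  | .leaf, pos => A.kind pos = 0 ∧ A.past pos = pos + 1 ∧ A.value pos = A.pay pos
  | .node o k child, pos => A.kind pos = o.code ∧ A.past pos = pos + (node o k child).size ∧
      A.value pos = (node o k child).maximin (atLeaves A.pay _ pos) ∧
      ∀ j, A.parent (pos + childPos child j) = pos ∧ A.Fits (child j) (pos + childPos child j)

variable {A : Arrays}

theorem Fits.past_eq {T : GameTree} {pos : ℕ} (h : A.Fits T pos) : A.past pos = pos + T.size := by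
  cases T with
  | leaf => exact h.2.1
  | node o k child => exact h.2.1

theorem Fits.value_eq {T : GameTree} {pos : ℕ} (h : A.Fits T pos) :
    A.value pos = T.maximin (atLeaves A.pay T pos) := by
  cases T with
  | leaf => exact h.2.2
  | node o k child => exact h.2.2.1

theorem Fits.exists_child {o : Player} {k : ℕ} {child : Fin (k + 1) → GameTree} {pos w : ℕ}
    (_ : A.Fits (node o k child) pos) (h1 : pos < w) (h2 : w < pos + (node o k child).size) :
    ∃ j, pos + childPos child j ≤ w ∧ w < pos + childPos child j + (child j).size := by
  obtain ⟨j, hj⟩ := exists_childPos_le (o := o) (child := child) (r := w - pos) (by omega)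
    (by omega)
  exact ⟨j, by omega, by omega⟩

/-- In preorder each subtree is an interval contained in those of its ancestors, and parents precede
their children. With these inequalities questions about ancestry become linear arithmetic. -/
theorem Fits.bounds : {T : GameTree} → {pos : ℕ} → A.Fits T pos → ∀ {w : ℕ}, pos ≤ w →
    w < pos + T.size → w < A.past w ∧ A.past w ≤ pos + T.size ∧
      (pos < w → pos ≤ A.parent w ∧ A.parent w < w)
  | .leaf, pos, h, w, h1, h2 => by
    obtain rfl : w = pos := by simp only [size] at h2; omega
    rw [h.past_eq]
    exact ⟨by simp [size], le_rfl, fun h => absurd h (lt_irrefl _)⟩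
  | .node o k child, pos, h, w, h1, h2 => by
    rcases h1.eq_or_lt with rfl | h1
    · rw [h.past_eq]
      exact ⟨by simp only [size]; omega, le_rfl, fun h => absurd h (lt_irrefl _)⟩
    · obtain ⟨j, hj1, hj2⟩ := h.exists_child h1 h2
      have hj := h.2.2.2 j
      have hb := hj.2.bounds hj1 hj2
      have hs := childPos_add_size_le_size o child j
      have hc := one_le_childPos child j
      refine ⟨hb.1, by omega, fun _ => ?_⟩
      rcases hj1.eq_or_lt with rfl | hj1
      · rw [hj.1]; omega
      · have := hb.2.2 hj1
        omega

/-- The child in whose subtree a node lies. -/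
theorem Fits.child_cases {o : Player} {k : ℕ} {child : Fin (k + 1) → GameTree} {pos w : ℕ}
    (h : A.Fits (node o k child) pos) (h1 : pos < w) (h2 : w < pos + (node o k child).size) :
    ∃ j, pos + childPos child j ≤ w ∧ w < A.past w ∧
      A.past w ≤ pos + childPos child j + (child j).size ∧
      (w = pos + childPos child j ∨ pos + childPos child j < w ∧
        pos + childPos child j ≤ A.parent w ∧ A.parent w < w) := by
  obtain ⟨j, hj1, hj2⟩ := h.exists_child h1 h2
  have hb := (h.2.2.2 j).2.bounds hj1 hj2
  refine ⟨j, hj1, hb.1, hb.2.1, ?_⟩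
  rcases hj1.eq_or_lt with h0 | h0
  · exact .inl h0.symm
  · exact .inr ⟨h0, hb.2.2 h0⟩

theorem child_disjoint {k : ℕ} (child : Fin (k + 1) → GameTree) {i j : Fin (k + 1)} (h : i ≠ j) :
    childPos child i + (child i).size ≤ childPos child j ∨
      childPos child j + (child j).size ≤ childPos child i := by
  rcases lt_or_gt_of_ne h with h | h
  · exact .inl (childPos_add_size_le child h)
  · exact .inr (childPos_add_size_le child h)

theorem Fits.kind_leafPos : {T : GameTree} → {pos : ℕ} → A.Fits T pos → (z : T.Leaf) →
    A.kind (pos + T.leafPos z) = 0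
  | .leaf, _, h, _ => h.1
  | .node o k child, pos, h, ⟨j, z⟩ => by
    simp only [leafPos]
    rw [← add_assoc]
    exact (h.2.2.2 j).2.kind_leafPos z

theorem Fits.exists_leafPos : {T : GameTree} → {pos : ℕ} → A.Fits T pos → ∀ {w : ℕ}, pos ≤ w →
    w < pos + T.size → A.kind w = 0 → ∃ z : T.Leaf, pos + T.leafPos z = w
  | .leaf, pos, _, w, h1, h2, _ => ⟨(), by simp only [size] at h2; simp only [leafPos]; omega⟩
  | .node o k child, pos, h, w, h1, h2, hk => by
    rcases h1.eq_or_lt with rfl | h1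
    · rw [h.1] at hk
      cases o <;> simp [Player.code] at hk
    · obtain ⟨j, hj1, hj2⟩ := h.exists_child h1 h2
      obtain ⟨z, hz⟩ := (h.2.2.2 j).2.exists_leafPos hj1 hj2 hk
      exact ⟨⟨j, z⟩, by simp only [leafPos]; omega⟩

/-- `y` lies in the subtree of `x`. -/
def Anc (A : Arrays) (x y : ℕ) : Prop := x ≤ y ∧ y < A.past x

/-- `w` is a child of a leader node that is a proper ancestor of `c`, but `w` is not on the path
to `c`. -/
def OffPath (A : Arrays) (c w : ℕ) : Prop :=
  A.kind (A.parent w) = 1 ∧ A.parent w < c ∧ c < A.past (A.parent w) ∧ ¬ A.Anc w c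

end Arrays

end Stackelberg

/-! ### Necessity: the switch node, the threat and the pair behind a strongly inducible distribution
-/

namespace Stackelberg

namespace Arrays

open GameTree

variable {A : Arrays}

/-- Two positions below different children of a leader node between `lo` and `hi`. -/
def Forks (A : Arrays) (lo hi a b : ℕ) : Prop :=
  ∃ w₁ w₂, lo < w₁ ∧ w₁ < hi ∧ lo < w₂ ∧ w₂ < hi ∧ w₁ ≠ w₂ ∧ A.parent w₁ = A.parent w₂ ∧
    A.kind (A.parent w₁) = 1 ∧ A.Anc w₁ a ∧ A.Anc w₂ b

/-- Either `c` is a terminal node, or `c` and `i` are children of the same follower node. -/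
def Switch (A : Arrays) (lo hi c i : ℕ) : Prop :=
  (i = 0 ∧ A.kind c = 0) ∨
    (lo < c ∧ lo < i ∧ i < hi ∧ i ≠ c ∧ A.parent i = A.parent c ∧ A.kind (A.parent c) = 2)

/-- `s` exceeds what the leader can get in the subtree of `i` and away from the path to `c`. -/
def Exceeds (A : Arrays) (lo hi c i : ℕ) (s : ℝ) : Prop :=
  (i ≠ 0 → A.value i < s) ∧ ∀ w, lo < w → w < hi → A.OffPath c w → A.value w < s

theorem Forks.mono {lo hi lo' hi' a b : ℕ} (h : A.Forks lo hi a b) (h1 : lo' ≤ lo)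
    (h2 : hi ≤ hi') : A.Forks lo' hi' a b := by
  obtain ⟨w₁, w₂, a1, a2, a3, a4, h⟩ := h
  exact ⟨w₁, w₂, by omega, by omega, by omega, by omega, h⟩

/-- At a follower node only one child has positive probability, so two different terminal nodes in
the support part at a leader node. -/
theorem forks_of_outcome_pos : {T : GameTree} → {pos : ℕ} → A.Fits T pos →
    (δ : T.Behavioral .leader) → (π : T.Pure .follower) → (z z' : T.Leaf) →
    0 < T.outcome δ π z → 0 < T.outcome δ π z' → z = z' ∨
      A.Forks pos (pos + T.size) (pos + T.leafPos z) (pos + T.leafPos z')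
  | .leaf, _, _, _, _, _, _, _, _ => .inl rfl
  | .node o k child, pos, h, δ, π, ⟨i, z⟩, ⟨j, z'⟩, hz, hz' => by
    by_cases hij : i = j
    · subst hij
      have hs := childPos_add_size_le_size o child i
      have key : 0 < (child i).outcome (δ.2 i) (π.2 i) z ∧
          0 < (child i).outcome (δ.2 i) (π.2 i) z' := by
        cases o with
        | leader =>
          rw [outcome_leader] at hz hz'
          exact ⟨pos_of_mul_pos_right hz (weight_nonneg δ i),
            pos_of_mul_pos_right hz' (weight_nonneg δ i)⟩
        | follower =>
          rw [outcome_follower] at hz hz'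
          split_ifs at hz hz'
          · exact ⟨hz, hz'⟩
          · exact absurd hz (lt_irrefl _)
      rcases forks_of_outcome_pos (h.2.2.2 i).2 _ _ z z' key.1 key.2 with h1 | h1
      · exact .inl (by rw [h1])
      · refine .inr ?_
        simp only [leafPos]
        rw [← add_assoc, ← add_assoc]
        exact h1.mono (by omega) (by omega)
    · cases o with
      | leader =>
        have hi := h.2.2.2 i
        have hj := h.2.2.2 j
        have s1 := childPos_add_size_le_size .leader child i
        have s2 := childPos_add_size_le_size .leader child j
        have p1 := size_pos (child i)
        have p2 := size_pos (child j)
        have l1 := leafPos_lt_size _ z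
        have l2 := leafPos_lt_size _ z'
        have c1 := one_le_childPos child i
        have c2 := one_le_childPos child j
        have hd := child_disjoint child hij
        refine .inr ⟨pos + childPos child i, pos + childPos child j, by omega, by omega, by omega,
          by omega, by omega, by rw [hi.1, hj.1], by rw [hi.1]; exact h.1, ?_, ?_⟩
        · rw [Anc, hi.2.past_eq]; simp only [leafPos]; omega
        · rw [Anc, hj.2.past_eq]; simp only [leafPos]; omega
      | follower =>
        exfalso
        rw [outcome_follower] at hz hz'
        split_ifs at hz hz' with h1 h2
        · exact hij (h1.trans h2.symm)
        all_goals first | exact lt_irrefl _ hz | exact lt_irrefl _ hz'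

/-- The data behind a strongly inducible distribution `p`: up to domination, it is a mixture of
two terminal nodes in a subtree in which the follower can enforce a payoff threshold. -/
theorem exists_switch (F : ℕ → ℝ) : {T : GameTree} → {pos : ℕ} → A.Fits T pos →
    (v p : T.Leaf → ℝ) → StronglyInduces (atLeaves A.pay T pos) v p →
    ∃ c i, pos ≤ c ∧ c < pos + T.size ∧ A.Switch pos (pos + T.size) c i ∧
      A.Exceeds pos (pos + T.size) c i (expect (atLeaves A.pay T pos) p) ∧
      ∃ a b t, A.kind a = 0 ∧ A.kind b = 0 ∧ A.Anc c a ∧ A.Anc c b ∧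
        (a = b ∨ A.Forks pos (pos + T.size) a b) ∧ 0 ≤ t ∧ t ≤ 1 ∧
        expect (atLeaves A.pay T pos) p ≤ t * A.pay a + (1 - t) * A.pay b ∧
        expect (atLeaves F T pos) p ≤ t * F a + (1 - t) * F b
  | .leaf, pos, h, v, p, hp => by
    have h1 : p () = 1 := by
      obtain ⟨δ, π, -, rfl⟩ := hp.exists_isSSE
      rfl
    -- The value `0` for `i` means that no threat is used; as the root, node `0` is never a sibling
    -- of another node.
    refine ⟨pos, 0, le_rfl, by simp [size], .inl ⟨rfl, h.1⟩, ⟨fun h => absurd rfl h, ?_⟩,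
      pos, pos, 1, h.1, h.1, ?_, ?_, .inl rfl, zero_le_one, le_rfl, ?_, ?_⟩
    · intro w h1 h2
      simp only [size] at h2
      omega
    · rw [Anc, h.past_eq]; simp [size]
    · rw [Anc, h.past_eq]; simp [size]
    · rw [expect_leaf, h1]; simp [atLeaves, leafPos]
    · rw [expect_leaf, h1]; simp [atLeaves, leafPos]
  | .node o k child, pos, h, v, p, hp => by
    -- switching to a sibling below the same node, or further down
    have down : ∀ j, (∀ i ≠ j, ∀ z, p ⟨i, z⟩ = 0) →
        StronglyInduces (T := child j) (fun z => atLeaves A.pay (node o k child) pos ⟨j, z⟩)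
          (fun z => v ⟨j, z⟩) (fun z => p ⟨j, z⟩) →
        (o = .leader → ∀ i ≠ j, (child i).maximin (fun z => atLeaves A.pay (node o k child) pos ⟨i, z⟩) <
          expect (atLeaves A.pay (node o k child) pos) p) →
        ∃ c i, pos ≤ c ∧ c < pos + (node o k child).size ∧
          A.Switch pos (pos + (node o k child).size) c i ∧
          A.Exceeds pos (pos + (node o k child).size) c i (expect (atLeaves A.pay (node o k child) pos) p) ∧
          ∃ a b t, A.kind a = 0 ∧ A.kind b = 0 ∧ A.Anc c a ∧ A.Anc c b ∧
            (a = b ∨ A.Forks pos (pos + (node o k child).size) a b) ∧ 0 ≤ t ∧ t ≤ 1 ∧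
            expect (atLeaves A.pay (node o k child) pos) p ≤ t * A.pay a + (1 - t) * A.pay b ∧
            expect (atLeaves F (node o k child) pos) p ≤ t * F a + (1 - t) * F b := by
      intro j hsupp hj hm
      rw [expect_eq_of_support hsupp, expect_eq_of_support hsupp] at *
      simp only [atLeaves_child] at *
      obtain ⟨c, i, hc1, hc2, hsw, hex, a, b, t, ha, hb, haa, hab, hf, h0, h1, hu, hF⟩ :=
        exists_switch F (h.2.2.2 j).2 _ _ hj
      have s1 := childPos_add_size_le_size o child j
      have c1 := one_le_childPos child j
      refine ⟨c, i, by omega, by omega, ?_, ⟨hex.1, ?_⟩, a, b, t, ha, hb, haa, hab,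
        hf.imp_right fun hf => hf.mono (by omega) (by omega), h0, h1, hu, hF⟩
      · rcases hsw with hsw | ⟨g1, g2, g3, g4⟩
        · exact .inl hsw
        · exact .inr ⟨by omega, by omega, by omega, g4⟩
      -- A node off the path to `c` either is another child of the present node, which then belongs
      -- to the leader and is covered by `hm`, or lies below `j` and is covered by recursion.
      -- Elsewhere the interval of its parent would miss `c`.
      · intro w hw1 hw2 hoff
        obtain ⟨l, hl1, hl2, hl3, hl4⟩ := h.child_cases hw1 hw2
        by_cases hlj : l = j
        · subst hlj
          rcases hl4 with rfl | hl4
          · refine absurd ?_ hoff.2.2.2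
            rw [Anc, (h.2.2.2 l).2.past_eq]
            exact ⟨hc1, hc2⟩
          · exact hex.2 w (by omega) (by omega) hoff
        · have hd := child_disjoint child hlj
          rcases hl4 with rfl | hl4
          · have h1 := hoff.1
            rw [(h.2.2.2 l).1, h.1] at h1
            cases o with
            | leader =>
              rw [(h.2.2.2 l).2.value_eq]
              exact hm rfl l hlj
            | follower => simp [Player.code] at h1
          · have := (h.2.2.2 l).2.bounds hl4.2.1 (by omega)
            have := hoff.2.1
            have := hoff.2.2.1
            omega
    cases o with
    | leader =>
      obtain ⟨j, hsupp, hj, hm⟩ := hp.leader_child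
      exact down j hsupp hj fun _ => hm
    | follower =>
      obtain ⟨j, hsupp, ⟨δ, π, hδ⟩, hj | ⟨i, hij, hm⟩⟩ := hp.follower_child
      · exact down j hsupp hj fun h => nomatch h
      · have hfj := h.2.2.2 j
        have hfi := h.2.2.2 i
        have s1 := childPos_add_size_le_size .follower child j
        have s2 := childPos_add_size_le_size .follower child i
        have p1 := size_pos (child j)
        have p2 := size_pos (child i)
        have c1 := one_le_childPos child j
        have c2 := one_le_childPos child i
        have hd := child_disjoint child hij
        have hpay := expect_eq_of_support hsupp (atLeaves A.pay (node .follower k child) pos)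
        have hpF := expect_eq_of_support hsupp (atLeaves F (node .follower k child) pos)
        simp only [atLeaves_child] at hpay hpF hm
        -- Outcomes below `j` need no longer be strongly induced there; only realisability is used
        -- to pass to two nodes of the support.
        obtain ⟨ζ, ζ', hζ, hζ', t, h0, h1, hu, hF⟩ := exists_pair_dominating
          (outcome_mem_stdSimplex (child j) δ π) (atLeaves A.pay (child j) (pos + childPos child j))
          (atLeaves F (child j) (pos + childPos child j))
        have l1 := leafPos_lt_size _ ζ
        have l2 := leafPos_lt_size _ ζ'
        refine ⟨pos + childPos child j, pos + childPos child i, by omega, by omega,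
          .inr ⟨by omega, by omega, by omega, by omega, by rw [hfi.1, hfj.1],
            by rw [hfj.1]; exact h.1⟩, ⟨fun _ => by rw [hfi.2.value_eq]; exact hm, ?_⟩,
          pos + childPos child j + (child j).leafPos ζ,
          pos + childPos child j + (child j).leafPos ζ', t, hfj.2.kind_leafPos ζ,
          hfj.2.kind_leafPos ζ', ?_, ?_, ?_, h0, h1, ?_, ?_⟩
        -- No node is off the path within this subtree: its parent would be a proper ancestor of
        -- `c`, hence the present node, which belongs to the follower.
        · intro w hw1 hw2 hoff
          exfalso
          obtain ⟨l, hl1, hl2, hl3, hl4⟩ := h.child_cases hw1 hw2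
          have o1 := hoff.2.1
          have o2 := hoff.2.2.1
          rcases hl4 with rfl | hl4
          · have h1 := hoff.1
            rw [(h.2.2.2 l).1, h.1] at h1
            simp [Player.code] at h1
          · have := (h.2.2.2 l).2.bounds hl4.2.1 (by omega)
            by_cases hlj : l = j
            · subst hlj; omega
            · have hd := child_disjoint child hlj
              omega
        · rw [Anc, hfj.2.past_eq]; omega
        · rw [Anc, hfj.2.past_eq]; omega
        · rcases forks_of_outcome_pos hfj.2 δ π ζ ζ' hζ hζ' with h1 | h1
          · exact .inl (by rw [h1])
          · exact .inr (h1.mono (by omega) (by omega))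
        · rw [hpay, ← hδ]; exact hu
        · rw [hpF, ← hδ]; exact hF

end Arrays

end Stackelberg

/-! ### Realising and enforcing mixtures of two terminal nodes -/

namespace Stackelberg

namespace GameTree

theorem exists_outcome_child {o : Player} {k : ℕ} {child : Fin (k + 1) → GameTree}
    {j : Fin (k + 1)} (d : (child j).Behavioral .leader) (f : (child j).Pure .follower) :
    ∃ δ π, (∀ z, (node o k child).outcome δ π ⟨j, z⟩ = (child j).outcome d f z) ∧
      ∀ i ≠ j, ∀ z, (node o k child).outcome δ π ⟨i, z⟩ = 0 := by
  obtain ⟨d'⟩ : Nonempty (∀ i, (child i).Behavioral .leader) := inferInstance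
  obtain ⟨f'⟩ : Nonempty (∀ i, (child i).Pure .follower) := inferInstance
  cases o with
  | leader =>
    refine ⟨leaderMove j (Function.update d' j d), followerWait (Function.update f' j f),
      fun z => ?_, fun i hi z => ?_⟩
    · rw [outcome_leaderMove, if_pos rfl]; simp [followerWait]
    · rw [outcome_leaderMove, if_neg hi]
  | follower =>
    refine ⟨leaderWait (Function.update d' j d), followerMove j (Function.update f' j f),
      fun z => ?_, fun i hi z => ?_⟩
    · rw [outcome_follower]; simp [followerMove, leaderWait]
    · rw [outcome_follower, if_neg (by simpa [followerMove] using hi)]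

theorem exists_outcome_single : (T : GameTree) → (ζ : T.Leaf) →
    ∃ δ π, T.outcome δ π ζ = 1 ∧ ∀ z ≠ ζ, T.outcome δ π z = 0
  | .leaf, _ => ⟨(), (), rfl, fun _ h => absurd rfl h⟩
  | .node o k child, ⟨j, ζ⟩ => by
    obtain ⟨d, f, h1, h0⟩ := exists_outcome_single (child j) ζ
    obtain ⟨δ, π, hj, hi⟩ := exists_outcome_child (o := o) d f
    refine ⟨δ, π, by rw [hj, h1], ?_⟩
    rintro ⟨i, z⟩ hz
    by_cases hij : i = j
    · subst hij
      rw [hj, h0 z fun h => hz (by rw [h])]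
    · exact hi i hij z

end GameTree

/-- Probability `t` for `a` and probability `1 - t` for `b`. -/
noncomputable def pairDist (a b : ℕ) (t : ℝ) (z : ℕ) : ℝ :=
  if z = a then t else if z = b then 1 - t else 0

namespace Arrays

open GameTree

variable {A : Arrays}

/-- Children occupy disjoint intervals, so an ancestor of `z` other than the root stays in the child
that contains `z`. This is what lets forks and threats be restricted to a child. -/
theorem Anc.mem_child {o : Player} {k : ℕ} {child : Fin (k + 1) → GameTree} {pos w z : ℕ}
    (hA : A.Anc w z) (h : A.Fits (node o k child) pos) (h1 : pos < w)
    (h2 : w < pos + (node o k child).size) {j : Fin (k + 1)} (hz1 : pos + childPos child j ≤ z)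
    (hz2 : z < pos + childPos child j + (child j).size) :
    w = pos + childPos child j ∨ pos + childPos child j < w ∧
      w < pos + childPos child j + (child j).size ∧
      pos + childPos child j ≤ A.parent w ∧
      A.parent w < pos + childPos child j + (child j).size ∧
      A.past (A.parent w) ≤ pos + childPos child j + (child j).size := by
  obtain ⟨l, hl1, hl2, hl3, hl4⟩ := h.child_cases h1 h2
  have a1 := hA.1
  have a2 := hA.2
  by_cases hlj : l = j
  · subst hlj
    rcases hl4 with hl4 | hl4
    · exact .inl hl4
    · have hb := (h.2.2.2 l).2.bounds hl4.2.1 (by omega)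
      exact .inr ⟨hl4.1, by omega, hl4.2.1, by omega, hb.2.1⟩
  · have := child_disjoint child hlj
    omega

theorem Forks.child {o : Player} {k : ℕ} {child : Fin (k + 1) → GameTree} {pos a b : ℕ}
    (hf : A.Forks pos (pos + (node o k child).size) a b) (h : A.Fits (node o k child) pos)
    {j : Fin (k + 1)} (ha1 : pos + childPos child j ≤ a)
    (ha2 : a < pos + childPos child j + (child j).size) (hb1 : pos + childPos child j ≤ b)
    (hb2 : b < pos + childPos child j + (child j).size) :
    A.Forks (pos + childPos child j) (pos + childPos child j + (child j).size) a b := by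
  obtain ⟨w₁, w₂, l1, h1, l2, h2, hne, hp, hk, hA, hB⟩ := hf
  have c1 := one_le_childPos child j
  have hj := (h.2.2.2 j).1
  rcases hA.mem_child h l1 h1 ha1 ha2 with g1 | g1 <;>
    rcases hB.mem_child h l2 h2 hb1 hb2 with g2 | g2
  · omega
  · rw [← g1, hp] at hj; omega
  · rw [← g2, ← hp] at hj; omega
  · exact ⟨w₁, w₂, by omega, by omega, by omega, by omega, hne, hp, hk, hA, hB⟩

theorem Forks.eq_leader {o : Player} {k : ℕ} {child : Fin (k + 1) → GameTree} {pos a b : ℕ}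
    (hf : A.Forks pos (pos + (node o k child).size) a b) (h : A.Fits (node o k child) pos)
    {i j : Fin (k + 1)} (hij : i ≠ j) (ha1 : pos + childPos child i ≤ a)
    (ha2 : a < pos + childPos child i + (child i).size) (hb1 : pos + childPos child j ≤ b)
    (hb2 : b < pos + childPos child j + (child j).size) : o = .leader := by
  obtain ⟨w₁, w₂, l1, h1, l2, h2, hne, hp, hk, hA, hB⟩ := hf
  have c1 := one_le_childPos child i
  have c2 := one_le_childPos child j
  have hi := (h.2.2.2 i).1
  have hj := (h.2.2.2 j).1
  have hd := child_disjoint child hij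
  have hw : A.parent w₁ = pos := by
    rcases hA.mem_child h l1 h1 ha1 ha2 with g1 | g1
    · rw [g1, hi]
    · rcases hB.mem_child h l2 h2 hb1 hb2 with g2 | g2
      · rw [g2, hj] at hp; omega
      · omega
  rw [hw, h.1] at hk
  cases o with
  | leader => rfl
  | follower => simp [Player.code] at hk

/-- Descend to the node at which `a` and `b` part, which belongs to the leader by `Forks.eq_leader`.
There she mixes with probabilities `t` and `1 - t`, and below she and the follower head for `a` and
`b`. -/
theorem exists_outcome_pair {a b : ℕ} {t : ℝ} (h0 : 0 ≤ t) (h1 : t ≤ 1) : {T : GameTree} →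
    {pos : ℕ} → A.Fits T pos → A.Forks pos (pos + T.size) a b → A.kind a = 0 → A.kind b = 0 →
    pos ≤ a → a < pos + T.size → pos ≤ b → b < pos + T.size →
    ∃ δ π, T.outcome δ π = atLeaves (pairDist a b t) T pos
  | .leaf, pos, _, hf, _, _, _, _, _, _ => by
    obtain ⟨w₁, w₂, l1, h1, -⟩ := hf
    simp only [size] at h1
    omega
  | .node o k child, pos, h, hf, ka, kb, a1, a2, b1, b2 => by
    have hk : ∀ w, A.kind w = 0 → w ≠ pos := by
      rintro w hw rfl
      rw [h.1] at hw
      cases o <;> simp [Player.code] at hw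
    obtain ⟨i, i1, i2⟩ := h.exists_child (lt_of_le_of_ne a1 (hk a ka).symm) a2
    obtain ⟨j, j1, j2⟩ := h.exists_child (lt_of_le_of_ne b1 (hk b kb).symm) b2
    by_cases hij : i = j
    · subst hij
      obtain ⟨d, f, hdf⟩ := exists_outcome_pair h0 h1 (h.2.2.2 i).2 (hf.child h i1 i2 j1 j2)
        ka kb i1 i2 j1 j2
      obtain ⟨δ, π, hi, hl⟩ := exists_outcome_child (o := o) d f
      refine ⟨δ, π, ?_⟩
      funext ⟨l, z⟩
      by_cases hli : l = i
      · subst hli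
        rw [hi, hdf, ← atLeaves_child]
      · rw [hl l hli]
        have hd := child_disjoint child hli
        have hz := leafPos_lt_size (child l) z
        rw [atLeaves_node, pairDist]
        rw [if_neg (by omega), if_neg (by omega)]
    · obtain rfl := hf.eq_leader h hij i1 i2 j1 j2
      obtain ⟨ζ, hζ⟩ := (h.2.2.2 i).2.exists_leafPos i1 i2 ka
      obtain ⟨ζ', hζ'⟩ := (h.2.2.2 j).2.exists_leafPos j1 j2 kb
      obtain ⟨d, f, e1, e0⟩ := exists_outcome_single (child i) ζ
      obtain ⟨d', f', e1', e0'⟩ := exists_outcome_single (child j) ζ'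
      obtain ⟨d₀⟩ : Nonempty (∀ i, (child i).Behavioral .leader) := inferInstance
      obtain ⟨f₀⟩ : Nonempty (∀ i, (child i).Pure .follower) := inferInstance
      refine ⟨leaderMix ⟨fun l => if l = i then t else if l = j then 1 - t else 0, ?_, ?_⟩
        (Function.update (Function.update d₀ j d') i d),
        followerWait (Function.update (Function.update f₀ j f') i f), ?_⟩
      · intro l
        dsimp only
        split_ifs <;> linarith
      · rw [← Finset.add_sum_erase _ _ (Finset.mem_univ i),
          ← Finset.add_sum_erase _ _ (Finset.mem_erase.2 ⟨Ne.symm hij, Finset.mem_univ j⟩),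
          Finset.sum_eq_zero]
        · simp [Ne.symm hij]
        · intro l hl
          simp only [Finset.mem_erase] at hl
          simp [hl.1, hl.2.1]
      · funext ⟨l, z⟩
        rw [outcome_leader, weight_leaderMix]
        have hd := child_disjoint child hij
        have hz := leafPos_lt_size (child l) z
        have li := leafPos_lt_size (child i) ζ
        have lj := leafPos_lt_size (child j) ζ'
        change (if l = i then t else if l = j then 1 - t else 0) * _ = _
        by_cases hli : l = i
        · subst hli
          simp only [if_true, leaderMix, followerWait, Function.update_self]
          rw [atLeaves_node, pairDist]
          by_cases hzζ : z = ζ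
          · subst hzζ
            rw [e1, if_pos (by omega), mul_one]
          · have : (child l).leafPos z ≠ (child l).leafPos ζ :=
              fun h => hzζ (leafPos_injective (child l) h)
            rw [e0 z hzζ, if_neg (by omega), if_neg (by omega), mul_zero]
        · rw [if_neg hli]
          have hdi := child_disjoint child hli
          by_cases hlj : l = j
          · subst hlj
            simp only [if_true, leaderMix, followerWait, Function.update_self,
              Function.update_of_ne hli]
            rw [atLeaves_node, pairDist, if_neg (by omega)]
            by_cases hzζ : z = ζ'
            · subst hzζ
              rw [e1', if_pos (by omega), mul_one]
            · have : (child l).leafPos z ≠ (child l).leafPos ζ' :=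
                fun h => hzζ (leafPos_injective (child l) h)
              rw [e0' z hzζ, if_neg (by omega), mul_zero]
          · rw [if_neg hlj, zero_mul]
            have hdj := child_disjoint child hlj
            rw [atLeaves_node, pairDist]
            rw [if_neg (by omega), if_neg (by omega)]

/-- A single terminal node, or a proper mixture of two terminal nodes between which the leader can
mix. -/
def IsPair (A : Arrays) (lo hi a b : ℕ) (t : ℝ) : Prop :=
  (a = b ∧ t = 1) ∨ (A.Forks lo hi a b ∧ 0 < t ∧ t < 1 ∧ A.pay a ≠ A.pay b)

theorem IsPair.nonneg {lo hi a b : ℕ} {t : ℝ} (h : A.IsPair lo hi a b t) : 0 ≤ t := by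
  rcases h with ⟨-, rfl⟩ | ⟨-, h, -⟩
  exacts [zero_le_one, h.le]

theorem IsPair.exists_outcome {a b : ℕ} {t : ℝ} {T : GameTree} {pos : ℕ} (hF : A.Fits T pos)
    (h : A.IsPair pos (pos + T.size) a b t) (ka : A.kind a = 0) (kb : A.kind b = 0) (a1 : pos ≤ a)
    (a2 : a < pos + T.size) (b1 : pos ≤ b) (b2 : b < pos + T.size) :
    ∃ δ π, T.outcome δ π = atLeaves (pairDist a b t) T pos := by
  rcases h with ⟨rfl, rfl⟩ | ⟨h, h0, h1, -⟩
  · obtain ⟨ζ, hζ⟩ := hF.exists_leafPos a1 a2 ka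
    obtain ⟨δ, π, e1, e0⟩ := exists_outcome_single T ζ
    refine ⟨δ, π, funext fun z => ?_⟩
    simp only [atLeaves, pairDist]
    by_cases hz : z = ζ
    · subst hz
      rw [e1, if_pos hζ]
    · have : T.leafPos z ≠ T.leafPos ζ := fun h => hz (leafPos_injective T h)
      rw [e0 z hz, if_neg (by omega), if_neg (by omega)]
  · exact exists_outcome_pair h0.le h1.le hF h ka kb a1 a2 b1 b2

/-- The formula also covers `a = b`, since `IsPair` then forces `t = 1`: a proper mixture requires
different payoffs at `a` and `b`. -/
theorem IsPair.expect_eq {a b : ℕ} {t : ℝ} {T : GameTree} {pos lo hi : ℕ} (hF : A.Fits T pos)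
    (h : A.IsPair lo hi a b t) (ka : A.kind a = 0) (kb : A.kind b = 0) (a1 : pos ≤ a)
    (a2 : a < pos + T.size) (b1 : pos ≤ b) (b2 : b < pos + T.size) (f : ℕ → ℝ) :
    expect (atLeaves f T pos) (atLeaves (pairDist a b t) T pos) = t * f a + (1 - t) * f b := by
  classical
  obtain ⟨ζ, hζ⟩ := hF.exists_leafPos a1 a2 ka
  obtain ⟨ζ', hζ'⟩ := hF.exists_leafPos b1 b2 kb
  have e : ∀ z : T.Leaf, atLeaves f T pos z * atLeaves (pairDist a b t) T pos z =
      (if z = ζ then t * f a else 0) + (if z = ζ' then (1 - t) * f b else 0) := by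
    intro z
    simp only [atLeaves, pairDist]
    have i1 : pos + T.leafPos z = a ↔ z = ζ := by
      constructor
      · intro h; exact leafPos_injective T (by omega)
      · rintro rfl; exact hζ
    have i2 : pos + T.leafPos z = b ↔ z = ζ' := by
      constructor
      · intro h; exact leafPos_injective T (by omega)
      · rintro rfl; exact hζ'
    by_cases z1 : z = ζ
    · rw [if_pos z1, if_pos (i1.2 z1), i1.2 z1]
      by_cases z2 : z = ζ'
      · obtain rfl : t = 1 := by
          rcases h with ⟨-, h⟩ | ⟨-, -, -, h⟩
          · exact h
          · exact absurd (by rw [← i1.2 z1, ← i2.2 z2]) h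
        rw [if_pos z2]; ring
      · rw [if_neg z2]; ring
    · rw [if_neg z1, if_neg (mt i1.1 z1)]
      by_cases z2 : z = ζ'
      · rw [if_pos z2, if_pos (i2.2 z2), i2.2 z2]; ring
      · rw [if_neg z2, if_neg (mt i2.1 z2)]; ring
  simp only [expect, e, Finset.sum_add_distrib]
  simp

/-- The payoff function with which the follower enforces a pair in a subtree. -/
theorem IsPair.enforce {a b : ℕ} {t up bot : ℝ} {T : GameTree} {pos : ℕ} (hF : A.Fits T pos)
    (h : A.IsPair pos (pos + T.size) a b t) (ka : A.kind a = 0) (kb : A.kind b = 0) (a1 : pos ≤ a)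
    (a2 : a < pos + T.size) (b1 : pos ≤ b) (b2 : b < pos + T.size)
    (hup : up = t * A.pay a + (1 - t) * A.pay b) {V : ℕ → ℝ} (hVa : V a = up - A.pay a)
    (hVb : V b = up - A.pay b)
    (hV : ∀ z, pos ≤ z → z < pos + T.size → A.kind z = 0 → z ≠ a → z ≠ b → V z = bot)
    (hbot : ∀ z, pos ≤ z → z < pos + T.size → A.kind z = 0 → A.pay z + bot < up) :
    (∃ d f, T.outcome d f = atLeaves (pairDist a b t) T pos ∧
      expect (atLeaves V T pos) (T.outcome d f) = 0 ∧
      ∀ f', expect (atLeaves V T pos) (T.outcome d f') ≤ 0) ∧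
    ∀ d f, 0 ≤ expect (atLeaves V T pos) (T.outcome d f) →
      up ≤ expect (atLeaves A.pay T pos) (T.outcome d f) →
      T.outcome d f = atLeaves (pairDist a b t) T pos := by
  obtain ⟨d, f, hdf⟩ := h.exists_outcome hF ka kb a1 a2 b1 b2
  have hpV : expect (atLeaves V T pos) (T.outcome d f) = 0 := by
    rw [hdf, h.expect_eq hF ka kb a1 a2 b1 b2, hVa, hVb, hup]
    ring
  have hoff : ∀ z : T.Leaf, pos + T.leafPos z ≠ a → pos + T.leafPos z ≠ b →
      atLeaves V T pos z = bot := fun z h1 h2 =>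
    hV _ (by omega) (by have := leafPos_lt_size T z; omega) (hF.kind_leafPos z) h1 h2
  have hlow : ∀ z : T.Leaf, atLeaves A.pay T pos z + bot < up := fun z =>
    hbot _ (by omega) (by have := leafPos_lt_size T z; omega) (hF.kind_leafPos z)
  have hVcases : ∀ z : T.Leaf, pos + T.leafPos z = a ∨ pos + T.leafPos z = b →
      atLeaves V T pos z = up - atLeaves A.pay T pos z := by
    rintro z (h1 | h1)
    · simp only [atLeaves, h1, hVa]
    · simp only [atLeaves, h1, hVb]
  have hpos : ∀ z : T.Leaf, pos + T.leafPos z = a ∨ pos + T.leafPos z = b →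
      0 < T.outcome d f z := by
    intro z hz
    rw [hdf]
    simp only [atLeaves, pairDist]
    rcases h with ⟨rfl, rfl⟩ | ⟨-, h0, h1, -⟩
    · rw [if_pos (by tauto)]; exact one_pos
    · split_ifs
      · exact h0
      · linarith
      · tauto
  refine ⟨⟨d, f, hdf, hpV, fun f' => ?_⟩, ?_⟩
  -- Measured from `bot`, only `a` and `b` contribute, both positively, and no reply can raise their
  -- probabilities by `outcome_le_of_pos`. Hence no reply is better than `f`.
  · have e : ∀ f', expect (atLeaves V T pos) (T.outcome d f') =
        bot + ∑ z, (atLeaves V T pos z - bot) * T.outcome d f' z := by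
      intro f'
      simp only [sub_mul, Finset.sum_sub_distrib, ← Finset.mul_sum,
        (outcome_mem_stdSimplex T d f').2, expect]
      ring
    rw [← hpV, e, e]
    refine add_le_add le_rfl (Finset.sum_le_sum fun z _ => ?_)
    by_cases hz : pos + T.leafPos z = a ∨ pos + T.leafPos z = b
    · refine mul_le_mul_of_nonneg_left (outcome_le_of_pos T d f f' z (hpos z hz)) ?_
      rw [hVcases z hz]
      linarith [hlow z]
    · push Not at hz
      rw [hoff z hz.1 hz.2]
      simp
  · intro d' f' hv hu
    have hq := outcome_mem_stdSimplex T d' f'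
    -- The two payoffs add up to at most `up` at every terminal node, with equality only at `a` and
    -- `b`. An outcome worth at least `0` to the follower and `up` to the leader attains equality
    -- throughout its support.
    have hterm : ∀ z, 0 ≤ (up - atLeaves V T pos z - atLeaves A.pay T pos z) *
        T.outcome d' f' z := by
      intro z
      refine mul_nonneg ?_ (hq.1 z)
      by_cases hz : pos + T.leafPos z = a ∨ pos + T.leafPos z = b
      · rw [hVcases z hz]; linarith
      · push Not at hz
        rw [hoff z hz.1 hz.2]
        linarith [hlow z]
    have hs : ∑ z, (up - atLeaves V T pos z - atLeaves A.pay T pos z) * T.outcome d' f' z =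
        up - expect (atLeaves V T pos) (T.outcome d' f') -
          expect (atLeaves A.pay T pos) (T.outcome d' f') := by
      simp only [sub_mul, Finset.sum_sub_distrib, ← Finset.mul_sum, hq.2, expect]
      ring
    have hs0 := le_antisymm (by rw [hs]; linarith) (Finset.sum_nonneg fun z _ => hterm z)
    have hz0 := (Finset.sum_eq_zero_iff_of_nonneg fun z _ => hterm z).1 hs0
    have hq0 : ∀ z : T.Leaf, pos + T.leafPos z ≠ a → pos + T.leafPos z ≠ b →
        T.outcome d' f' z = 0 := by
      intro z h1 h2
      rcases mul_eq_zero.1 (hz0 z (Finset.mem_univ z)) with h3 | h3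
      · rw [hoff z h1 h2] at h3
        linarith [hlow z]
      · exact h3
    obtain ⟨ζ, hζ⟩ := hF.exists_leafPos a1 a2 ka
    obtain ⟨ζ', hζ'⟩ := hF.exists_leafPos b1 b2 kb
    have hne : ∀ {z z' : T.Leaf}, z ≠ z' → pos + T.leafPos z ≠ pos + T.leafPos z' :=
      fun h1 h2 => h1 (leafPos_injective T (by omega))
    rcases h with ⟨rfl, rfl⟩ | ⟨-, h0, h1, hab⟩
    · have hone : T.outcome d' f' ζ = 1 := by
        rw [← hq.2, Finset.sum_eq_single ζ]
        · intro z _ hz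
          have := hne hz
          exact hq0 z (by omega) (by omega)
        · simp
      funext z
      simp only [atLeaves, pairDist]
      by_cases hz : z = ζ
      · subst hz; rw [hone, if_pos hζ]
      · have := hne hz
        rw [hq0 z (by omega) (by omega), if_neg (by omega), if_neg (by omega)]
    · classical
      have hζζ : ζ' ≠ ζ := by
        rintro rfl
        exact hab (by rw [← hζ, ← hζ'])
      have hsum2 : ∀ g : T.Leaf → ℝ, ∑ z, g z * T.outcome d' f' z =
          g ζ * T.outcome d' f' ζ + g ζ' * T.outcome d' f' ζ' := by
        intro g
        rw [← Finset.add_sum_erase _ _ (Finset.mem_univ ζ),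
          ← Finset.add_sum_erase _ _ (Finset.mem_erase.2 ⟨hζζ, Finset.mem_univ ζ'⟩),
          Finset.sum_eq_zero, add_zero]
        intro z hz
        simp only [Finset.mem_erase] at hz
        have h1 := hne hz.1
        have h2 := hne hz.2.1
        rw [hq0 z (by omega) (by omega), mul_zero]
      have q1 := hsum2 fun _ => 1
      simp only [one_mul, hq.2] at q1
      have q2 : expect (atLeaves A.pay T pos) (T.outcome d' f') = up := by
        rw [hs] at hs0; linarith
      have q3 := hsum2 (atLeaves A.pay T pos)
      have pa : atLeaves A.pay T pos ζ = A.pay a := by simp only [atLeaves, hζ]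
      have pb : atLeaves A.pay T pos ζ' = A.pay b := by simp only [atLeaves, hζ']
      rw [pa, pb] at q3
      have q4 : expect (atLeaves A.pay T pos) (T.outcome d' f') =
        A.pay a * T.outcome d' f' ζ + A.pay b * T.outcome d' f' ζ' := q3
      rw [q2, hup] at q4
      -- With all mass on `a` and `b`, whose payoffs for the leader differ, her expected payoff `up`
      -- determines the probability.
      have q5 : T.outcome d' f' ζ = t := by
        have : (A.pay a - A.pay b) * (T.outcome d' f' ζ - t) = 0 := by
          have : T.outcome d' f' ζ' = 1 - T.outcome d' f' ζ := by linarith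
          rw [this] at q4
          linarith
        rcases mul_eq_zero.1 this with h | h
        · exact absurd (by linarith) hab
        · linarith
      funext z
      simp only [atLeaves, pairDist]
      by_cases hz : z = ζ
      · subst hz; rw [q5, if_pos hζ]
      · have z1 := hne hz
        by_cases hz' : z = ζ'
        · subst hz'
          rw [if_neg (by omega), if_pos hζ']
          linarith
        · have z2 := hne hz'
          rw [hq0 z (by omega) (by omega), if_neg (by omega), if_neg (by omega)]

end Arrays

end Stackelberg

/-! ### Sufficiency: threats that strongly induce a pair -/

namespace Stackelberg

namespace Arrays

open GameTree

variable {A : Arrays}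

/-- The payoff function `V` of a follower who aims at the pair `a`, `b` with payoff `up` for the
leader: his interests are opposed to those of the leader at `a` and `b`, below `i`, and below the
nodes off the path to `c` to which the leader could move; elsewhere his payoff is `bot`. -/
def IsThreat (A : Arrays) (lo hi c i a b : ℕ) (up bot : ℝ) (V : ℕ → ℝ) : Prop :=
  V a = up - A.pay a ∧ V b = up - A.pay b ∧
    ∀ z, lo ≤ z → z < hi → A.kind z = 0 → z ≠ a → z ≠ b →
      (∃ w, lo < w ∧ w < hi ∧ (w = i ∨ A.OffPath c w) ∧ A.Anc w z ∧
        V z = A.value w - A.pay z) ∨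
      ((∀ w, lo < w → w < hi → (w = i ∨ A.OffPath c w) → ¬ A.Anc w z) ∧ V z = bot)

/-- The interval of the parent of an off-path node contains `c`, so it cannot fit into a child other
than that of `c`. Hence an off-path node above something in child `l` is the root of that child. -/
theorem OffPath.root_or {o : Player} {k : ℕ} {child : Fin (k + 1) → GameTree} {pos c w : ℕ}
    (hw : A.OffPath c w) (h : A.Fits (node o k child) pos) (h1 : pos < w)
    (h2 : w < pos + (node o k child).size) {j l : Fin (k + 1)} (hlj : l ≠ j)
    (hc1 : pos + childPos child j ≤ c) (hc2 : c < pos + childPos child j + (child j).size) {z : ℕ}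
    (hz : A.Anc w z) (hz1 : pos + childPos child l ≤ z)
    (hz2 : z < pos + childPos child l + (child l).size) :
    w = pos + childPos child l ∧ o = .leader := by
  have hd := child_disjoint child hlj
  have o1 := hw.2.1
  have o2 := hw.2.2.1
  rcases hz.mem_child h h1 h2 hz1 hz2 with g | g
  · refine ⟨g, ?_⟩
    have hk := hw.1
    rw [g, (h.2.2.2 l).1, h.1] at hk
    cases o with
    | leader => rfl
    | follower => simp [Player.code] at hk
  · omega

/-- A node `w` responsible for a terminal node below `j` lies strictly below the root of child `j`:
that root is on the path to `c`, hence not off the path, and it is not `i`. -/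
theorem IsThreat.child {o : Player} {k : ℕ} {child : Fin (k + 1) → GameTree}
    {pos c i a b : ℕ} {up bot : ℝ} {V : ℕ → ℝ} {j : Fin (k + 1)}
    (hV : A.IsThreat pos (pos + (node o k child).size) c i a b up bot V)
    (h : A.Fits (node o k child) pos) (hc1 : pos + childPos child j ≤ c)
    (hc2 : c < pos + childPos child j + (child j).size) (hij : i ≠ pos + childPos child j) :
    A.IsThreat (pos + childPos child j) (pos + childPos child j + (child j).size) c i a b up bot
      V := by
  refine ⟨hV.1, hV.2.1, fun z z1 z2 kz za zb => ?_⟩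
  have s1 := childPos_add_size_le_size o child j
  have c1 := one_le_childPos child j
  rcases hV.2.2 z (by omega) (by omega) kz za zb with ⟨w, w1, w2, hw, hA, hz⟩ | ⟨hn, hz⟩
  · refine .inl ⟨w, ?_, ?_, hw, hA, hz⟩
    · rcases hA.mem_child h w1 w2 z1 z2 with g | g
      · rcases hw with hw | hw
        · omega
        · refine absurd ?_ hw.2.2.2
          rw [g, Anc, (h.2.2.2 j).2.past_eq]
          exact ⟨hc1, hc2⟩
      · omega
    · have := hA.1
      omega
  · exact .inr ⟨fun w w1 w2 => hn w (by omega) (by omega), hz⟩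

/-- The payoff function of `IsThreat` strongly induces the pair. -/
theorem IsThreat.stronglyInduces {c i a b : ℕ} {t up bot : ℝ} {V : ℕ → ℝ} (ka : A.kind a = 0)
    (kb : A.kind b = 0) (hca : A.Anc c a) (hcb : A.Anc c b)
    (hup : up = t * A.pay a + (1 - t) * A.pay b) (hbot : bot < 0) : {T : GameTree} → {pos : ℕ} →
    A.Fits T pos → pos ≤ c → c < pos + T.size → A.Switch pos (pos + T.size) c i →
    A.Exceeds pos (pos + T.size) c i up → A.IsPair pos (pos + T.size) a b t →
    A.IsThreat pos (pos + T.size) c i a b up bot V →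
    (∀ z, pos ≤ z → z < pos + T.size → A.kind z = 0 → A.pay z + bot < up) →
    StronglyInduces (atLeaves A.pay T pos) (atLeaves V T pos) (atLeaves (pairDist a b t) T pos) ∧
      Secures (atLeaves V T pos) bot
  | .leaf, pos, h, c1, c2, hsw, hex, hpair, hV, hlow => by
    simp only [size] at c2
    obtain rfl : c = pos := by omega
    have hs := h.past_eq
    simp only [size] at hs
    obtain rfl : a = c := by have := hca.1; have := hca.2; omega
    obtain rfl : b = a := by have := hcb.1; have := hcb.2; omega
    obtain rfl : t = 1 := by
      rcases hpair with ⟨-, h⟩ | ⟨-, -, -, h⟩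
      · exact h
      · exact absurd rfl h
    refine ⟨fun δ π _ => ?_, fun δ => ⟨(), ?_⟩⟩
    · funext z
      simp [atLeaves, pairDist, leafPos, outcome]
    · rw [expect_leaf]
      simp only [atLeaves, leafPos, add_zero, hV.1, hup, outcome]
      linarith
  | .node o k child, pos, h, c1, c2, hsw, hex, hpair, hV, hlow => by
    have hcpos : pos < c := by
      rcases hsw with ⟨-, hk⟩ | ⟨hlt, -⟩
      · refine lt_of_le_of_ne c1 ?_
        rintro rfl
        rw [h.1] at hk
        cases o <;> simp [Player.code] at hk
      · exact hlt
    obtain ⟨j, j1, j2⟩ := h.exists_child hcpos c2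
    have hj := h.2.2.2 j
    have s1 := childPos_add_size_le_size o child j
    have q1 := one_le_childPos child j
    have hcb' := hj.2.bounds j1 j2
    have a1 := hca.1
    have a2 := hca.2
    have b1 := hcb.1
    have b2 := hcb.2
    have hpairj : A.IsPair (pos + childPos child j) (pos + childPos child j + (child j).size)
        a b t := by
      rcases hpair with hp | ⟨hf, hp⟩
      · exact .inl hp
      · exact .inr ⟨hf.child h (by omega) (by omega) (by omega) (by omega), hp⟩
    have hsupp : ∀ l ≠ j, ∀ z, atLeaves (pairDist a b t) (node o k child) pos ⟨l, z⟩ = 0 := by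
      intro l hl z
      have hd := child_disjoint child hl
      have hz := leafPos_lt_size (child l) z
      rw [atLeaves_node, pairDist, if_neg (by omega), if_neg (by omega)]
    have hexp : expect (atLeaves A.pay (node o k child) pos)
        (atLeaves (pairDist a b t) (node o k child) pos) = up := by
      rw [hpair.expect_eq h ka kb (by omega) (by omega) (by omega) (by omega), hup]
    -- terminal nodes below the other children
    have hother : ∀ l ≠ j, ∀ z : (child l).Leaf,
        (∃ w, pos < w ∧ w < pos + (node o k child).size ∧ (w = i ∨ A.OffPath c w) ∧
          A.Anc w (pos + childPos child l + (child l).leafPos z) ∧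
          V (pos + childPos child l + (child l).leafPos z) =
            A.value w - A.pay (pos + childPos child l + (child l).leafPos z)) ∨
        ((∀ w, pos < w → w < pos + (node o k child).size → (w = i ∨ A.OffPath c w) →
          ¬ A.Anc w (pos + childPos child l + (child l).leafPos z)) ∧
          V (pos + childPos child l + (child l).leafPos z) = bot) := by
      intro l hl z
      have hd := child_disjoint child hl
      have hz := leafPos_lt_size (child l) z
      have s2 := childPos_add_size_le_size o child l
      exact hV.2.2 _ (by omega) (by omega) ((h.2.2.2 l).2.kind_leafPos z) (by omega) (by omega)
    have hanc : ∀ l, ∀ z : (child l).Leaf, A.Anc (pos + childPos child l)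
        (pos + childPos child l + (child l).leafPos z) := by
      intro l z
      have hz := leafPos_lt_size (child l) z
      rw [Anc, (h.2.2.2 l).2.past_eq]
      omega
    by_cases hthreat : i ≠ 0 ∧ A.parent c = pos
    · -- the threat is made here
      obtain ⟨hi0, hpc⟩ := hthreat
      obtain ⟨-, i1, i2, hic, hpi, hk⟩ : pos < c ∧ pos < i ∧ i < pos + (node o k child).size ∧
          i ≠ c ∧ A.parent i = A.parent c ∧ A.kind (A.parent c) = 2 := by
        rcases hsw with ⟨h0, -⟩ | hsw
        · exact absurd h0 hi0
        · exact hsw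
      rw [hpc] at hpi hk
      obtain rfl : o = .follower := by
        rw [h.1] at hk
        cases o with
        | leader => simp [Player.code] at hk
        | follower => rfl
      have root : ∀ w, pos < w → w < pos + (node .follower k child).size → A.parent w = pos →
          ∃ l, w = pos + childPos child l := by
        intro w w1 w2 hp
        obtain ⟨l, l1, l2, l3, l4⟩ := h.child_cases w1 w2
        have := one_le_childPos child l
        exact ⟨l, by omega⟩
      have hcj : c = pos + childPos child j := by
        rcases j1.eq_or_lt with hlt | hlt
        · exact hlt.symm
        · have := hcb'.2.2 hlt; omega
      obtain ⟨l, hil⟩ := root i i1 i2 hpi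
      have hlj : l ≠ j := by rintro rfl; omega
      have hm : A.value i < up := hex.1 hi0
      rw [hil, (h.2.2.2 l).2.value_eq] at hm
      have hdl := child_disjoint child hlj
      have pl := size_pos (child l)
      have hVi : ∀ z : (child l).Leaf, V (pos + childPos child l + (child l).leafPos z) =
          A.value (pos + childPos child l) -
            A.pay (pos + childPos child l + (child l).leafPos z) := by
        intro z
        have hz := leafPos_lt_size (child l) z
        rcases hother l hlj z with ⟨w, w1, w2, hw, hA, hz'⟩ | ⟨hn, -⟩
        · rcases hw with rfl | hw
          · rw [hz', ← hil]
          · have := (hw.root_or h w1 w2 hlj j1 j2 hA (by omega) (by omega)).2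
            exact nomatch this
        · exact absurd (hanc l z) (hn _ (by omega) (by omega) (.inl hil.symm))
      have hVj : ∀ z, pos + childPos child j ≤ z →
          z < pos + childPos child j + (child j).size → A.kind z = 0 → z ≠ a → z ≠ b →
          V z = bot := by
        intro z z1 z2 kz za zb
        rcases hV.2.2 z (by omega) (by omega) kz za zb with ⟨w, w1, w2, hw, hA, -⟩ | ⟨-, hz⟩
        · exfalso
          rcases hw with rfl | hw
          · have hA2 := hA.2
            have hA1 := hA.1
            rw [hil, (h.2.2.2 l).2.past_eq] at hA2
            omega
          · have o1 := hw.2.1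
            have o2 := hw.2.2.2
            rcases hA.mem_child h w1 w2 z1 z2 with g | g
            · apply o2
              rw [g, Anc, hj.2.past_eq]
              exact ⟨j1, j2⟩
            · omega
        · exact hz
      obtain ⟨hE1, hE2⟩ := hpairj.enforce hj.2 ka kb (by omega) (by omega) (by omega) (by omega)
        hup hV.1 hV.2.1 hVj fun z z1 z2 => hlow z (by omega) (by omega)
      -- More than `bot` is secured by the threat itself: the zero-sum game in child `l` is
      -- normalised to value `0`.
      refine ⟨stronglyInduces_threat hlj hbot hsupp ?_ ?_ ?_ ?_ ?_, Secures.follower (j := l) ?_⟩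
      · simpa only [atLeaves_child] using hE1
      · simpa only [atLeaves_child, hexp] using hE2
      · intro z
        rw [atLeaves_node, atLeaves_node, hVi z, (h.2.2.2 l).2.value_eq, atLeaves_child]
      · rw [atLeaves_child, hexp]; exact hm
      · intro l' h1 h2 z
        have hd := child_disjoint child h2
        have hd' := child_disjoint child h1
        have hz := leafPos_lt_size (child l') z
        rw [atLeaves_node]
        rcases hother l' h2 z with ⟨w, w1, w2, hw, hA, -⟩ | ⟨-, hz⟩
        · exfalso
          rcases hw with rfl | hw
          · have hA2 := hA.2
            have hA1 := hA.1
            rw [hil, (h.2.2.2 l).2.past_eq] at hA2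
            omega
          · have := (hw.root_or h w1 w2 h2 j1 j2 hA (by omega) (by omega)).2
            exact nomatch this
        · exact hz
      · rw [atLeaves_child]
        refine secures_of_sub (u := atLeaves A.pay (child l) (pos + childPos child l))
          (fun z => ?_) hbot
        rw [← (h.2.2.2 l).2.value_eq]
        exact hVi z
    · -- the threat is made further down, if at all
      have hsw' : A.Switch (pos + childPos child j) (pos + childPos child j + (child j).size)
          c i ∧ i ≠ pos + childPos child j := by
        rcases hsw with ⟨h0, hk⟩ | ⟨g1, g2, g3, g4, g5, g6⟩
        · exact ⟨.inl ⟨h0, hk⟩, by omega⟩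
        · have hpc : A.parent c ≠ pos := fun hp => hthreat ⟨by omega, hp⟩
          have hcj : pos + childPos child j < c := by
            refine lt_of_le_of_ne j1 ?_
            rintro rfl
            exact hpc hj.1
          have hpb := hcb'.2.2 hcj
          obtain ⟨l, l1, l2, l3, l4⟩ := h.child_cases g2 g3
          rcases l4 with rfl | l4
          · rw [(h.2.2.2 l).1] at g5
            omega
          · have hlj : l = j := by
              by_contra hne
              have := child_disjoint child hne
              omega
            subst hlj
            exact ⟨.inr ⟨hcj, by omega, by omega, g4, g5, g6⟩, by omega⟩
      have hexj : A.Exceeds (pos + childPos child j) (pos + childPos child j + (child j).size)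
          c i up := ⟨hex.1, fun w w1 w2 => hex.2 w (by omega) (by omega)⟩
      obtain ⟨hS, hsec⟩ := IsThreat.stronglyInduces ka kb hca hcb hup hbot hj.2 j1 j2 hsw'.1 hexj
        hpairj (hV.child h j1 j2 hsw'.2) fun z z1 z2 => hlow z (by omega) (by omega)
      have hi_anc : ∀ l ≠ j, ∀ z : (child l).Leaf, pos < i → i < pos + (node o k child).size →
          ¬ A.Anc i (pos + childPos child l + (child l).leafPos z) := by
        intro l hl z i1 i2 hA
        have hd := child_disjoint child hl
        have hz := leafPos_lt_size (child l) z
        have hi' : pos + childPos child j < i ∧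
            i < pos + childPos child j + (child j).size := by
          rcases hsw'.1 with ⟨h0, -⟩ | ⟨-, g2, g3, -⟩
          · omega
          · exact ⟨g2, g3⟩
        have := (hj.2.bounds hi'.1.le hi'.2).2.1
        have := hA.1
        have := hA.2
        omega
      cases o with
      | leader =>
        have hVl : ∀ l ≠ j, ∀ z : (child l).Leaf,
            V (pos + childPos child l + (child l).leafPos z) = A.value (pos + childPos child l) -
              A.pay (pos + childPos child l + (child l).leafPos z) := by
          intro l hl z
          have hz := leafPos_lt_size (child l) z
          rcases hother l hl z with ⟨w, w1, w2, hw, hA, hz'⟩ | ⟨hn, -⟩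
          · rcases hw with rfl | hw
            · exact absurd hA (hi_anc l hl z w1 w2)
            · rw [hz', (hw.root_or h w1 w2 hl j1 j2 hA (by omega) (by omega)).1]
          · have hd := child_disjoint child hl
            have ql := one_le_childPos child l
            have sl := childPos_add_size_le_size .leader child l
            have pl := size_pos (child l)
            refine absurd (hanc l z) (hn _ (by omega) (by omega) (.inr ⟨?_, ?_, ?_, ?_⟩))
            · rw [(h.2.2.2 l).1, h.1]; rfl
            · rw [(h.2.2.2 l).1]; exact hcpos
            · rw [(h.2.2.2 l).1, h.past_eq]; exact c2
            · rw [Anc, (h.2.2.2 l).2.past_eq]; omega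
        -- Each other child is off the path, so it is zero-sum by `hVl`, and `Exceeds` bounds its
        -- maximin value.
        refine ⟨stronglyInduces_leader hsupp ?_ (fun l hl => ⟨A.value (pos + childPos child l),
          fun z => ?_⟩) fun l hl => ?_, Secures.leader fun l => ?_⟩
        · simpa only [atLeaves_child] using hS
        · rw [atLeaves_node, atLeaves_node]; exact hVl l hl z
        · rw [hexp, atLeaves_child, ← (h.2.2.2 l).2.value_eq]
          have hd := child_disjoint child hl
          have ql := one_le_childPos child l
          have sl := childPos_add_size_le_size .leader child l
          have pl := size_pos (child l)
          refine hex.2 _ (by omega) (by omega) ⟨?_, ?_, ?_, ?_⟩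
          · rw [(h.2.2.2 l).1, h.1]; rfl
          · rw [(h.2.2.2 l).1]; exact hcpos
          · rw [(h.2.2.2 l).1, h.past_eq]; exact c2
          · rw [Anc, (h.2.2.2 l).2.past_eq]; omega
        · rw [atLeaves_child]
          by_cases hl : l = j
          · subst hl; exact hsec
          · refine secures_of_sub (u := atLeaves A.pay (child l) (pos + childPos child l))
              (fun z => ?_) hbot
            rw [← (h.2.2.2 l).2.value_eq]
            exact hVl l hl z
      | follower =>
        -- The siblings pay the constant `bot`, which the follower must be able to beat below `j`.
        -- This is why `Secures` is carried through the induction.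
        refine ⟨stronglyInduces_follower (c := bot) hsupp ?_ ?_ fun l hl z => ?_,
          Secures.follower (j := j) ?_⟩
        · simpa only [atLeaves_child] using hS
        · simpa only [atLeaves_child] using hsec
        · rw [atLeaves_node]
          have hz := leafPos_lt_size (child l) z
          rcases hother l hl z with ⟨w, w1, w2, hw, hA, -⟩ | ⟨-, hz⟩
          · exfalso
            rcases hw with rfl | hw
            · exact hi_anc l hl z w1 w2 hA
            · have := (hw.root_or h w1 w2 hl j1 j2 hA (by omega) (by omega)).2
              exact nomatch this
          · exact hz
        · simpa only [atLeaves_child] using hsec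

end Arrays

end Stackelberg

/-! ### Thresholds, targets and the optimal value -/

namespace Stackelberg

namespace Arrays

open GameTree

variable (A : Arrays) (F : ℕ → ℝ) (n : ℕ)

open Classical in
/-- The payoff of the leader above which the follower can enforce outcomes below `c`, where he
threatens to move to `i`. -/
noncomputable def threshold (c i : ℕ) : ℝ :=
  ((Finset.range n).filter fun w => 0 < w ∧ A.OffPath c w).fold max
    -- Without a threat, `c` is a terminal node and `A.pay c` the only payoff in question;
    -- subtracting `1` makes the starting value of the maximum harmless.
    (if i = 0 then A.pay c - 1 else A.value i) A.value

/-- A terminal node `a` that the follower can enforce. -/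
def LeafTarget (c i a : ℕ) : Prop :=
  c < n ∧ i < n ∧ a < n ∧ A.Switch 0 n c i ∧ A.kind a = 0 ∧ A.Anc c a ∧ A.threshold n c i < A.pay a

/-- Terminal nodes `a`, `b` such that the follower prefers `b` but can only enforce mixtures with
a sufficient probability of `a`. -/
def PairTarget (c i a b : ℕ) : Prop :=
  A.LeafTarget n c i a ∧ b < n ∧ A.kind b = 0 ∧ A.Anc c b ∧ A.pay b ≤ A.threshold n c i ∧
    F a < F b ∧ A.Forks 0 n a b

/-- The probability of `a` for which the payoff of the leader is the threshold. -/
noncomputable def pairProb (c i a b : ℕ) : ℝ :=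
  (A.threshold n c i - A.pay b) / (A.pay a - A.pay b)

noncomputable def pairValue (c i a b : ℕ) : ℝ :=
  A.pairProb n c i a b * F a + (1 - A.pairProb n c i a b) * F b

/-- A payoff lower than all those that occur in threats. -/
noncomputable def bottom : ℝ := -(1 + 2 * ∑ v ∈ Finset.range n, |A.pay v|)

variable {A F n}

theorem threshold_lt {c i : ℕ} {s : ℝ} : A.threshold n c i < s ↔
    (if i = 0 then A.pay c - 1 else A.value i) < s ∧
      ∀ w, 0 < w → w < n → A.OffPath c w → A.value w < s := by
  classical
  rw [threshold, Finset.fold_max_lt]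
  simp only [Finset.mem_filter, Finset.mem_range]
  exact and_congr_right fun _ => ⟨fun h w h1 h2 h3 => h w ⟨h2, h1, h3⟩, fun h w hw =>
    h w hw.2.1 hw.1 hw.2.2⟩

theorem exceeds_of_threshold_lt {c i : ℕ} {s : ℝ} (h : A.threshold n c i < s) :
    A.Exceeds 0 n c i s := by
  rw [threshold_lt] at h
  exact ⟨fun hi => by simpa [hi] using h.1, h.2⟩

theorem bottom_neg : A.bottom n < 0 := by
  have : 0 ≤ ∑ v ∈ Finset.range n, |A.pay v| := Finset.sum_nonneg fun v _ => abs_nonneg _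
  unfold bottom
  linarith

/-- All payoffs in question lie between plus and minus the sum of absolute values, so a payoff and a
mixture differ by at most twice this sum. -/
theorem pay_add_bottom_lt {a b z : ℕ} {t : ℝ} (ha : a < n) (hb : b < n) (hz : z < n) (h0 : 0 ≤ t)
    (h1 : t ≤ 1) : A.pay z + A.bottom n < t * A.pay a + (1 - t) * A.pay b := by
  have h : ∀ v, v < n → |A.pay v| ≤ ∑ v ∈ Finset.range n, |A.pay v| := fun v hv =>
    Finset.single_le_sum (f := fun v => |A.pay v|) (fun v _ => abs_nonneg _)
      (Finset.mem_range.2 hv)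
  have ea := abs_le.1 (h a ha)
  have eb := abs_le.1 (h b hb)
  have ez := abs_le.1 (h z hz)
  unfold bottom
  nlinarith [mul_le_mul_of_nonneg_left ea.1 h0, mul_le_mul_of_nonneg_left eb.1 (sub_nonneg.2 h1)]

-- Any admissible node `w` above a terminal node may supply the constant there, since `IsThreat`
-- does not specify which; the proof of strong inducibility shows that the choice cannot matter.
open Classical in
theorem exists_isThreat (c i a b : ℕ) (up bot : ℝ) : ∃ V, A.IsThreat 0 n c i a b up bot V := by
  refine ⟨fun z => if z = a ∨ z = b then up - A.pay z else
    if h : ∃ w, 0 < w ∧ w < n ∧ (w = i ∨ A.OffPath c w) ∧ A.Anc w z then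
      A.value h.choose - A.pay z else bot, by simp, by simp, fun z _ _ _ za zb => ?_⟩
  by_cases h : ∃ w, 0 < w ∧ w < n ∧ (w = i ∨ A.OffPath c w) ∧ A.Anc w z
  · obtain ⟨h1, h2, h3, h4⟩ := h.choose_spec
    exact .inl ⟨h.choose, h1, h2, h3, h4, by simp [za, zb, h]⟩
  · refine .inr ⟨fun w h1 h2 h3 h4 => h ⟨w, h1, h2, h3, h4⟩, by simp [za, zb, h]⟩

/-- The arrays describe the game `G`, and `F` is the payoff function of the follower. -/
structure Describes (A : Arrays) (F : ℕ → ℝ) (G : Game) : Prop where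
  fits : A.Fits G.tree 0
  pay : atLeaves A.pay G.tree 0 = G.uL
  payF : atLeaves F G.tree 0 = G.uF

variable {G : Game}

theorem Describes.stronglyInduces (hG : A.Describes F G) {c i a b : ℕ} {t : ℝ} {V : ℕ → ℝ}
    (hc : c < G.size) (hb : b < G.size) (ha : a < G.size) (hsw : A.Switch 0 G.size c i)
    (ka : A.kind a = 0)
    (kb : A.kind b = 0) (hca : A.Anc c a) (hcb : A.Anc c b) (hp : A.IsPair 0 G.size a b t)
    (ht : t ≤ 1) (hthr : A.threshold G.size c i < t * A.pay a + (1 - t) * A.pay b)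
    (hV : A.IsThreat 0 G.size c i a b (t * A.pay a + (1 - t) * A.pay b) (A.bottom G.size) V) :
    StronglyInduces G.uL (atLeaves V G.tree 0) (atLeaves (pairDist a b t) G.tree 0) := by
  have hs : 0 + G.tree.size = G.size := zero_add _
  have := IsThreat.stronglyInduces ka kb hca hcb rfl bottom_neg (T := G.tree) (pos := 0)
    hG.fits (Nat.zero_le c) (by rwa [hs]) (by rwa [hs])
    (by rw [hs]; exact exceeds_of_threshold_lt hthr) (by rwa [hs]) (by rwa [hs])
    (fun z _ hz _ => pay_add_bottom_lt ha hb (by rwa [hs] at hz) hp.nonneg ht)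
  rw [← hG.pay]
  exact this.1

theorem Describes.mem_SP (hG : A.Describes F G) {c i a b : ℕ} {t : ℝ}
    (hc : c < G.size) (hb : b < G.size) (ha : a < G.size) (hsw : A.Switch 0 G.size c i)
    (ka : A.kind a = 0) (kb : A.kind b = 0) (hca : A.Anc c a) (hcb : A.Anc c b)
    (hp : A.IsPair 0 G.size a b t) (ht : t ≤ 1)
    (hthr : A.threshold G.size c i < t * A.pay a + (1 - t) * A.pay b) :
    atLeaves (pairDist a b t) G.tree 0 ∈ G.SP ∧
      expect G.uF (atLeaves (pairDist a b t) G.tree 0) = t * F a + (1 - t) * F b := by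
  have hs : 0 + G.tree.size = G.size := zero_add _
  obtain ⟨V, hV⟩ := A.exists_isThreat (n := G.size) c i a b (t * A.pay a + (1 - t) * A.pay b)
    (A.bottom G.size)
  have hI := hG.stronglyInduces hc hb ha hsw ka kb hca hcb hp ht hthr hV
  refine ⟨⟨hI.mem_stdSimplex, _, hI⟩, ?_⟩
  rw [← hG.payF]
  exact hp.expect_eq hG.fits ka kb (Nat.zero_le a) (by rwa [hs]) (Nat.zero_le b) (by rwa [hs]) F

theorem LeafTarget.isPair {lo hi a : ℕ} : A.IsPair lo hi a a 1 := .inl ⟨rfl, rfl⟩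

theorem LeafTarget.mem_SP {c i a : ℕ} (h : A.LeafTarget G.size c i a) (hG : A.Describes F G) :
    atLeaves (pairDist a a 1) G.tree 0 ∈ G.SP ∧
      expect G.uF (atLeaves (pairDist a a 1) G.tree 0) = F a := by
  obtain ⟨hc, -, ha, hsw, ka, hca, hthr⟩ := h
  have := hG.mem_SP hc ha ha hsw ka ka hca hca isPair le_rfl (by linarith)
  simpa using this

theorem PairTarget.pairProb_mem {c i a b : ℕ} (h : A.PairTarget F n c i a b) :
    0 < A.pay a - A.pay b ∧ 0 ≤ A.pairProb n c i a b ∧ A.pairProb n c i a b < 1 := by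
  obtain ⟨⟨-, -, -, -, -, -, h1⟩, -, -, -, h2, -⟩ := h
  have hd : 0 < A.pay a - A.pay b := by linarith
  exact ⟨hd, div_nonneg (by linarith) hd.le, (div_lt_one hd).2 (by linarith)⟩

theorem PairTarget.threshold_lt {c i a b : ℕ} (h : A.PairTarget F n c i a b) {t : ℝ}
    (ht : A.pairProb n c i a b < t) :
    A.threshold n c i < t * A.pay a + (1 - t) * A.pay b := by
  have hd := h.pairProb_mem.1
  rw [pairProb, div_lt_iff₀ hd] at ht
  linarith

theorem PairTarget.isPair {c i a b : ℕ} (h : A.PairTarget F n c i a b) {t : ℝ}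
    (ht : A.pairProb n c i a b < t) (ht1 : t < 1) : A.IsPair 0 n a b t :=
  .inr ⟨h.2.2.2.2.2.2, h.pairProb_mem.2.1.trans_lt ht, ht1, by
    have := h.pairProb_mem.1
    intro heq
    linarith⟩

/-- The follower's payoff decreases linearly in `t`, so `pairValue` is approached as `t` falls to
`pairProb`. At `t = pairProb` itself the leader would get exactly the threshold, which is not
enough. -/
theorem PairTarget.mem_SP {c i a b : ℕ} (h : A.PairTarget F G.size c i a b)
    (hG : A.Describes F G) {t : ℝ} (ht : A.pairProb G.size c i a b < t) (ht1 : t < 1) :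
    atLeaves (pairDist a b t) G.tree 0 ∈ G.SP ∧
      expect G.uF (atLeaves (pairDist a b t) G.tree 0) =
        A.pairValue F G.size c i a b - (t - A.pairProb G.size c i a b) * (F b - F a) := by
  have hthr := h.threshold_lt ht
  have hp := h.isPair ht ht1
  obtain ⟨⟨hc, -, ha, hsw, ka, hca, -⟩, hb, kb, hcb, -⟩ := h
  obtain ⟨h1, h2⟩ := hG.mem_SP hc hb ha hsw ka kb hca hcb hp ht1.le hthr
  refine ⟨h1, ?_⟩
  rw [h2, pairValue]
  ring

/-- By `exists_switch`, a mixture of `a` and `b` above the threshold dominates `p`. If both nodes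
are above it, the one better for the follower is a leaf target. If only one is, then either it is
the better one for him, or shifting weight towards the other improves his payoff up to the pair
value, strictly because the threshold is exceeded strictly. -/
theorem Describes.exists_target (hG : A.Describes F G) {p : G.tree.Leaf → ℝ} (hp : p ∈ G.SP) :
    (∃ c i a, A.LeafTarget G.size c i a ∧ expect G.uF p ≤ F a) ∨
      ∃ c i a b, A.PairTarget F G.size c i a b ∧
        expect G.uF p < A.pairValue F G.size c i a b := by
  have hs : 0 + G.tree.size = G.size := zero_add _
  obtain ⟨-, v, hv⟩ := hp
  rw [← hG.pay] at hv
  obtain ⟨c, i, -, hc, hsw, hex, a, b, t, ka, kb, hca, hcb, hf, h0, h1, hu, hF⟩ :=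
    exists_switch F hG.fits v p hv
  rw [hs] at hc hsw hex hf
  rw [hG.payF] at hF
  have hpast := (hG.fits.bounds (Nat.zero_le c) (by rwa [hs])).2.1
  rw [hs] at hpast
  have ha : a < G.size := hca.2.trans_le hpast
  have hb : b < G.size := hcb.2.trans_le hpast
  have hi : i < G.size := by
    rcases hsw with h | h
    · omega
    · exact h.2.2.1
  -- the threshold is exceeded
  have hthr : A.threshold G.size c i < t * A.pay a + (1 - t) * A.pay b := by
    rw [Arrays.threshold_lt]
    refine ⟨?_, fun w w1 w2 hw => (hex.2 w w1 w2 hw).trans_le hu⟩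
    -- For `i = 0` the node `c` is terminal, hence `a = b = c`, and the default `A.pay c - 1` is
    -- exceeded.
    split_ifs with hi0
    · have hkc : A.kind c = 0 := by
        rcases hsw with h | h
        · exact h.2
        · omega
      obtain ⟨ζ, hζ⟩ := hG.fits.exists_leafPos (Nat.zero_le c) (by rwa [hs]) hkc
      have hpast : A.past c = c + 1 := by
        have key : ∀ {T : GameTree} {pos : ℕ}, A.Fits T pos → pos ≤ c → c < pos + T.size →
            A.past c = c + 1 := by
          intro T
          induction T with
          | leaf =>
            intro pos h h1 h2
            simp only [size] at h2
            obtain rfl : c = pos := by omega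
            exact h.2.1
          | node o k child ih =>
            intro pos h h1 h2
            have hne : pos ≠ c := by
              rintro rfl
              have := h.1
              rw [hkc] at this
              cases o <;> simp [Player.code] at this
            obtain ⟨j, j1, j2⟩ := h.exists_child (lt_of_le_of_ne h1 hne) h2
            exact ih j (h.2.2.2 j).2 j1 j2
        exact key hG.fits (Nat.zero_le c) (by rwa [hs])
      have hac : a = c := by have := hca.1; have := hca.2; omega
      have hbc : b = c := by have := hcb.1; have := hcb.2; omega
      rw [hac, hbc]
      linarith
    · exact (hex.1 hi0).trans_le hu
  have leafa : A.threshold G.size c i < A.pay a → A.LeafTarget G.size c i a :=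
    fun h => ⟨hc, hi, ha, hsw, ka, hca, h⟩
  have leafb : A.threshold G.size c i < A.pay b → A.LeafTarget G.size c i b :=
    fun h => ⟨hc, hi, hb, hsw, kb, hcb, h⟩
  have pair : ∀ {a b : ℕ} {t : ℝ}, A.LeafTarget G.size c i a → b < G.size → A.kind b = 0 →
      A.Anc c b → (a = b ∨ A.Forks 0 G.size a b) → 0 ≤ t → t ≤ 1 →
      A.pay b ≤ A.threshold G.size c i →
      A.threshold G.size c i < t * A.pay a + (1 - t) * A.pay b →
      expect G.uF p ≤ t * F a + (1 - t) * F b →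
      (∃ c i a, A.LeafTarget G.size c i a ∧ expect G.uF p ≤ F a) ∨
      ∃ c i a b, A.PairTarget F G.size c i a b ∧
        expect G.uF p < A.pairValue F G.size c i a b := by
    intro a b t hl hb kb hcb hf h0 h1 hle hthr hF
    by_cases hFab : F a < F b
    · have hfork : A.Forks 0 G.size a b := by
        rcases hf with rfl | hf
        · exact absurd hFab (lt_irrefl _)
        · exact hf
      have hP : A.PairTarget F G.size c i a b := ⟨hl, hb, kb, hcb, hle, hFab, hfork⟩
      refine .inr ⟨c, i, a, b, hP, hF.trans_lt ?_⟩
      have hd := hP.pairProb_mem.1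
      have htp : A.pairProb G.size c i a b < t := by
        rw [pairProb, div_lt_iff₀ hd]
        linarith
      rw [pairValue]
      nlinarith
    · refine .inl ⟨c, i, a, hl, hF.trans ?_⟩
      nlinarith
  rcases le_or_gt (A.pay a) (A.threshold G.size c i) with hla | hla
  · rcases le_or_gt (A.pay b) (A.threshold G.size c i) with hlb | hlb
    · nlinarith
    · refine pair (t := 1 - t) (leafb hlb) ha ka hca ?_ (by linarith) (by linarith) hla
        (by linarith) (by linarith)
      rcases hf with rfl | ⟨w₁, w₂, l1, u1, l2, u2, hne, hpp, hk, hA, hB⟩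
      · exact .inl rfl
      · exact .inr ⟨w₂, w₁, l2, u2, l1, u1, hne.symm, hpp.symm, hpp ▸ hk, hB, hA⟩
  · rcases le_or_gt (A.pay b) (A.threshold G.size c i) with hlb | hlb
    · exact pair (leafa hla) hb kb hcb hf h0 h1 hlb hthr hF
    · rcases le_or_gt (F a) (F b) with hab | hab
      · exact .inl ⟨c, i, b, leafb hlb, by nlinarith⟩
      · exact .inl ⟨c, i, a, leafa hla, by nlinarith⟩

/-- A pair target contains a leaf target, namely its node `a`, so pairs are not needed to decide
this. -/
theorem Describes.nonempty_SP_iff (hG : A.Describes F G) :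
    G.SP.Nonempty ↔ ∃ c i a, A.LeafTarget G.size c i a := by
  constructor
  · rintro ⟨p, hp⟩
    rcases hG.exists_target hp with ⟨c, i, a, h, -⟩ | ⟨c, i, a, b, h, -⟩
    · exact ⟨c, i, a, h⟩
    · exact ⟨c, i, a, h.1⟩
  · rintro ⟨c, i, a, h⟩
    exact ⟨_, (h.mem_SP hG).1⟩

theorem Describes.isOptimal (hG : A.Describes F G) {c i a : ℕ} (h : A.LeafTarget G.size c i a)
    (hL : ∀ c' i' a', A.LeafTarget G.size c' i' a' → F a' ≤ F a)
    (hP : ∀ c' i' a' b', A.PairTarget F G.size c' i' a' b' →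
      A.pairValue F G.size c' i' a' b' ≤ F a) :
    G.IsOptimal (atLeaves (pairDist a a 1) G.tree 0) := by
  obtain ⟨h1, h2⟩ := h.mem_SP hG
  refine ⟨h1, fun q hq => ?_⟩
  rw [h2]
  rcases hG.exists_target hq with ⟨c', i', a', h', hle⟩ | ⟨c', i', a', b', h', hlt⟩
  · exact hle.trans (hL c' i' a' h')
  · exact hlt.le.trans (hP c' i' a' b' h')

theorem Describes.lt_pairValue (hG : A.Describes F G) {c i a b : ℕ}
    (hL : ∀ c' i' a', A.LeafTarget G.size c' i' a' → F a' < A.pairValue F G.size c i a b)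
    (hP : ∀ c' i' a' b', A.PairTarget F G.size c' i' a' b' →
      A.pairValue F G.size c' i' a' b' ≤ A.pairValue F G.size c i a b) {p : G.tree.Leaf → ℝ}
    (hp : p ∈ G.SP) : expect G.uF p < A.pairValue F G.size c i a b := by
  rcases hG.exists_target hp with ⟨c', i', a', h', hle⟩ | ⟨c', i', a', b', h', hlt⟩
  · exact hle.trans_lt (hL c' i' a' h')
  · exact hlt.trans_le (hP c' i' a' b' h')

theorem Describes.isNearOptimal (hG : A.Describes F G) {c i a b : ℕ}
    (h : A.PairTarget F G.size c i a b)
    (hL : ∀ c' i' a', A.LeafTarget G.size c' i' a' → F a' < A.pairValue F G.size c i a b)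
    (hP : ∀ c' i' a' b', A.PairTarget F G.size c' i' a' b' →
      A.pairValue F G.size c' i' a' b' ≤ A.pairValue F G.size c i a b) {t ε : ℝ}
    (ht : A.pairProb G.size c i a b < t) (ht1 : t < 1)
    (hε : (t - A.pairProb G.size c i a b) * (F b - F a) ≤ ε) :
    G.IsNearOptimal ε (atLeaves (pairDist a b t) G.tree 0) := by
  obtain ⟨h1, h2⟩ := h.mem_SP hG ht ht1
  refine ⟨h1, ?_⟩
  rw [h2]
  have : sSup (expect G.uF '' G.SP) ≤ A.pairValue F G.size c i a b := by
    refine csSup_le ⟨_, _, h1, rfl⟩ ?_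
    rintro x ⟨q, hq, rfl⟩
    exact (hG.lt_pairValue hL hP hq).le
  linarith

/-- Every strongly inducible distribution stays strictly below the best pair value by
`lt_pairValue`, and mixtures with `t` close enough to `pairProb` do better than any given one. -/
theorem Describes.not_exists_isOptimal (hG : A.Describes F G) {c i a b : ℕ}
    (h : A.PairTarget F G.size c i a b)
    (hL : ∀ c' i' a', A.LeafTarget G.size c' i' a' → F a' < A.pairValue F G.size c i a b)
    (hP : ∀ c' i' a' b', A.PairTarget F G.size c' i' a' b' →
      A.pairValue F G.size c' i' a' b' ≤ A.pairValue F G.size c i a b) :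
    ¬ ∃ p, G.IsOptimal p := by
  rintro ⟨p, hp⟩
  have hlt := hG.lt_pairValue hL hP hp.1
  have hF : 0 < F b - F a := sub_pos.2 h.2.2.2.2.2.1
  have hs := h.pairProb_mem.2.2
  set s := A.pairProb G.size c i a b
  obtain ⟨t, ht, ht'⟩ := exists_between (show s < min 1 (s +
    (A.pairValue F G.size c i a b - expect G.uF p) / (F b - F a)) from
      lt_min hs (lt_add_of_pos_right _ (div_pos (sub_pos.2 hlt) hF)))
  rw [lt_min_iff, ← sub_lt_iff_lt_add', lt_div_iff₀ hF] at ht'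
  obtain ⟨h1, h2⟩ := h.mem_SP hG ht ht'.1
  have := hp.2 _ h1
  rw [h2] at this
  linarith [ht'.2]

end Arrays

end Stackelberg

namespace Stackelberg

/-! ### The input -/

theorem getElem?_flatten_ofFn {α : Type*} : ∀ {k : ℕ} (f : Fin k → List α) (j : Fin k) (r : ℕ),
    r < (f j).length →
    (List.ofFn f).flatten[(∑ l ∈ Finset.univ.filter (· < j), (f l).length) + r]? = (f j)[r]?
  | 0, _, j, _, _ => j.elim0
  | k + 1, f, j, r, hr => by
    rw [List.ofFn_succ, List.flatten_cons, Finset.sum_filter, Fin.sum_univ_succ]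
    induction j using Fin.cases with
    | zero =>
      simp only [lt_irrefl, if_false, Fin.not_lt_zero, Finset.sum_const_zero, zero_add]
      rw [List.getElem?_append_left hr]
    | succ j =>
      simp only [Fin.succ_pos, if_true, Fin.succ_lt_succ_iff]
      rw [add_assoc, List.getElem?_append_right (Nat.le_add_right _ _), Nat.add_sub_cancel_left,
        ← Finset.sum_filter]
      exact getElem?_flatten_ofFn (fun l => f l.succ) j r hr

namespace GameTree

theorem length_rows : (T : GameTree) → (u w : T.Leaf → ℝ) → (pos par : ℕ) →
    (T.rows u w pos par).length = T.size
  | .leaf, _, _, _, _ => rfl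
  | .node o k child, u, w, pos, par => by
    simp only [rows, List.length_cons, List.length_flatten, List.map_ofFn, List.sum_ofFn, size,
      Function.comp_def, length_rows]
    omega

theorem rows_child {o : Player} {k : ℕ} {child : Fin (k + 1) → GameTree}
    (u w : (node o k child).Leaf → ℝ) (pos par : ℕ) (j : Fin (k + 1)) {r : ℕ}
    (hr : r < (child j).size) : ((node o k child).rows u w pos par)[childPos child j + r]? =
      ((child j).rows (fun z => u ⟨j, z⟩) (fun z => w ⟨j, z⟩) (pos + childPos child j) pos)[r]? := by
  have := getElem?_flatten_ofFn (fun j => (child j).rows (fun z => u ⟨j, z⟩) (fun z => w ⟨j, z⟩)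
    (pos + childPos child j) pos) j r (by rw [length_rows]; exact hr)
  simp only [length_rows] at this
  rw [rows, childPos, show ∀ x : ℕ, 1 + x + r = x + r + 1 by intro x; omega,
    List.getElem?_cons_succ, this]
  rfl

end GameTree

/-! ### From the input records and table entries to `Fits` -/

namespace Arrays

open GameTree

/-- The kinds and parents are those of the given tree, from position `pos` on. -/
def Shape (A : Arrays) : GameTree → ℕ → Prop
  | .leaf, pos => A.kind pos = 0
  | .node o _ child, pos => A.kind pos = o.code ∧
      ∀ j, A.parent (pos + childPos child j) = pos ∧ A.Shape (child j) (pos + childPos child j)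

variable {A : Arrays} {F : ℕ → ℝ}

theorem shape_of_rows : {T : GameTree} → {u w : T.Leaf → ℝ} → {pos par : ℕ} →
    (∀ r < T.size, (T.rows u w pos par)[r]? =
      some ⟨A.kind (pos + r), A.parent (pos + r), A.pay (pos + r), F (pos + r)⟩) →
    A.parent pos = par ∧ A.Shape T pos ∧ atLeaves A.pay T pos = u ∧ atLeaves F T pos = w
  | .leaf, u, w, pos, par, h => by
    have h := h 0 one_pos
    simp only [rows, List.getElem?_cons_zero, Option.some.injEq, Row.mk.injEq, add_zero] at h
    exact ⟨h.2.1.symm, h.1.symm, funext fun z => h.2.2.1.symm, funext fun z => h.2.2.2.symm⟩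
  | .node o k child, u, w, pos, par, h => by
    have h0 := h 0 (size_pos _)
    simp only [rows, List.getElem?_cons_zero, Option.some.injEq, Row.mk.injEq, add_zero] at h0
    have hj : ∀ j, _ := fun j => shape_of_rows (T := child j)
      (u := fun z => u ⟨j, z⟩) (w := fun z => w ⟨j, z⟩) (pos := pos + childPos child j)
      (par := pos) fun r hr => by
        have := childPos_add_size_le_size o child j
        rw [← rows_child u w pos par j hr, h _ (by omega)]
        simp only [add_assoc]
    refine ⟨h0.2.1.symm, ⟨h0.1.symm, fun j => ⟨(hj j).1, (hj j).2.1⟩⟩, ?_, ?_⟩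
    · funext ⟨j, z⟩
      rw [atLeaves_node]
      exact congrFun (hj j).2.2.1 z
    · funext ⟨j, z⟩
      rw [atLeaves_node]
      exact congrFun (hj j).2.2.2 z

theorem shape_row {G : Game} (hk : A.kind = fun i => (G.row i).kind)
    (hp : A.parent = fun i => (G.row i).parent) (hu : A.pay = fun i => (G.row i).uL) :
    A.Shape G.tree 0 ∧ atLeaves A.pay G.tree 0 = G.uL ∧
      atLeaves (fun i => (G.row i).uF) G.tree 0 = G.uF := by
  refine (shape_of_rows (par := 0) fun r hr => ?_).2
  have hl : r < (G.tree.rows G.uL G.uF 0 0).length := by rw [length_rows]; exact hr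
  rw [hk, hp, hu, List.getElem?_eq_getElem hl, zero_add]
  simp only [Game.row]
  rw [List.getD_eq_getElem _ _ hl]

/-- The defining properties of the entries of the tables at node `v`. -/
structure TableRow (A : Arrays) (n v : ℕ) : Prop where
  lt_past : v + 1 ≤ A.past v
  past_le : ∀ w, v < w → w < n → A.parent w = v → A.past w ≤ A.past v
  past_eq : A.past v = v + 1 ∨ ∃ w, v < w ∧ w < n ∧ A.parent w = v ∧ A.past v = A.past w
  value_leaf : (∀ w, v < w → w < n → A.parent w ≠ v) → A.value v = A.pay v
  value_eq : ∀ w, v < w → w < n → A.parent w = v →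
    ∃ w, v < w ∧ w < n ∧ A.parent w = v ∧ A.value v = A.value w
  le_value : A.kind v ≤ 1 → ∀ w, v < w → w < n → A.parent w = v → A.value w ≤ A.value v
  value_le : ¬ A.kind v ≤ 1 → ∀ w, v < w → w < n → A.parent w = v → A.value v ≤ A.value w

theorem Shape.bounds : {T : GameTree} → {pos : ℕ} → A.Shape T pos → ∀ {w : ℕ}, pos < w →
    w < pos + T.size → pos ≤ A.parent w ∧ A.parent w < w
  | .leaf, pos, _, w, h1, h2 => by simp only [size] at h2; omega
  | .node o k child, pos, h, w, h1, h2 => by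
    obtain ⟨j, hj1, hj2⟩ := exists_childPos_le (o := o) (child := child) (r := w - pos)
      (by omega) (by omega)
    have hj := h.2 j
    have c1 := one_le_childPos child j
    rcases (show pos + childPos child j ≤ w by omega).eq_or_lt with rfl | hlt
    · rw [hj.1]; omega
    · have := hj.2.bounds hlt (by omega)
      omega

/-- The properties in `TableRow` are the recursions for interval ends and maximin values, and an
induction on the tree solves them. The last hypothesis says that later nodes with a parent in the
subtree belong to it, so that scanning for nodes with parent `v` finds exactly the children of `v`.
-/
theorem fits_of_tableRow {n : ℕ} (ht : ∀ v < n, A.TableRow n v) : {T : GameTree} → {pos : ℕ} →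
    A.Shape T pos → pos + T.size ≤ n →
    (∀ w, pos < w → w < n → pos ≤ A.parent w → A.parent w < pos + T.size → w < pos + T.size) →
    A.Fits T pos
  | .leaf, pos, h, hn, hout => by
    simp only [size] at hn hout
    have hno : ∀ w, pos < w → w < n → A.parent w ≠ pos := by
      intro w h1 h2 h3
      have := hout w h1 h2 (by omega) (by omega)
      omega
    have r := ht pos (by omega)
    refine ⟨h, ?_, r.value_leaf hno⟩
    rcases r.past_eq with h | ⟨w, h1, h2, h3, -⟩
    · exact h
    · exact absurd h3 (hno w h1 h2)
  | .node o k child, pos, h, hn, hout => by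
    have hb : ∀ {w}, pos < w → w < n → pos ≤ A.parent w →
        A.parent w < pos + (node o k child).size → ∃ j, pos + childPos child j ≤ w ∧
          w < pos + childPos child j + (child j).size ∧ (w = pos + childPos child j ∨
            pos + childPos child j < w ∧ pos + childPos child j ≤ A.parent w ∧
              A.parent w < w) := by
      intro w w1 w2 w3 w4
      have w5 := hout w w1 w2 w3 w4
      obtain ⟨j, j1, j2⟩ := exists_childPos_le (o := o) (child := child) (r := w - pos)
        (by omega) (by omega)
      refine ⟨j, by omega, by omega, ?_⟩
      rcases (show pos + childPos child j ≤ w by omega).eq_or_lt with h0 | h0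
      · exact .inl h0.symm
      · exact .inr ⟨h0, (h.2 j).2.bounds h0 (by omega)⟩
    have hchild : ∀ j, A.Fits (child j) (pos + childPos child j) := by
      intro j
      have s1 := childPos_add_size_le_size o child j
      have c1 := one_le_childPos child j
      refine fits_of_tableRow ht (h.2 j).2 (by omega) fun w w1 w2 w3 w4 => ?_
      obtain ⟨l, l1, l2, l3⟩ := hb (by omega) w2 (by omega) (by omega)
      have cl := one_le_childPos child l
      by_cases hlj : l = j
      · subst hlj; exact l2
      · have hd := child_disjoint child hlj
        rcases l3 with rfl | l3
        · rw [(h.2 l).1] at w3; omega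
        · omega
    have hpos : pos < n := by have := size_pos (node o k child); omega
    have r := ht pos hpos
    have hc : ∀ j, pos < pos + childPos child j ∧ pos + childPos child j < n ∧
        A.parent (pos + childPos child j) = pos := by
      intro j
      have s1 := childPos_add_size_le_size o child j
      have c1 := one_le_childPos child j
      have p1 := size_pos (child j)
      exact ⟨by omega, by omega, (h.2 j).1⟩
    have hroot : ∀ w, pos < w → w < n → A.parent w = pos → ∃ j, w = pos + childPos child j := by
      intro w w1 w2 w3
      obtain ⟨j, j1, j2, j3⟩ := hb w1 w2 (by omega)
        (by have := size_pos (node o k child); omega)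
      have cj := one_le_childPos child j
      exact ⟨j, by omega⟩
    have hval : ∀ j, A.value (pos + childPos child j) =
        (child j).maximin fun z => atLeaves A.pay (node o k child) pos ⟨j, z⟩ := by
      intro j
      rw [(hchild j).value_eq, atLeaves_child]
    obtain ⟨j₀, hj₀⟩ : ∃ j, A.value pos = A.value (pos + childPos child j) := by
      obtain ⟨w, w1, w2, w3, w4⟩ := r.value_eq _ (hc 0).1 (hc 0).2.1 (hc 0).2.2
      obtain ⟨j, rfl⟩ := hroot w w1 w2 w3
      exact ⟨j, w4⟩
    refine ⟨h.1, ?_, ?_, fun j => ⟨(h.2 j).1, hchild j⟩⟩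
    · have hlast := childPos_add_size child (Fin.last k)
      rw [Finset.filter_true_of_mem fun l _ => Fin.le_last l] at hlast
      apply le_antisymm
      · rcases r.past_eq with he | ⟨w, w1, w2, w3, w4⟩
        · have := size_pos (node o k child); omega
        · obtain ⟨j, rfl⟩ := hroot w w1 w2 w3
          have s1 := childPos_add_size_le_size o child j
          rw [w4, (hchild j).past_eq]
          omega
      · have := r.past_le _ (hc (Fin.last k)).1 (hc (Fin.last k)).2.1 (hc (Fin.last k)).2.2
        rw [(hchild _).past_eq] at this
        simp only [size]
        omega
    · cases o with
      | leader =>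
        have hk : A.kind pos ≤ 1 := by rw [h.1]; exact le_rfl
        rw [maximin]
        apply le_antisymm
        · rw [hj₀, hval]
          exact Finset.le_sup' (fun j => (child j).maximin
            fun z => atLeaves A.pay (node .leader k child) pos ⟨j, z⟩) (Finset.mem_univ j₀)
        · refine Finset.sup'_le _ _ fun j _ => ?_
          rw [← hval]
          exact r.le_value hk _ (hc j).1 (hc j).2.1 (hc j).2.2
      | follower =>
        have hk : ¬ A.kind pos ≤ 1 := by rw [h.1]; decide
        rw [maximin]
        apply le_antisymm
        · refine Finset.le_inf' _ _ fun j _ => ?_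
          rw [← hval]
          exact r.value_le hk _ (hc j).1 (hc j).2.1 (hc j).2.2
        · rw [hj₀, hval]
          exact Finset.inf'_le (fun j => (child j).maximin
            fun z => atLeaves A.pay (node .follower k child) pos ⟨j, z⟩) (Finset.mem_univ j₀)

end Arrays

end Stackelberg

/-! ### The program for the tables -/

namespace Stackelberg

namespace Cmd

/-- Run `C` if `e ≤ f` for all pairs `(e, f)` in the list. -/
def guard (l : List (NatExpr × NatExpr)) (C : Cmd) : Cmd :=
  l.foldr (fun p C => iteNat p.1 p.2 C skip) C

theorem run_guard (l : List (NatExpr × NatExpr)) (C : Cmd) (m : Memory) :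
    (guard l C).run m = if ∀ p ∈ l, p.1.eval m ≤ p.2.eval m then C.run m else m := by
  induction l with
  | nil => simp [guard]
  | cons p l ih =>
    have ih : (List.foldr (fun p C => iteNat p.1 p.2 C skip) C l).run m = _ := ih
    simp only [guard, List.foldr_cons, run, ih, List.forall_mem_cons]
    by_cases h : p.1.eval m ≤ p.2.eval m
    · rw [if_pos h]
      exact if_congr (by simp [h]) rfl rfl
    · rw [if_neg h, if_neg fun hh => h hh.1]

end Cmd

/-- The number kept in cell `0` of bank `x`. -/
def NatExpr.var (x : ℕ) : NatExpr := .cell x (.const 0)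

/-- The real number kept in cell `0` of bank `x`. -/
def RealExpr.var (x : ℕ) : RealExpr := .cell x (.const 0)

@[simp] theorem NatExpr.eval_var (m : Memory) (x : ℕ) : (NatExpr.var x).eval m = m.nat x 0 := rfl

@[simp] theorem RealExpr.eval_var (m : Memory) (x : ℕ) :
    (RealExpr.var x).eval m = m.real x 0 := rfl

/-- The arrays in memory. -/
def Memory.arrays (m : Memory) : Arrays where
  kind := m.nat 1
  parent := m.nat 2
  past := m.nat 4
  pay := m.real 0
  value := m.real 5

namespace Cmd

open NatExpr in
/-- Enter the child in cell `0` of bank `7` into the tables at the node in cell `0` of bank `6`;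
cell `0` of bank `8` tells whether it is the first child. -/
def tableStep : Cmd :=
  guard [(.add (var 6) (.const 1), var 7), (.cell 2 (var 7), var 6), (var 6, .cell 2 (var 7))]
    (seq
      (iteNat (var 8) (.const 0)
        (seq (setNat 8 (.const 0) (.const 1)) (setReal 5 (var 6) (.cell 5 (var 7))))
        -- Kind `1` takes the maximum and kind `2` the minimum. A terminal node has kind `0` but no
        -- children, so it keeps the payoff with which the entry was initialised.
        (iteNat (.cell 1 (var 6)) (.const 1)
          (iteReal (.cell 5 (var 6)) (.cell 5 (var 7))
            (setReal 5 (var 6) (.cell 5 (var 7))) skip)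
          (iteReal (.cell 5 (var 7)) (.cell 5 (var 6))
            (setReal 5 (var 6) (.cell 5 (var 7))) skip)))
      (iteNat (.cell 4 (var 6)) (.cell 4 (var 7))
        (setNat 4 (var 6) (.cell 4 (var 7))) skip))

open NatExpr in
/-- Compute the ends of the subtrees and the maximin values, in reverse preorder. -/
def tables : Cmd :=
  -- Round `t` treats node `n - 1 - t`; children have larger numbers than their parent, so their
  -- entries are final when they are used.
  loop 9 (seq (setNat 6 (.const 0) (.sub (.sub (var 0) (.const 1)) (var 9)))
    (seq (setNat 4 (var 6) (.add (var 6) (.const 1)))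
      (seq (setReal 5 (var 6) (.cell 0 (var 6)))
        (seq (setNat 8 (.const 0) (.const 0)) (loop 7 tableStep)))))

/-- The invariant of the inner loop: `A` are the arrays at its start, and the children before `j`
have been entered into the tables at `v`. -/
structure TableInv (A : Arrays) (v j : ℕ) (m : Memory) : Prop where
  kind : m.nat 1 = A.kind
  parent : m.nat 2 = A.parent
  node : m.nat 6 0 = v
  pay : m.real 0 = A.pay
  past_ne : ∀ x ≠ v, m.nat 4 x = A.past x
  value_ne : ∀ x ≠ v, m.real 5 x = A.value x
  lt_past : v + 1 ≤ m.nat 4 v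
  past_le : ∀ w, v < w → w < j → A.parent w = v → A.past w ≤ m.nat 4 v
  past_eq : m.nat 4 v = v + 1 ∨ ∃ w, v < w ∧ w < j ∧ A.parent w = v ∧ m.nat 4 v = A.past w
  first : m.nat 8 0 = 0 → m.real 5 v = A.pay v ∧ ∀ w, v < w → w < j → A.parent w ≠ v
  later : m.nat 8 0 ≠ 0 → ∃ w, v < w ∧ w < j ∧ A.parent w = v ∧ m.real 5 v = A.value w
  le_value : A.kind v ≤ 1 → ∀ w, v < w → w < j → A.parent w = v → A.value w ≤ m.real 5 v
  value_le : ¬ A.kind v ≤ 1 → ∀ w, v < w → w < j → A.parent w = v → m.real 5 v ≤ A.value w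

/-- Only the entries at `v` change, and only nodes `j > v` with parent `v` are entered, so the
entries that are read stay the same during the inner loop. -/
theorem TableInv.step {A : Arrays} {v j : ℕ} {m : Memory} (h : TableInv A v j m)
    (hj : m.nat 7 0 = j) : TableInv A v (j + 1) ((tableStep.run m).tick 7) := by
  have hlt : ∀ {w}, w < j + 1 → w = j ∨ w < j := by omega
  by_cases hg : v < j ∧ A.parent j = v
  · obtain ⟨hvj, hp⟩ := hg
    have hne : j ≠ v := by omega
    have hrun : tableStep.run m = (seq
      (iteNat (.var 8) (.const 0)
        (seq (setNat 8 (.const 0) (.const 1)) (setReal 5 (.var 6) (.cell 5 (.var 7))))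
        (iteNat (.cell 1 (.var 6)) (.const 1)
          (iteReal (.cell 5 (.var 6)) (.cell 5 (.var 7))
            (setReal 5 (.var 6) (.cell 5 (.var 7))) skip)
          (iteReal (.cell 5 (.var 7)) (.cell 5 (.var 6))
            (setReal 5 (.var 6) (.cell 5 (.var 7))) skip)))
      (iteNat (.cell 4 (.var 6)) (.cell 4 (.var 7))
        (setNat 4 (.var 6) (.cell 4 (.var 7))) skip)).run m := by
      rw [tableStep, run_guard, if_pos]
      simp [NatExpr.eval, h.parent, h.node, hj, hp, Nat.succ_le_of_lt hvj]
    rw [hrun]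
    -- the first part updates the value, the second part updates the end of the subtree
    obtain ⟨m₁, hm₁, hA, e1, e2, e3, e4, e5, e6, e7, e8, e9, e10⟩ : ∃ m₁, (iteNat (.var 8)
        (.const 0)
        (seq (setNat 8 (.const 0) (.const 1)) (setReal 5 (.var 6) (.cell 5 (.var 7))))
        (iteNat (.cell 1 (.var 6)) (.const 1)
          (iteReal (.cell 5 (.var 6)) (.cell 5 (.var 7))
            (setReal 5 (.var 6) (.cell 5 (.var 7))) skip)
          (iteReal (.cell 5 (.var 7)) (.cell 5 (.var 6))
            (setReal 5 (.var 6) (.cell 5 (.var 7))) skip))).run m = m₁ ∧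
        m₁.nat 1 = A.kind ∧ m₁.nat 2 = A.parent ∧ m₁.nat 6 0 = v ∧ m₁.real 0 = A.pay ∧
        m₁.nat 4 = m.nat 4 ∧ m₁.nat 7 0 = j ∧
        (∀ x ≠ v, m₁.real 5 x = A.value x) ∧ m₁.nat 8 0 ≠ 0 ∧
        (∃ w, v < w ∧ w < j + 1 ∧ A.parent w = v ∧ m₁.real 5 v = A.value w) ∧
        (A.kind v ≤ 1 → ∀ w, v < w → w < j + 1 → A.parent w = v → A.value w ≤ m₁.real 5 v) ∧
        (¬ A.kind v ≤ 1 → ∀ w, v < w → w < j + 1 → A.parent w = v →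
          m₁.real 5 v ≤ A.value w) := by
      have hval : m.real 5 j = A.value j := h.value_ne j hne
      refine ⟨_, rfl, ?_⟩
      by_cases h8 : m.nat 8 0 = 0
      · have hf := (h.first h8).2
        have hone : ∀ {w}, v < w → w < j + 1 → A.parent w = v → w = j := fun w1 w2 w3 =>
          (hlt w2).resolve_right fun h => hf _ w1 h w3
        simp only [run, NatExpr.eval, NatExpr.eval_var, RealExpr.eval, h8, le_refl, if_true]
        refine ⟨?_, ?_, ?_, h.pay, ?_, ?_, ?_, ?_, ⟨j, hvj, by omega, hp, ?_⟩, ?_, ?_⟩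
        · rw [← h.kind]; funext x; simp
        · rw [← h.parent]; funext x; simp
        · simpa using h.node
        · funext x; simp
        · simpa using hj
        · intro x hx; simp [h.node, hx, h.value_ne x hx]
        · simp
        · simp [h.node, hj, hval]
        · intro _ w w1 w2 w3
          obtain rfl := hone w1 w2 w3
          simp [h.node, hj, hval]
        · intro _ w w1 w2 w3
          obtain rfl := hone w1 w2 w3
          simp [h.node, hj, hval]
      · have h8' : ¬ m.nat 8 0 ≤ 0 := by omega
        obtain ⟨w₀, w01, w02, w03, w04⟩ := h.later h8
        simp only [run, NatExpr.eval, NatExpr.eval_var, RealExpr.eval, h8', if_false, h.node,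
          h.kind, hj, hval]
        by_cases hk : A.kind v ≤ 1
        · simp only [hk, if_true, not_true, false_imp_iff, and_true, true_imp_iff]
          have hle := h.le_value hk
          by_cases hc : m.real 5 v ≤ A.value j
          · rw [if_pos hc]
            refine ⟨h.kind, h.parent, h.node, h.pay, rfl, hj, ?_, h8, ⟨j, hvj, by omega, hp, ?_⟩,
              ?_⟩
            · intro x hx; simp [hx, h.value_ne x hx]
            · simp
            · intro w w1 w2 w3
              simp only [Memory.writeReal_real, and_self, if_true]
              rcases hlt w2 with rfl | w2
              · exact le_rfl
              · exact (hle w w1 w2 w3).trans hc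
          · rw [if_neg hc]
            refine ⟨h.kind, h.parent, h.node, h.pay, rfl, hj, h.value_ne, h8,
              ⟨w₀, w01, by omega, w03, w04⟩, ?_⟩
            intro w w1 w2 w3
            rcases hlt w2 with rfl | w2
            · exact (not_le.1 hc).le
            · exact hle w w1 w2 w3
        · simp only [hk, if_false, not_false_iff, false_imp_iff, true_and, true_imp_iff]
          have hle := h.value_le hk
          by_cases hc : A.value j ≤ m.real 5 v
          · rw [if_pos hc]
            refine ⟨h.kind, h.parent, h.node, h.pay, rfl, hj, ?_, h8, ⟨j, hvj, by omega, hp, ?_⟩,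
              ?_⟩
            · intro x hx; simp [hx, h.value_ne x hx]
            · simp
            · intro w w1 w2 w3
              simp only [Memory.writeReal_real, and_self, if_true]
              rcases hlt w2 with rfl | w2
              · exact le_rfl
              · exact hc.trans (hle w w1 w2 w3)
          · rw [if_neg hc]
            refine ⟨h.kind, h.parent, h.node, h.pay, rfl, hj, h.value_ne, h8,
              ⟨w₀, w01, by omega, w03, w04⟩, ?_⟩
            intro w w1 w2 w3
            rcases hlt w2 with rfl | w2
            · exact (not_le.1 hc).le
            · exact hle w w1 w2 w3
    rw [run, hm₁]
    have hpast : m.nat 4 j = A.past j := h.past_ne j hne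
    simp only [run, NatExpr.eval, NatExpr.eval_var, e2, e5, e4, hpast]
    by_cases hc : m.nat 4 v ≤ A.past j
    · rw [if_pos hc]
      constructor
      · rw [← hA]; funext x; simp
      · rw [← e1]; funext x; simp
      · simpa using e2
      · exact e3
      · intro x hx; simp [hx, e4, h.past_ne x hx]
      · exact e6
      · have := h.lt_past
        simp; omega
      · intro w w1 w2 w3
        simp only [Memory.tick_nat, Memory.writeNat_nat]
        norm_num
        rcases hlt w2 with rfl | w2
        · exact le_rfl
        · exact (h.past_le w w1 w2 w3).trans hc
      · exact .inr ⟨j, hvj, by omega, hp, by simp⟩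
      · intro h0; exact absurd (by simpa using h0) e7
      · intro _; exact e8
      · exact e9
      · exact e10
    · rw [if_neg hc]
      constructor
      · rw [← hA]; funext x; simp
      · rw [← e1]; funext x; simp
      · simpa using e2
      · exact e3
      · intro x hx; simp [e4, h.past_ne x hx]
      · exact e6
      · simpa [e4] using h.lt_past
      · intro w w1 w2 w3
        simp only [Memory.tick_nat, e4]
        norm_num
        rcases hlt w2 with rfl | w2
        · omega
        · exact h.past_le w w1 w2 w3
      · rcases h.past_eq with h1 | ⟨w, w1, w2, w3, w4⟩
        · exact .inl (by simpa [e4] using h1)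
        · exact .inr ⟨w, w1, by omega, w3, by simpa [e4] using w4⟩
      · intro h0; exact absurd (by simpa using h0) e7
      · intro _; exact e8
      · exact e9
      · exact e10
  · have hrun : tableStep.run m = m := by
      rw [tableStep, run_guard, if_neg]
      intro hall
      simp only [List.forall_mem_cons, NatExpr.eval, NatExpr.eval_var, h.parent, h.node, hj] at hall
      exact hg ⟨by omega, by omega⟩
    rw [hrun]
    have hno : ∀ w, v < w → w < j + 1 → A.parent w = v → w < j := fun w w1 w2 w3 =>
      (hlt w2).resolve_left fun h => hg (by subst h; exact ⟨w1, w3⟩)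
    constructor
    · rw [← h.kind]; funext x; simp
    · rw [← h.parent]; funext x; simp
    · simpa using h.node
    · exact h.pay
    · intro x hx; simpa using h.past_ne x hx
    · exact h.value_ne
    · simpa using h.lt_past
    · intro w w1 w2 w3
      simpa using h.past_le w w1 (hno w w1 w2 w3) w3
    · rcases h.past_eq with h1 | ⟨w, w1, w2, w3, w4⟩
      · exact .inl (by simpa using h1)
      · exact .inr ⟨w, w1, by omega, w3, by simpa using w4⟩
    · intro h0
      have := h.first (by simpa using h0)
      exact ⟨this.1, fun w w1 w2 w3 => this.2 w w1 (hno w w1 w2 w3) w3⟩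
    · intro h0
      obtain ⟨w, w1, w2, w3, w4⟩ := h.later (by simpa using h0)
      exact ⟨w, w1, by omega, w3, w4⟩
    · exact fun hk w w1 w2 w3 => h.le_value hk w w1 (hno w w1 w2 w3) w3
    · exact fun hk w w1 w2 w3 => h.value_le hk w w1 (hno w w1 w2 w3) w3

/-- After `t` rounds the rows of the last `t` nodes are correct. Such a row refers only to the node
itself and to later nodes, so the rounds for earlier nodes preserve it. -/
theorem run_tables (m : Memory) : ∀ v < m.nat 0 0,
    (tables.run m).arrays.TableRow (m.nat 0 0) v := by
  set n := m.nat 0 0 with hn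
  have h := run_loop (x := 9) (C := _) (by decide : tables.WellFormed) m
    (fun t m' => ∀ v < n, n ≤ v + t → m'.arrays.TableRow n v)
    (fun v hv h => by omega) ?_
  · exact fun v hv => h v hv (by omega)
  intro t m' ht h0 ht' hI
  rw [← hn] at ht h0
  set v := n - 1 - t with hv
  have hvn : v < n := by omega
  set C₁ := seq (setNat 6 (.const 0) (.sub (.sub (.var 0) (.const 1)) (.var 9)))
    (seq (setNat 4 (.var 6) (.add (.var 6) (.const 1)))
      (seq (setReal 5 (.var 6) (.cell 0 (.var 6))) (setNat 8 (.const 0) (.const 0)))) with hC₁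
  set m₁ := C₁.run m' with hm₁
  -- The assignments before the inner loop are regrouped into `C₁`; both sides run alike by
  -- definition.
  have hsplit : (seq (setNat 6 (.const 0) (.sub (.sub (.var 0) (.const 1)) (.var 9)))
    (seq (setNat 4 (.var 6) (.add (.var 6) (.const 1)))
      (seq (setReal 5 (.var 6) (.cell 0 (.var 6)))
        (seq (setNat 8 (.const 0) (.const 0)) (loop 7 tableStep))))).run m' =
      (loop 7 tableStep).run m₁ := rfl
  rw [hsplit]
  have hmv : m₁.nat 6 0 = v := by simp [hm₁, hC₁, run, NatExpr.eval, h0, ht', hv]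
  have hm0 : m₁.nat 0 0 = n := by simp [hm₁, hC₁, run, NatExpr.eval, h0]
  have hinv := run_loop (x := 7) (C := tableStep) (by decide) m₁ (TableInv m'.arrays v) (by
    constructor
    · funext x; simp [hm₁, hC₁, run, Memory.arrays]
    · funext x; simp [hm₁, hC₁, run, Memory.arrays]
    · simpa using hmv
    · funext x; simp [hm₁, hC₁, run, Memory.arrays]
    · intro x hx
      simp [hm₁, hC₁, run, Memory.arrays, NatExpr.eval, h0, ht', ← hv, hx]
    · intro x hx
      simp [hm₁, hC₁, run, Memory.arrays, NatExpr.eval, RealExpr.eval, h0, ht', ← hv, hx]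
    · simp [hm₁, hC₁, run, NatExpr.eval, h0, ht', ← hv]
    · intro w _ h; omega
    · left; simp [hm₁, hC₁, run, NatExpr.eval, h0, ht', ← hv]
    · intro _
      refine ⟨?_, fun w _ h => by omega⟩
      simp [hm₁, hC₁, run, NatExpr.eval, RealExpr.eval, h0, ht', ← hv, Memory.arrays]
    · intro h; simp [hm₁, hC₁, run, NatExpr.eval] at h
    · intro _ w _ h; omega
    · intro _ w _ h; omega) (fun j m'' _ _ hj hI => hI.step hj)
  rw [hm0] at hinv
  set m₂ := (loop 7 tableStep).run m₁
  have hk : (m₂.tick 9).arrays.kind = m'.arrays.kind := by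
    rw [← hinv.kind]; funext x; simp [Memory.arrays]
  have hp : (m₂.tick 9).arrays.parent = m'.arrays.parent := by
    rw [← hinv.parent]; funext x; simp [Memory.arrays]
  have hs : (m₂.tick 9).arrays.past = m₂.nat 4 := by funext x; simp [Memory.arrays]
  have hy : (m₂.tick 9).arrays.pay = m'.arrays.pay := hinv.pay
  have hV : (m₂.tick 9).arrays.value = m₂.real 5 := rfl
  intro x hx hxt
  rcases (show v ≤ x by omega).eq_or_lt with rfl | hlt
  · have hsw : ∀ w, v < w → m₂.nat 4 w = m'.arrays.past w := fun w hw => hinv.past_ne w (by omega)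
    have hvw : ∀ w, v < w → m₂.real 5 w = m'.arrays.value w := fun w hw =>
      hinv.value_ne w (by omega)
    constructor <;> simp only [hk, hp, hs, hy, hV]
    · exact hinv.lt_past
    · intro w w1 w2 w3
      rw [hsw w w1]; exact hinv.past_le w w1 w2 w3
    · refine hinv.past_eq.imp_right ?_
      rintro ⟨w, w1, w2, w3, w4⟩
      exact ⟨w, w1, w2, w3, by rw [hsw w w1]; exact w4⟩
    · intro hno
      by_cases h8 : m₂.nat 8 0 = 0
      · exact (hinv.first h8).1
      · obtain ⟨w, w1, w2, w3, -⟩ := hinv.later h8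
        exact absurd w3 (hno w w1 w2)
    · intro w w1 w2 w3
      by_cases h8 : m₂.nat 8 0 = 0
      · exact absurd w3 ((hinv.first h8).2 w w1 w2)
      · obtain ⟨w, w1, w2, w3, w4⟩ := hinv.later h8
        exact ⟨w, w1, w2, w3, by rw [hvw w w1]; exact w4⟩
    · intro hk w w1 w2 w3
      rw [hvw w w1]; exact hinv.le_value hk w w1 w2 w3
    · intro hk w w1 w2 w3
      rw [hvw w w1]; exact hinv.value_le hk w w1 w2 w3
  · have r := hI x hx (by omega)
    have hsw : ∀ w, v < w → m₂.nat 4 w = m'.arrays.past w := fun w hw => hinv.past_ne w (by omega)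
    have hvw : ∀ w, v < w → m₂.real 5 w = m'.arrays.value w := fun w hw =>
      hinv.value_ne w (by omega)
    constructor <;> simp only [hk, hp, hs, hy, hV]
    · rw [hsw x hlt]; exact r.lt_past
    · intro w w1 w2 w3
      rw [hsw x hlt, hsw w (by omega)]; exact r.past_le w w1 w2 w3
    · rw [hsw x hlt]
      refine r.past_eq.imp_right ?_
      rintro ⟨w, w1, w2, w3, w4⟩
      exact ⟨w, w1, w2, w3, by rw [hsw w (by omega)]; exact w4⟩
    · intro hno
      rw [hvw x hlt]; exact r.value_leaf hno
    · intro w w1 w2 w3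
      obtain ⟨w, w1, w2, w3, w4⟩ := r.value_eq w w1 w2 w3
      exact ⟨w, w1, w2, w3, by rw [hvw x hlt, hvw w (by omega)]; exact w4⟩
    · intro hk w w1 w2 w3
      rw [hvw x hlt, hvw w (by omega)]; exact r.le_value hk w w1 w2 w3
    · intro hk w w1 w2 w3
      rw [hvw x hlt, hvw w (by omega)]; exact r.value_le hk w w1 w2 w3

end Cmd

end Stackelberg

/-! ### Framing, ancestry tests and the program for the threshold -/

namespace Stackelberg

namespace Cmd

/-- Run `C` unless `e ≤ f` for all pairs `(e, f)` in the list. -/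
def guardNot (l : List (NatExpr × NatExpr)) (C : Cmd) : Cmd :=
  l.foldr (fun p D => iteNat p.1 p.2 D C) skip

theorem run_guardNot (l : List (NatExpr × NatExpr)) (C : Cmd) (m : Memory) :
    (guardNot l C).run m = if ∀ p ∈ l, p.1.eval m ≤ p.2.eval m then m else C.run m := by
  induction l with
  | nil => simp [guardNot, run]
  | cons p l ih =>
    have ih : (List.foldr (fun p D => iteNat p.1 p.2 D C) skip l).run m = _ := ih
    simp only [guardNot, List.foldr_cons, run, ih, List.forall_mem_cons]
    by_cases h : p.1.eval m ≤ p.2.eval m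
    · rw [if_pos h]
      exact if_congr (by simp [h]) rfl rfl
    · rw [if_neg h, if_neg fun hh => h hh.1]

/-- The memories differ only in banks that the program writes to. -/
def Frame (C : Cmd) (m m' : Memory) : Prop :=
  (∀ b ∉ C.natBanks, m'.nat b = m.nat b) ∧ ∀ b ∉ C.realBanks, m'.real b = m.real b

theorem frame_run (C : Cmd) (m : Memory) : C.Frame m (C.run m) :=
  ⟨fun _ hb => C.run_nat_of_notMem hb m, fun _ hb => C.run_real_of_notMem hb m⟩

/-- The loop rule, where the invariant need not mention what the loop does not write to. -/
theorem run_loop_frame {x : ℕ} {C : Cmd} (hw : (loop x C).WellFormed) (m : Memory)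
    (I : ℕ → Memory → Prop) (h0 : I 0 (m.writeNat x 0 0))
    (hs : ∀ j m', j < m.nat 0 0 → (loop x C).Frame m m' → m'.nat x 0 = j → I j m' →
      I (j + 1) ((C.run m').tick x)) : I (m.nat 0 0) ((loop x C).run m) := by
  refine (run_loop hw m (fun j m' => (loop x C).Frame m m' ∧ I j m') ⟨⟨?_, fun _ _ => rfl⟩, h0⟩
    fun j m' hj _ hx h => ⟨⟨?_, ?_⟩, hs j m' hj h.1 hx h.2⟩).2
  · intro b hb
    simp only [natBanks, List.mem_cons, not_or] at hb
    funext y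
    simp [hb.1]
  · intro b hb
    rw [← h.1.1 b hb]
    simp only [natBanks, List.mem_cons, not_or] at hb
    funext y
    simp [hb.1, C.run_nat_of_notMem hb.2]
  · intro b hb
    rw [← h.1.2 b hb]
    exact C.run_real_of_notMem hb m'

/-- The program does not write to the description of the game. -/
def Safe (C : Cmd) : Prop :=
  (∀ b ∈ [0, 1, 2, 4], b ∉ C.natBanks) ∧ ∀ b ∈ [0, 1, 2, 5], b ∉ C.realBanks

instance (C : Cmd) : Decidable C.Safe := by unfold Safe; infer_instance

theorem Frame.arrays {C : Cmd} {m m' : Memory} (h : C.Frame m m') (hC : C.Safe) :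
    m'.arrays = m.arrays := by
  simp only [Safe, List.forall_mem_cons] at hC
  simp [Memory.arrays, h.1 _ hC.1.2.1, h.1 _ hC.1.2.2.1, h.1 _ hC.1.2.2.2.1,
    h.2 _ hC.2.1, h.2 _ hC.2.2.2.2.1]

theorem Frame.size {C : Cmd} {m m' : Memory} (h : C.Frame m m') (hC : C.Safe) :
    m'.nat 0 0 = m.nat 0 0 := by
  rw [h.1 0 (hC.1 0 (by simp))]

theorem Frame.payF {C : Cmd} {m m' : Memory} (h : C.Frame m m') (hC : C.Safe) :
    m'.real 1 = m.real 1 :=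
  h.2 1 (hC.2 1 (by simp))

open NatExpr in
/-- Is the node `x` an ancestor of the node `y` (or `y` itself)? -/
def ancTest (x y : NatExpr) : List (NatExpr × NatExpr) :=
  -- Branching offers only `≤`, so a strict inequality is tested with one added on the left.
  [(x, y), (.add y (.const 1), .cell 4 x)]

theorem ancTest_iff (x y : NatExpr) (m : Memory) :
    (∀ p ∈ ancTest x y, p.1.eval m ≤ p.2.eval m) ↔ m.arrays.Anc (x.eval m) (y.eval m) := by
  simp [ancTest, NatExpr.eval, Arrays.Anc, Memory.arrays]

open NatExpr in
/-- Run `C` if the node `w` hangs off the path to the node in cell `0` of bank `10`, below a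
decision node of the leader. -/
def ifOffPath (w : NatExpr) (C : Cmd) : Cmd :=
  guard [(.const 1, .cell 1 (.cell 2 w)), (.cell 1 (.cell 2 w), .const 1),
    (.add (.cell 2 w) (.const 1), var 10), (.add (var 10) (.const 1), .cell 4 (.cell 2 w))]
    (guardNot (ancTest w (var 10)) C)

open Classical in
theorem run_ifOffPath (w : NatExpr) (C : Cmd) (m : Memory) : (ifOffPath w C).run m =
    if m.arrays.OffPath (m.nat 10 0) (w.eval m) then C.run m else m := by
  simp only [ifOffPath, run_guard, run_guardNot, ancTest_iff, NatExpr.eval_var]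
  by_cases h : m.arrays.OffPath (m.nat 10 0) (w.eval m)
  · have h' := h
    obtain ⟨h1, h2, h3, h4⟩ := h'
    simp only [Memory.arrays] at h1 h2 h3
    rw [if_pos h, if_pos, if_neg h4]
    simp [NatExpr.eval, h1, Nat.succ_le_of_lt h2, Nat.succ_le_of_lt h3]
  · rw [if_neg h]
    split_ifs with h1 h2
    · rfl
    · exfalso
      simp [NatExpr.eval] at h1
      refine h ⟨?_, ?_, ?_, h2⟩ <;> simp only [Memory.arrays] <;> omega
    · rfl

open NatExpr in
/-- Compute the threshold in cell `0` of bank `6` of real numbers. -/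
def computeThreshold : Cmd :=
  seq (iteNat (var 11) (.const 0)
      (setReal 6 (.const 0) (.sub (.cell 0 (var 10)) (.const 1)))
      (setReal 6 (.const 0) (.cell 5 (var 11))))
    (loop 12 (guard [(.const 1, var 12)] (ifOffPath (var 12)
      (iteReal (.var 6) (.cell 5 (var 12)) (setReal 6 (.const 0) (.cell 5 (var 12))) skip))))

/-- `Arrays.threshold` is a fold over an initial segment of the nodes, so the threshold for the
first `j` nodes is itself the loop invariant; node `0` is skipped in both. -/
theorem run_computeThreshold (m : Memory) : (computeThreshold.run m).real 6 0 =
    m.arrays.threshold (m.nat 0 0) (m.nat 10 0) (m.nat 11 0) := by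
  classical
  set A := m.arrays with hA
  set n := m.nat 0 0 with hn
  set c := m.nat 10 0 with hc
  set i := m.nat 11 0 with hi
  rw [computeThreshold, run]
  set C₁ := iteNat (.var 11) (.const 0)
      (setReal 6 (.const 0) (.sub (.cell 0 (.var 10)) (.const 1)))
      (setReal 6 (.const 0) (.cell 5 (.var 11))) with hC₁
  set m₁ := C₁.run m with hm₁
  have hf₁ : C₁.Frame m m₁ := frame_run _ _
  have hn₁ : m₁.nat 0 0 = n := hf₁.size (by decide)
  have hc₁ : m₁.nat 10 0 = c := by rw [hf₁.1 10 (by decide)]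
  have hA₁ : m₁.arrays = A := hf₁.arrays (by decide)
  rw [← hn₁]
  refine run_loop_frame (by decide) m₁ (fun j m' => m'.real 6 0 = A.threshold j c i) ?_ ?_
  · simp only [Arrays.threshold, Finset.range_zero, Finset.filter_empty, Finset.fold_empty]
    by_cases h : i = 0
    · have h' : m.nat 11 0 = 0 := h
      simp [hm₁, hC₁, run, NatExpr.eval, RealExpr.eval, h', h, hA, hc, Memory.arrays]
    · have h' : ¬ m.nat 11 0 = 0 := h
      simp [hm₁, hC₁, run, NatExpr.eval, RealExpr.eval, h', hA, hi, Memory.arrays]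
  · intro j m' hj hf hx hI
    have hA' : m'.arrays = A := (hf.arrays (by decide)).trans hA₁
    have hc' : m'.nat 10 0 = c := by rw [hf.1 10 (by decide), hc₁]
    have hV : m'.real 5 j = A.value j := by rw [← hA']; rfl
    rw [Memory.tick_real, run_guard, run_ifOffPath]
    simp only [List.forall_mem_singleton, NatExpr.eval, NatExpr.eval_var, hx, hA', hc']
    have hrec : A.threshold (j + 1) c i = if 0 < j ∧ A.OffPath c j then
        max (A.value j) (A.threshold j c i) else A.threshold j c i := by
      unfold Arrays.threshold
      rw [Finset.range_add_one, Finset.filter_insert]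
      split_ifs
      all_goals first | rw [Finset.fold_insert (by simp)] | rfl
    rw [hrec]
    by_cases h : 0 < j ∧ A.OffPath c j
    · rw [if_pos h, if_pos (Nat.succ_le_of_lt h.1), if_pos h.2]
      simp only [run, RealExpr.eval, RealExpr.eval_var, NatExpr.eval_var, hx, hI, hV]
      split_ifs with h1
      · simp [NatExpr.eval, h1]
      · rw [max_eq_right (not_le.1 h1).le]; exact hI
    · rw [if_neg h]
      split_ifs with h1 h2
      · exact absurd ⟨h1, h2⟩ h
      · exact hI
      · exact hI

end Cmd

end Stackelberg

/-! ### Records of the best targets and rules for searching -/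

namespace Stackelberg

/-- The bank of the flag and the value of the best target found so far; `k` tells whether to look
for pairs of terminal nodes. -/
def track (k : Bool) : ℕ := bif k then 30 else 20

/-- A target with a value of at least `r` has been found. -/
def Memory.Beats (m : Memory) (k : Bool) (r : ℝ) : Prop :=
  m.nat (track k) 0 = 1 ∧ r ≤ m.real (track k) 0

/-- `r` is the value of the target given by `c`, `i`, `a` (and `b`). -/
def Arrays.IsValue (A : Arrays) (F : ℕ → ℝ) (n c i a b : ℕ) : Bool → ℝ → Prop
  | false, r => A.LeafTarget n c i a ∧ r = F a
  | true, r => A.PairTarget F n c i a b ∧ r = A.pairValue F n c i a b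

/-- The description of the game, and the records of the targets found so far. -/
structure Memory.SearchState (A : Arrays) (F : ℕ → ℝ) (n : ℕ) (m : Memory) : Prop where
  arrays : m.arrays = A
  payF : m.real 1 = F
  size : m.nat 0 0 = n
  leaf : m.nat 20 0 = 0 ∨ m.nat 20 0 = 1 ∧
    A.LeafTarget n (m.nat 21 0) (m.nat 22 0) (m.nat 23 0) ∧ m.real 20 0 = F (m.nat 23 0)
  pair : m.nat 30 0 = 0 ∨ m.nat 30 0 = 1 ∧
    A.PairTarget F n (m.nat 31 0) (m.nat 32 0) (m.nat 33 0) (m.nat 34 0) ∧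
    m.real 30 0 = A.pairValue F n (m.nat 31 0) (m.nat 32 0) (m.nat 33 0) (m.nat 34 0) ∧
    m.real 31 0 = A.pairProb n (m.nat 31 0) (m.nat 32 0) (m.nat 33 0) (m.nat 34 0)

variable {A : Arrays} {F : ℕ → ℝ} {n : ℕ}

/-- The banks `10` to `19` of natural numbers are scratch space for loop counters: the description
of the game lies below them and the records lie above. -/
theorem Memory.SearchState.writeNat {m : Memory} (h : m.SearchState A F n) {x : ℕ} (h1 : 10 ≤ x)
    (h2 : x < 20) (y z : ℕ) : (m.writeNat x y z).SearchState A F n := by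
  have key : ∀ b, b < 10 ∨ 20 ≤ b → (m.writeNat x y z).nat b = m.nat b := by
    intro b hb
    have : b ≠ x := by omega
    funext w
    simp [this]
  obtain ⟨e1, e2, e3, e4, e5⟩ := h
  constructor
  · rw [← e1]
    simp [Memory.arrays, key]
  · exact e2
  · rwa [key 0 (by norm_num)]
  · simpa only [key 20 (by norm_num), key 21 (by norm_num), key 22 (by norm_num),
      key 23 (by norm_num), Memory.writeNat_real] using e4
  · simpa only [key 30 (by norm_num), key 31 (by norm_num), key 32 (by norm_num),
      key 33 (by norm_num), key 34 (by norm_num),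
      Memory.writeNat_real] using e5

theorem Memory.Beats.writeNat {m : Memory} {k : Bool} {r : ℝ} (h : m.Beats k r) {x : ℕ}
    (h2 : x < 20) (y z : ℕ) : (m.writeNat x y z).Beats k r := by
  refine ⟨?_, h.2⟩
  have : track k ≠ x := by cases k <;> simp [track] <;> omega
  simpa [this] using h.1

namespace Cmd

/-- The program searches the targets whose values are given by `T`. -/
structure Searches (A : Arrays) (F : ℕ → ℝ) (n : ℕ) (C : Cmd) (m : Memory)
    (T : Bool → ℝ → Prop) : Prop where
  state : (C.run m).SearchState A F n
  mono : ∀ k r, m.Beats k r → (C.run m).Beats k r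
  beats : ∀ k r, T k r → (C.run m).Beats k r

theorem Searches.anti {C : Cmd} {m : Memory} {T T' : Bool → ℝ → Prop}
    (h : Searches A F n C m T) (hT : ∀ k r, T' k r → T k r) : Searches A F n C m T' :=
  ⟨h.state, h.mono, fun k r hr => h.beats k r (hT k r hr)⟩

theorem searches_of_run_eq {C : Cmd} {m : Memory} {T : Bool → ℝ → Prop}
    (h : m.SearchState A F n) (hC : C.run m = m) (hT : ∀ k r, ¬ T k r) :
    Searches A F n C m T := by
  refine ⟨?_, ?_, fun k r hr => absurd hr (hT k r)⟩ <;> rw [hC]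
  · exact h
  · exact fun _ _ => id

theorem Searches.seq {C D : Cmd} {m : Memory} {T T' : Bool → ℝ → Prop}
    (h : Searches A F n C m T) (h' : Searches A F n D (C.run m) T') :
    Searches A F n (seq C D) m fun k r => T k r ∨ T' k r :=
  ⟨h'.state, fun k r hr => h'.mono k r (h.mono k r hr), fun k r hr =>
    hr.elim (fun hr => h'.mono k r (h.beats k r hr)) (h'.beats k r)⟩

theorem searches_guard {l : List (NatExpr × NatExpr)} {C : Cmd} {m : Memory}
    {T : Bool → ℝ → Prop} (hS : m.SearchState A F n)
    (h : (∀ p ∈ l, p.1.eval m ≤ p.2.eval m) → Searches A F n C m T)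
    (hT : ∀ k r, T k r → ∀ p ∈ l, p.1.eval m ≤ p.2.eval m) :
    Searches A F n (guard l C) m T := by
  by_cases hl : ∀ p ∈ l, p.1.eval m ≤ p.2.eval m
  · have hrun : (guard l C).run m = C.run m := by rw [run_guard, if_pos hl]
    obtain ⟨h1, h2, h3⟩ := h hl
    constructor <;> rwa [hrun]
  · exact searches_of_run_eq hS (by rw [run_guard, if_neg hl]) fun k r hr => hl (hT k r hr)

theorem searches_iteReal {e f : RealExpr} {C : Cmd} {m : Memory} {T : Bool → ℝ → Prop}
    (hS : m.SearchState A F n) (h : f.eval m < e.eval m → Searches A F n C m T)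
    (hT : ∀ k r, T k r → f.eval m < e.eval m) :
    Searches A F n (iteReal e f skip C) m T := by
  by_cases hl : e.eval m ≤ f.eval m
  · exact searches_of_run_eq hS (by simp [run, hl]) fun k r hr => not_lt.2 hl (hT k r hr)
  · have hrun : (iteReal e f skip C).run m = C.run m := by simp [run, hl]
    obtain ⟨h1, h2, h3⟩ := h (not_le.1 hl)
    constructor <;> rwa [hrun]

/-- Records only improve, so what one round has found is still beaten after all later rounds. -/
theorem searches_loop {x : ℕ} {C : Cmd} (hw : (loop x C).WellFormed) (h1 : 10 ≤ x) (h2 : x < 20)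
    {m : Memory} (hS : m.SearchState A F n) {T : ℕ → Bool → ℝ → Prop}
    (hs : ∀ j < n, ∀ m', (loop x C).Frame m m' → m'.SearchState A F n → m'.nat x 0 = j →
      Searches A F n C m' (T j)) :
    Searches A F n (loop x C) m fun k r => ∃ j < n, T j k r := by
  have key := run_loop_frame hw m (fun j m' => m'.SearchState A F n ∧
    (∀ k r, m.Beats k r → m'.Beats k r) ∧ ∀ j' < j, ∀ k r, T j' k r → m'.Beats k r)
    ⟨hS.writeNat h1 h2 _ _, fun k r hr => hr.writeNat h2 _ _, fun _ h => absurd h (Nat.not_lt_zero _)⟩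
    ?_
  · rw [hS.size] at key
    exact ⟨key.1, key.2.1, fun k r ⟨j, hj, hr⟩ => key.2.2 j hj k r hr⟩
  · rintro j m' hj hf hx ⟨g1, g2, g3⟩
    rw [hS.size] at hj
    obtain ⟨s1, s2, s3⟩ := hs j hj m' hf g1 hx
    refine ⟨s1.writeNat h1 h2 _ _, fun k r hr => (s2 k r (g2 k r hr)).writeNat h2 _ _,
      fun j' hj' k r hr => Memory.Beats.writeNat ?_ h2 _ _⟩
    rcases Nat.lt_succ_iff_lt_or_eq.1 hj' with h | rfl
    · exact s2 k r (g3 j' h k r hr)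
    · exact s3 k r hr

/-- Run `C` unless the flag is set and the value is at most that in the record. -/
def record (x : ℕ) (e : RealExpr) (C : Cmd) : Cmd :=
  iteNat (.const 1) (.var x) (iteReal e (.var x) skip C) C

theorem run_record (x : ℕ) (e : RealExpr) (C : Cmd) (m : Memory) : (record x e C).run m =
    if 1 ≤ m.nat x 0 ∧ e.eval m ≤ m.real x 0 then m else C.run m := by
  simp only [record, run, NatExpr.eval, NatExpr.eval_var, RealExpr.eval_var]
  by_cases h1 : 1 ≤ m.nat x 0 <;> by_cases h2 : e.eval m ≤ m.real x 0 <;> simp [h1, h2]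

open NatExpr in
/-- Store the target in the banks `10`, `11` and `13`. -/
def storeLeaf : Cmd :=
  seq (setNat 20 (.const 0) (.const 1)) (seq (setNat 21 (.const 0) (var 10))
    (seq (setNat 22 (.const 0) (var 11)) (seq (setNat 23 (.const 0) (var 13))
      (setReal 20 (.const 0) (.cell 1 (var 13))))))

/-- Record the target in the banks `10`, `11` and `13`. -/
def recordLeaf : Cmd := record 20 (.cell 1 (.var 13)) storeLeaf

/-- The record is overwritten only if it is empty or holds a smaller value; in both cases it ends up
with at least `F a` and at least its old value. -/
theorem searches_recordLeaf {m : Memory} {c i a : ℕ} (hS : m.SearchState A F n)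
    (hc : m.nat 10 0 = c) (hi : m.nat 11 0 = i) (ha : m.nat 13 0 = a)
    (h : A.LeafTarget n c i a) :
    Searches A F n recordLeaf m fun k r => k = false ∧ r = F a := by
  have hrun := run_record 20 (.cell 1 (.var 13)) storeLeaf m
  simp only [RealExpr.eval, NatExpr.eval_var, ha, hS.payF] at hrun
  split_ifs at hrun with hcond
  · have h1 : m.nat 20 0 = 1 := by rcases hS.leaf with h | h <;> omega
    constructor <;> rw [recordLeaf, hrun]
    · exact hS
    · exact fun _ _ => id
    · rintro k r ⟨rfl, rfl⟩
      exact ⟨h1, hcond.2⟩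
  · have hf : recordLeaf.Frame m (recordLeaf.run m) := frame_run _ _
    rw [← recordLeaf] at hrun
    have e1 : (recordLeaf.run m).nat 20 0 = 1 := by rw [hrun]; simp [storeLeaf, run, NatExpr.eval]
    have e2 : (recordLeaf.run m).nat 21 0 = c := by rw [hrun]; simp [storeLeaf, run, NatExpr.eval, hc]
    have e3 : (recordLeaf.run m).nat 22 0 = i := by rw [hrun]; simp [storeLeaf, run, NatExpr.eval, hi]
    have e4 : (recordLeaf.run m).nat 23 0 = a := by rw [hrun]; simp [storeLeaf, run, NatExpr.eval, ha]
    have e5 : (recordLeaf.run m).real 20 0 = F a := by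
      rw [hrun]; simp [storeLeaf, run, NatExpr.eval, RealExpr.eval, ha, hS.payF]
    constructor
    · refine ⟨(hf.arrays (by decide)).trans hS.arrays, (hf.payF (by decide)).trans hS.payF,
        (hf.size (by decide)).trans hS.size, ?_, ?_⟩
      · rw [e1, e2, e3, e4, e5]
        exact .inr ⟨rfl, h, rfl⟩
      · rw [hf.1 30 (by decide), hf.1 31 (by decide), hf.1 32 (by decide), hf.1 33 (by decide),
          hf.1 34 (by decide), hf.2 30 (by decide), hf.2 31 (by decide)]
        exact hS.pair
    · rintro (_ | _) r ⟨hr1, hr2⟩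
      · refine ⟨e1, ?_⟩
        simp only [track, cond_false] at hr1 hr2 ⊢
        rw [e5]
        exact hr2.trans (not_le.1 fun hle => hcond ⟨hr1.ge, hle⟩).le
      · simp only [Memory.Beats, track, cond_true] at hr1 hr2 ⊢
        rw [hf.1 30 (by decide), hf.2 30 (by decide)]
        exact ⟨hr1, hr2⟩
    · rintro k r ⟨rfl, rfl⟩
      exact ⟨e1, e5.ge⟩

open NatExpr in
/-- Store the target in the banks `10`, `11`, `13` and `14`. -/
def storePair : Cmd :=
  seq (setNat 30 (.const 0) (.const 1)) (seq (setNat 31 (.const 0) (var 10))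
    (seq (setNat 32 (.const 0) (var 11)) (seq (setNat 33 (.const 0) (var 13))
      (seq (setNat 34 (.const 0) (var 14)) (seq (setReal 30 (.const 0) (.var 8))
        (setReal 31 (.const 0) (.var 7)))))))

open NatExpr in
/-- Record the target in the banks `10`, `11`, `13` and `14`. -/
def recordPair : Cmd :=
  seq (setReal 7 (.const 0) (.div (.sub (.var 6) (.cell 0 (var 14)))
      (.sub (.cell 0 (var 13)) (.cell 0 (var 14)))))
    (seq (setReal 8 (.const 0) (.add (.mul (.var 7) (.cell 1 (var 13)))
        (.mul (.sub (.const 1) (.var 7)) (.cell 1 (var 14)))))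
      (record 30 (.var 8) storePair))

theorem searches_recordPair {m : Memory} {c i a b : ℕ} (hS : m.SearchState A F n)
    (hc : m.nat 10 0 = c) (hi : m.nat 11 0 = i) (ha : m.nat 13 0 = a) (hb : m.nat 14 0 = b)
    (hB : m.real 6 0 = A.threshold n c i) (h : A.PairTarget F n c i a b) :
    Searches A F n recordPair m fun k r => k = true ∧ r = A.pairValue F n c i a b := by
  set P := A.pairProb n c i a b with hP
  set W := A.pairValue F n c i a b with hW
  have hU : m.real 0 = A.pay := by rw [← hS.arrays]; rfl
  have hrun' : recordPair.run m = if 1 ≤ m.nat 30 0 ∧ W ≤ m.real 30 0 then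
      (m.writeReal 7 0 P).writeReal 8 0 W
      else storePair.run ((m.writeReal 7 0 P).writeReal 8 0 W) := by
    have h1 : recordPair.run m =
        (record 30 (.var 8) storePair).run ((m.writeReal 7 0 P).writeReal 8 0 W) := by
      simp [recordPair, run, RealExpr.eval, NatExpr.eval, ha, hb, hB, hU, hS.payF, hW,
        Arrays.pairValue, hP, Arrays.pairProb]
    rw [h1, run_record]
    simp
  have hf : recordPair.Frame m (recordPair.run m) := frame_run _ _
  split_ifs at hrun' with hcond
  · have h1 : m.nat 30 0 = 1 := by rcases hS.pair with h | h <;> omega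
    have e : (recordPair.run m).nat = m.nat := by rw [hrun']; rfl
    have e30 : (recordPair.run m).real 30 = m.real 30 := by rw [hrun']; funext x; simp
    have e31 : (recordPair.run m).real 31 = m.real 31 := by rw [hrun']; funext x; simp
    have e20 : (recordPair.run m).real 20 = m.real 20 := by rw [hrun']; funext x; simp
    constructor
    · refine ⟨(hf.arrays (by decide)).trans hS.arrays, (hf.payF (by decide)).trans hS.payF,
        (hf.size (by decide)).trans hS.size, ?_, ?_⟩
      · rw [e, e20]; exact hS.leaf
      · rw [e, e30, e31]; exact hS.pair
    · rintro (_ | _) r hr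
      · simpa only [Memory.Beats, track, cond_false, e, e20] using hr
      · simpa only [Memory.Beats, track, cond_true, e, e30] using hr
    · rintro k r ⟨rfl, rfl⟩
      simp only [Memory.Beats, track, cond_true, e, e30]
      exact ⟨h1, hcond.2⟩
  · have e1 : (recordPair.run m).nat 30 0 = 1 := by rw [hrun']; simp [storePair, run, NatExpr.eval]
    have e2 : (recordPair.run m).nat 31 0 = c := by rw [hrun']; simp [storePair, run, NatExpr.eval, hc]
    have e3 : (recordPair.run m).nat 32 0 = i := by rw [hrun']; simp [storePair, run, NatExpr.eval, hi]
    have e4 : (recordPair.run m).nat 33 0 = a := by rw [hrun']; simp [storePair, run, NatExpr.eval, ha]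
    have e5 : (recordPair.run m).nat 34 0 = b := by rw [hrun']; simp [storePair, run, NatExpr.eval, hb]
    have e6 : (recordPair.run m).real 30 0 = W := by
      rw [hrun']; simp [storePair, run, NatExpr.eval]
    have e7 : (recordPair.run m).real 31 0 = P := by
      rw [hrun']; simp [storePair, run, NatExpr.eval]
    constructor
    · refine ⟨(hf.arrays (by decide)).trans hS.arrays, (hf.payF (by decide)).trans hS.payF,
        (hf.size (by decide)).trans hS.size, ?_, ?_⟩
      · rw [hf.1 20 (by decide), hf.1 21 (by decide), hf.1 22 (by decide), hf.1 23 (by decide),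
          hf.2 20 (by decide)]
        exact hS.leaf
      · rw [e1, e2, e3, e4, e5, e6, e7]
        exact .inr ⟨rfl, h, rfl, rfl⟩
    · rintro (_ | _) r ⟨hr1, hr2⟩
      · simp only [Memory.Beats, track, cond_false] at hr1 hr2 ⊢
        rw [hf.1 20 (by decide), hf.2 20 (by decide)]
        exact ⟨hr1, hr2⟩
      · refine ⟨e1, ?_⟩
        simp only [track, cond_true] at hr1 hr2 ⊢
        rw [e6]
        exact hr2.trans (not_le.1 fun hle => hcond ⟨hr1.ge, hle⟩).le
    · rintro k r ⟨rfl, rfl⟩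
      exact ⟨e1, e6.ge⟩

end Cmd

end Stackelberg

/-! ### The nested search over all targets -/

namespace Stackelberg

variable {A : Arrays} {F : ℕ → ℝ} {n : ℕ}

namespace Cmd

theorem searches_iteReal' {e f : RealExpr} {C : Cmd} {m : Memory} {T : Bool → ℝ → Prop}
    (hS : m.SearchState A F n) (h : e.eval m ≤ f.eval m → Searches A F n C m T)
    (hT : ∀ k r, T k r → e.eval m ≤ f.eval m) :
    Searches A F n (iteReal e f C skip) m T := by
  by_cases hl : e.eval m ≤ f.eval m
  · have hrun : (iteReal e f C skip).run m = C.run m := by simp [run, hl]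
    obtain ⟨h1, h2, h3⟩ := h hl
    constructor <;> rwa [hrun]
  · exact searches_of_run_eq hS (by simp [run, hl]) fun k r hr => hl (hT k r hr)

open NatExpr in
/-- Are the nodes in the banks `15` and `16` different children of the same node of the leader,
one above the node in bank `13` and the other above the node in bank `14`? -/
def forkTest : List (NatExpr × NatExpr) :=
  [(.const 1, var 15), (.const 1, var 16),
    -- With truncated subtraction the sum is the distance of the two numbers, so this says that they
    -- differ.
    (.const 1, .add (.sub (var 15) (var 16)) (.sub (var 16) (var 15))),
    (.cell 2 (var 15), .cell 2 (var 16)), (.cell 2 (var 16), .cell 2 (var 15)),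
    (.const 1, .cell 1 (.cell 2 (var 15))), (.cell 1 (.cell 2 (var 15)), .const 1)] ++
  (ancTest (var 15) (var 13) ++ ancTest (var 16) (var 14))

theorem forkTest_iff (m : Memory) : (∀ p ∈ forkTest, p.1.eval m ≤ p.2.eval m) ↔
    0 < m.nat 15 0 ∧ 0 < m.nat 16 0 ∧ m.nat 15 0 ≠ m.nat 16 0 ∧
      m.arrays.parent (m.nat 15 0) = m.arrays.parent (m.nat 16 0) ∧
      m.arrays.kind (m.arrays.parent (m.nat 15 0)) = 1 ∧ m.arrays.Anc (m.nat 15 0) (m.nat 13 0) ∧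
      m.arrays.Anc (m.nat 16 0) (m.nat 14 0) := by
  simp only [forkTest, List.forall_mem_append, ancTest_iff, List.forall_mem_cons, NatExpr.eval,
    NatExpr.eval_var]
  simp only [List.not_mem_nil, false_imp_iff, implies_true, and_true, Memory.arrays]
  constructor
  · rintro ⟨⟨h1, h2, h3, h4, h5, h6, h7⟩, h8, h9⟩
    exact ⟨h1, h2, by omega, by omega, by omega, h8, h9⟩
  · rintro ⟨h1, h2, h3, h4, h5, h8, h9⟩
    exact ⟨⟨h1, h2, by omega, by omega, by omega, by omega, by omega⟩, h8, h9⟩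

open NatExpr in
/-- Search the pairs of the node in bank `13` and a node that is found in bank `14`. -/
def searchPairs : Cmd :=
  loop 14 (guard ((.cell 1 (var 14), .const 0) :: ancTest (var 10) (var 14))
    (iteReal (.cell 0 (var 14)) (.var 6)
      (iteReal (.cell 1 (var 14)) (.cell 1 (var 13)) skip
        (loop 15 (loop 16 (guard forkTest recordPair)))) skip))

/-- The conditions in `PairTarget` are tested one after another, the two innermost loops looking for
the witnesses of `Forks`. A pair may come up for several witnesses, which does no harm. -/
theorem searches_searchPairs {m : Memory} {c i a : ℕ} (hS : m.SearchState A F n)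
    (hc : m.nat 10 0 = c) (hi : m.nat 11 0 = i) (ha : m.nat 13 0 = a)
    (hB : m.real 6 0 = A.threshold n c i) (h : A.LeafTarget n c i a) :
    Searches A F n searchPairs m fun k r => k = true ∧ ∃ b, A.IsValue F n c i a b k r := by
  have H := searches_loop (x := 14) (C := guard ((.cell 1 (.var 14), .const 0) ::
    ancTest (.var 10) (.var 14)) (iteReal (.cell 0 (.var 14)) (.var 6)
      (iteReal (.cell 1 (.var 14)) (.cell 1 (.var 13)) skip
        (loop 15 (loop 16 (guard forkTest recordPair)))) skip)) (by decide) (by norm_num)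
    (by norm_num) hS (T := fun b k r => k = true ∧ A.IsValue F n c i a b k r) ?_
  · refine H.anti ?_
    rintro _ r ⟨rfl, b, hb⟩
    exact ⟨b, hb.1.2.1, rfl, hb⟩
  intro b hbn m₁ hf hS₁ hb
  replace hc : m₁.nat 10 0 = c := by rw [hf.1 10 (by decide), hc]
  replace hi : m₁.nat 11 0 = i := by rw [hf.1 11 (by decide), hi]
  replace ha : m₁.nat 13 0 = a := by rw [hf.1 13 (by decide), ha]
  replace hB : m₁.real 6 0 = A.threshold n c i := by rw [hf.2 6 (by decide), hB]
  have hU : m₁.real 0 = A.pay := by rw [← hS₁.arrays]; rfl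
  have hK : m₁.nat 1 = A.kind := by rw [← hS₁.arrays]; rfl
  clear hf hS
  refine searches_guard hS₁ (fun hg => ?_) ?_
  swap
  · rintro _ r ⟨rfl, hT⟩
    rw [List.forall_mem_cons, ancTest_iff]
    simpa [NatExpr.eval, hb, hc, hK, hS₁.arrays] using ⟨hT.1.2.2.1, hT.1.2.2.2.1⟩
  rw [List.forall_mem_cons, ancTest_iff] at hg
  simp only [NatExpr.eval, NatExpr.eval_var, hb, hc, hK, hS₁.arrays, Nat.le_zero] at hg
  refine searches_iteReal' hS₁ (fun hle => ?_) ?_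
  swap
  · rintro _ r ⟨rfl, hT⟩
    simpa [RealExpr.eval, NatExpr.eval, hb, hB, hU] using hT.1.2.2.2.2.1
  simp only [RealExpr.eval, NatExpr.eval_var, RealExpr.eval_var, hb, hB, hU] at hle
  refine searches_iteReal hS₁ (fun hlt => ?_) ?_
  swap
  · rintro _ r ⟨rfl, hT⟩
    simpa [RealExpr.eval, NatExpr.eval, hb, ha, hS₁.payF] using hT.1.2.2.2.2.2.1
  simp only [RealExpr.eval, NatExpr.eval_var, hb, ha, hS₁.payF] at hlt
  have H := searches_loop (x := 15) (C := loop 16 (guard forkTest recordPair)) (by decide)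
    (by norm_num) (by norm_num) hS₁ (T := fun w₁ k r => ∃ w₂ < n, (0 < w₁ ∧ 0 < w₂ ∧ w₁ ≠ w₂ ∧
      A.parent w₁ = A.parent w₂ ∧ A.kind (A.parent w₁) = 1 ∧ A.Anc w₁ a ∧ A.Anc w₂ b) ∧
      k = true ∧ r = A.pairValue F n c i a b) ?_
  · refine H.anti ?_
    rintro _ r ⟨rfl, ⟨-, -, -, -, -, -, w₁, w₂, h1, h2, h3, h4, h5⟩, hr⟩
    exact ⟨w₁, h2, w₂, h4, ⟨h1, h3, h5⟩, rfl, hr⟩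
  intro w₁ hw₁ m₂ hf₂ hS₂ hx₁
  refine searches_loop (by decide) (by norm_num) (by norm_num) hS₂ ?_
  intro w₂ hw₂ m₃ hf₃ hS₃ hx₂
  replace hc : m₃.nat 10 0 = c := by rw [hf₃.1 10 (by decide), hf₂.1 10 (by decide), hc]
  replace hi : m₃.nat 11 0 = i := by rw [hf₃.1 11 (by decide), hf₂.1 11 (by decide), hi]
  replace ha : m₃.nat 13 0 = a := by rw [hf₃.1 13 (by decide), hf₂.1 13 (by decide), ha]
  replace hb : m₃.nat 14 0 = b := by rw [hf₃.1 14 (by decide), hf₂.1 14 (by decide), hb]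
  replace hx₁ : m₃.nat 15 0 = w₁ := by rw [hf₃.1 15 (by decide), hx₁]
  replace hB : m₃.real 6 0 = A.threshold n c i := by
    rw [hf₃.2 6 (by decide), hf₂.2 6 (by decide), hB]
  have hiff := forkTest_iff m₃
  rw [hS₃.arrays, hx₁, hx₂, ha, hb] at hiff
  refine searches_guard hS₃ (fun hg' => ?_) fun k r hT => hiff.2 hT.1
  obtain ⟨g1, g2, g3⟩ := hiff.1 hg'
  exact (searches_recordPair hS₃ hc hi ha hb hB
    ⟨h, hbn, hg.1, hg.2, hle, hlt, w₁, w₂, g1, hw₁, g2, hw₂, g3⟩).anti fun k r hT => hT.2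

open NatExpr in
/-- Search the targets for the nodes in the banks `10` and `11`. -/
def searchLeaves : Cmd :=
  seq computeThreshold
    (loop 13 (guard ((.cell 1 (var 13), .const 0) :: ancTest (var 10) (var 13))
      (iteReal (.cell 0 (var 13)) (.var 6) skip (seq recordLeaf searchPairs))))

theorem searches_searchLeaves {m : Memory} {c i : ℕ} (hS : m.SearchState A F n)
    (hc : m.nat 10 0 = c) (hi : m.nat 11 0 = i) (hcn : c < n) (hin : i < n)
    (hsw : A.Switch 0 n c i) :
    Searches A F n searchLeaves m fun k r => ∃ a b, A.IsValue F n c i a b k r := by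
  have hf₀ : computeThreshold.Frame m (computeThreshold.run m) := frame_run _ _
  have hB := run_computeThreshold m
  rw [hS.arrays, hS.size, hc, hi] at hB
  set m₀ := computeThreshold.run m
  have hS₀ : m₀.SearchState A F n := by
    refine ⟨(hf₀.arrays (by decide)).trans hS.arrays, (hf₀.payF (by decide)).trans hS.payF,
        (hf₀.size (by decide)).trans hS.size, ?_, ?_⟩
    · rw [hf₀.1 20 (by decide), hf₀.1 21 (by decide), hf₀.1 22 (by decide), hf₀.1 23 (by decide),
        hf₀.2 20 (by decide)]
      exact hS.leaf
    · rw [hf₀.1 30 (by decide), hf₀.1 31 (by decide), hf₀.1 32 (by decide), hf₀.1 33 (by decide),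
        hf₀.1 34 (by decide), hf₀.2 30 (by decide), hf₀.2 31 (by decide)]
      exact hS.pair
  have hb₀ : ∀ k r, m.Beats k r → m₀.Beats k r := by
    rintro (_ | _) r hr
    · simpa only [Memory.Beats, track, cond_false, hf₀.1 20 (by decide),
        hf₀.2 20 (by decide)] using hr
    · simpa only [Memory.Beats, track, cond_true, hf₀.1 30 (by decide),
        hf₀.2 30 (by decide)] using hr
  replace hc : m₀.nat 10 0 = c := by rw [hf₀.1 10 (by decide), hc]
  replace hi : m₀.nat 11 0 = i := by rw [hf₀.1 11 (by decide), hi]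
  suffices H : Searches A F n (loop 13 (guard ((.cell 1 (.var 13), .const 0) ::
      ancTest (.var 10) (.var 13)) (iteReal (.cell 0 (.var 13)) (.var 6) skip
        (seq recordLeaf searchPairs)))) m₀
      fun k r => ∃ a < n, ∃ b, A.IsValue F n c i a b k r by
    refine ⟨H.state, fun k r hr => H.mono k r (hb₀ k r hr), ?_⟩
    rintro k r ⟨a, b, hT⟩
    refine H.beats k r ⟨a, ?_, b, hT⟩
    cases k
    exacts [hT.1.2.2.1, hT.1.1.2.2.1]
  refine searches_loop (by decide) (by norm_num) (by norm_num) hS₀ ?_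
  intro a han m₁ hf hS₁ ha
  replace hc : m₁.nat 10 0 = c := by rw [hf.1 10 (by decide), hc]
  replace hi : m₁.nat 11 0 = i := by rw [hf.1 11 (by decide), hi]
  replace hB : m₁.real 6 0 = A.threshold n c i := by rw [hf.2 6 (by decide), hB]
  have hU : m₁.real 0 = A.pay := by rw [← hS₁.arrays]; rfl
  have hK : m₁.nat 1 = A.kind := by rw [← hS₁.arrays]; rfl
  have hleaf : ∀ k r, (∃ b, A.IsValue F n c i a b k r) → A.LeafTarget n c i a := by
    rintro (_ | _) r ⟨b, hT⟩
    exacts [hT.1, hT.1.1]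
  refine searches_guard hS₁ (fun hg => ?_) ?_
  swap
  · intro k r hT
    have hT := hleaf k r hT
    rw [List.forall_mem_cons, ancTest_iff]
    simpa [NatExpr.eval, ha, hc, hK, hS₁.arrays] using ⟨hT.2.2.2.2.1, hT.2.2.2.2.2.1⟩
  rw [List.forall_mem_cons, ancTest_iff] at hg
  simp only [NatExpr.eval, NatExpr.eval_var, ha, hc, hK, hS₁.arrays, Nat.le_zero] at hg
  refine searches_iteReal hS₁ (fun hlt => ?_) ?_
  swap
  · intro k r hT
    simpa [RealExpr.eval, NatExpr.eval, ha, hB, hU] using (hleaf k r hT).2.2.2.2.2.2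
  simp only [RealExpr.eval, NatExpr.eval_var, RealExpr.eval_var, ha, hB, hU] at hlt
  have htar : A.LeafTarget n c i a := ⟨hcn, hin, han, hsw, hg.1, hg.2, hlt⟩
  have H₁ := searches_recordLeaf hS₁ hc hi ha htar
  have hf' : recordLeaf.Frame m₁ (recordLeaf.run m₁) := frame_run _ _
  refine (H₁.seq (searches_searchPairs H₁.state (by rw [hf'.1 10 (by decide), hc])
    (by rw [hf'.1 11 (by decide), hi]) (by rw [hf'.1 13 (by decide), ha])
    (by rw [hf'.2 6 (by decide), hB]) htar)).anti ?_
  rintro (_ | _) r ⟨b, hT⟩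
  · exact .inl ⟨rfl, hT.2⟩
  · exact .inr ⟨rfl, b, hT⟩

open NatExpr in
/-- Search all targets. -/
def search : Cmd :=
  loop 10 (loop 11 (seq
    (guard [(var 11, .const 0), (.cell 1 (var 10), .const 0)] searchLeaves)
    (guard [(.const 1, var 10), (.const 1, var 11),
      (.const 1, .add (.sub (var 11) (var 10)) (.sub (var 10) (var 11))),
      (.cell 2 (var 11), .cell 2 (var 10)), (.cell 2 (var 10), .cell 2 (var 11)),
      (.cell 1 (.cell 2 (var 10)), .const 2), (.const 2, .cell 1 (.cell 2 (var 10)))]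
      searchLeaves)))

/-- The two guards are the two alternatives of `Switch`, and a target contains only node numbers
below `n`, so bounded loops miss nothing. -/
theorem searches_search {m : Memory} (hS : m.SearchState A F n) :
    Searches A F n search m fun k r => ∃ c i a b, A.IsValue F n c i a b k r := by
  have hleaf : ∀ {c i k r}, (∃ a b, A.IsValue F n c i a b k r) →
      c < n ∧ i < n ∧ A.Switch 0 n c i := by
    rintro c i (_ | _) r ⟨a, b, hT⟩
    exacts [⟨hT.1.1, hT.1.2.1, hT.1.2.2.2.1⟩, ⟨hT.1.1.1, hT.1.1.2.1, hT.1.1.2.2.2.1⟩]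
  suffices H : Searches A F n search m
      fun k r => ∃ c < n, ∃ i < n, ∃ a b, A.IsValue F n c i a b k r by
    refine H.anti ?_
    rintro k r ⟨c, i, hT⟩
    exact ⟨c, (hleaf hT).1, i, (hleaf hT).2.1, hT⟩
  refine searches_loop (by decide) (by norm_num) (by norm_num) hS ?_
  intro c hcn m₁ hf₁ hS₁ hc
  refine searches_loop (by decide) (by norm_num) (by norm_num) hS₁ ?_
  intro i hin m₂ hf₂ hS₂ hi
  replace hc : m₂.nat 10 0 = c := by rw [hf₂.1 10 (by decide), hc]
  have key : ∀ (m₃ : Memory) (l : List (NatExpr × NatExpr)) (Q : Prop), m₃.SearchState A F n →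
      m₃.nat 10 0 = c → m₃.nat 11 0 = i → (Q → A.Switch 0 n c i) →
      ((∀ p ∈ l, p.1.eval m₃ ≤ p.2.eval m₃) ↔ Q) →
      Searches A F n (guard l searchLeaves) m₃
        fun k r => Q ∧ ∃ a b, A.IsValue F n c i a b k r := by
    intro m₃ l Q hS₃ hc hi hQ hiff
    refine searches_guard hS₃ (fun hg => ?_) fun k r hT => hiff.2 hT.1
    exact (searches_searchLeaves hS₃ hc hi hcn hin (hQ (hiff.1 hg))).anti fun k r hT => hT.2
  have hK : ∀ m₃ : Memory, m₃.SearchState A F n → m₃.nat 1 = A.kind := by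
    intro m₃ h; rw [← h.arrays]; rfl
  have hP : ∀ m₃ : Memory, m₃.SearchState A F n → m₃.nat 2 = A.parent := by
    intro m₃ h; rw [← h.arrays]; rfl
  have H₁ := key m₂ [(.var 11, .const 0), (.cell 1 (.var 10), .const 0)] (i = 0 ∧ A.kind c = 0)
    hS₂ hc hi .inl (by simp [NatExpr.eval, hc, hi, hK m₂ hS₂])
  have hf := frame_run (guard [(.var 11, .const 0), (.cell 1 (.var 10), .const 0)] searchLeaves) m₂
  refine (H₁.seq (key _ _ (0 < c ∧ 0 < i ∧ i < n ∧ i ≠ c ∧ A.parent i = A.parent c ∧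
    A.kind (A.parent c) = 2) H₁.state ?_ ?_ .inr ?_)).anti ?_
  · rw [hf.1 10 (by decide), hc]
  · rw [hf.1 11 (by decide), hi]
  · simp only [List.forall_mem_cons, NatExpr.eval, NatExpr.eval_var, hK _ H₁.state,
      hP _ H₁.state, hf.1 10 (by decide), hf.1 11 (by decide), hc, hi]
    simp only [List.not_mem_nil, false_imp_iff, implies_true, and_true]
    omega
  · intro k r hT
    rcases (hleaf hT).2.2 with h | h
    exacts [.inl ⟨h, hT⟩, .inr ⟨h, hT⟩]

end Cmd

end Stackelberg

/-! ### The program for the output -/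

namespace Stackelberg

variable {A : Arrays} {F : ℕ → ℝ} {n : ℕ}

namespace Cmd

open NatExpr in
/-- Compute a payoff lower than all those in threats, in bank `32` of real numbers. -/
def computeBottom : Cmd :=
  seq (setReal 32 (.const 0) (.const (-1)))
    (loop 12 (iteReal (.const 0) (.cell 0 (var 12))
      (setReal 32 (.const 0) (.sub (.var 32) (.mul (.const 2) (.cell 0 (var 12)))))
      (setReal 32 (.const 0) (.add (.var 32) (.mul (.const 2) (.cell 0 (var 12)))))))

theorem run_computeBottom (m : Memory) :
    (computeBottom.run m).real 32 0 = m.arrays.bottom (m.nat 0 0) := by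
  set m₁ := (setReal 32 (.const 0) (.const (-1))).run m with hm₁
  refine run_loop_frame (by decide) m₁ (fun j m' => m'.real 32 0 = m.arrays.bottom j) ?_ ?_
  · simp [hm₁, run, RealExpr.eval, NatExpr.eval, Arrays.bottom]
  · intro j m' _ hf hx hI
    have hU : m'.real 0 j = m.arrays.pay j := by
      rw [hf.2 0 (by decide)]
      simp [hm₁, run, Memory.arrays]
    have hrec : m.arrays.bottom (j + 1) = m.arrays.bottom j - 2 * |m.arrays.pay j| := by
      unfold Arrays.bottom
      rw [Finset.sum_range_succ]
      ring
    rw [Memory.tick_real, hrec, ← hI, ← hU]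
    simp only [run, RealExpr.eval, NatExpr.eval_var, hx, RealExpr.eval_var]
    split_ifs with h
    · rw [abs_of_nonneg (by simpa using h)]
      simp [NatExpr.eval]
    · rw [abs_of_nonpos (by simpa using (not_le.1 h).le)]
      simp [NatExpr.eval]

open NatExpr in
/-- Make all terminal nodes below the node in bank `12` worth its maximin value to both players
together. -/
def threaten : Cmd :=
  loop 15 (guard (ancTest (var 12) (var 15))
    (setReal 4 (var 15) (.sub (.cell 5 (var 12)) (.cell 0 (var 15)))))

open Classical in
theorem run_threaten (m : Memory) (z : ℕ) : (threaten.run m).real 4 z =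
    if z < m.nat 0 0 ∧ m.arrays.Anc (m.nat 12 0) z then
      m.arrays.value (m.nat 12 0) - m.arrays.pay z else m.real 4 z := by
  refine run_loop_frame (by decide) m (fun j m' => m'.real 4 z =
    if z < j ∧ m.arrays.Anc (m.nat 12 0) z then
      m.arrays.value (m.nat 12 0) - m.arrays.pay z else m.real 4 z) ?_ ?_
  · simp
  · intro j m' _ hf hx hI
    have hA : m'.arrays = m.arrays := hf.arrays (by decide)
    have hU : m'.real 0 = m.arrays.pay := by rw [← hA]; rfl
    have hV : m'.real 5 = m.arrays.value := by rw [← hA]; rfl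
    have hw : m'.nat 12 0 = m.nat 12 0 := by rw [hf.1 12 (by decide)]
    rw [Memory.tick_real, run_guard, if_congr (ancTest_iff _ _ _) rfl rfl]
    simp only [NatExpr.eval_var, hw, hx, hA]
    by_cases hj : m.arrays.Anc (m.nat 12 0) j
    · rw [if_pos hj]
      simp only [run, RealExpr.eval, NatExpr.eval_var, hx, hU, hV, hw, Memory.writeReal_real]
      by_cases hz : z = j
      · subst hz
        simp [hj]
      · have : z < j + 1 ↔ z < j := by omega
        simp [hz, hI, this]
    · rw [if_neg hj, hI]
      by_cases hz : z = j
      · subst hz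
        simp [hj]
      · have : z < j + 1 ↔ z < j := by omega
        simp [this]

open NatExpr in
/-- Apply all threats, for the nodes in the banks `10` and `11`. -/
def threatenAll : Cmd :=
  -- The test `1 ≤ w` keeps `i = 0`, which stands for no threat, from being read as a threat at the
  -- root.
  loop 12 (seq (guard [(.const 1, var 12), (var 12, var 11), (var 11, var 12)] threaten)
    (guard [(.const 1, var 12)] (ifOffPath (var 12) threaten)))

/-- Later rounds overwrite earlier ones, so each terminal node ends up with the value of the last
node that applies to it; the statement records only that there is such a node, as `IsThreat`
requires. -/
theorem run_threatenAll (m : Memory) {bot : ℝ} (hbot : ∀ z < m.nat 0 0, m.real 4 z = bot) :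
    ∀ z < m.nat 0 0,
      (∃ w, 0 < w ∧ w < m.nat 0 0 ∧ (w = m.nat 11 0 ∨ m.arrays.OffPath (m.nat 10 0) w) ∧
        m.arrays.Anc w z ∧ (threatenAll.run m).real 4 z = m.arrays.value w - m.arrays.pay z) ∨
      ((∀ w, 0 < w → w < m.nat 0 0 → (w = m.nat 11 0 ∨ m.arrays.OffPath (m.nat 10 0) w) →
        ¬ m.arrays.Anc w z) ∧ (threatenAll.run m).real 4 z = bot) := by
  classical
  refine run_loop_frame (by decide) m (fun j m' => ∀ z < m.nat 0 0,
      (∃ w, 0 < w ∧ w < j ∧ (w = m.nat 11 0 ∨ m.arrays.OffPath (m.nat 10 0) w) ∧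
        m.arrays.Anc w z ∧ m'.real 4 z = m.arrays.value w - m.arrays.pay z) ∨
      ((∀ w, 0 < w → w < j → (w = m.nat 11 0 ∨ m.arrays.OffPath (m.nat 10 0) w) →
        ¬ m.arrays.Anc w z) ∧ m'.real 4 z = bot)) ?_ ?_
  · exact fun z hz => .inr ⟨fun w _ h => absurd h (Nat.not_lt_zero _), hbot z hz⟩
  · intro j m' _ hf hx hI z hz
    set C₁ := guard [(.const 1, .var 12), (.var 12, .var 11), (.var 11, .var 12)] threaten
    set C₂ := guard [(.const 1, .var 12)] (ifOffPath (.var 12) threaten)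
    have hf₁ : C₁.Frame m' (C₁.run m') := frame_run _ _
    have hA : m'.arrays = m.arrays := hf.arrays (by decide)
    have hn : m'.nat 0 0 = m.nat 0 0 := hf.size (by decide)
    have hc : m'.nat 10 0 = m.nat 10 0 := by rw [hf.1 10 (by decide)]
    have hi : m'.nat 11 0 = m.nat 11 0 := by rw [hf.1 11 (by decide)]
    have h1 : (C₁.run m').real 4 z = if (0 < j ∧ j = m.nat 11 0) ∧ m.arrays.Anc j z then
        m.arrays.value j - m.arrays.pay z else m'.real 4 z := by
      have hiff : (∀ p ∈ [(NatExpr.const 1, NatExpr.var 12), (.var 12, .var 11),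
          (.var 11, .var 12)], p.1.eval m' ≤ p.2.eval m') ↔ 0 < j ∧ j = m.nat 11 0 := by
        simp [NatExpr.eval, hx, hi]
        omega
      rw [run_guard, if_congr hiff rfl rfl]
      by_cases h : 0 < j ∧ j = m.nat 11 0
      · rw [if_pos h, run_threaten, hn, hA, hx]
        exact if_congr ⟨fun hh => ⟨h, hh.2⟩, fun hh => ⟨hz, hh.2⟩⟩ rfl rfl
      · simp [h]
    have h2 : (C₂.run (C₁.run m')).real 4 z =
        if (0 < j ∧ m.arrays.OffPath (m.nat 10 0) j) ∧ m.arrays.Anc j z then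
        m.arrays.value j - m.arrays.pay z else (C₁.run m').real 4 z := by
      have hA₁ := (hf₁.arrays (by decide)).trans hA
      have hn₁ := (hf₁.size (by decide)).trans hn
      have hx₁ : (C₁.run m').nat 12 0 = j := by rw [hf₁.1 12 (by decide), hx]
      have hc₁ : (C₁.run m').nat 10 0 = m.nat 10 0 := by rw [hf₁.1 10 (by decide), hc]
      rw [run_guard, run_ifOffPath]
      simp only [List.forall_mem_singleton, NatExpr.eval, NatExpr.eval_var, hA₁, hx₁, hc₁]
      by_cases h : 0 < j ∧ m.arrays.OffPath (m.nat 10 0) j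
      · rw [if_pos (Nat.succ_le_of_lt h.1), if_pos h.2, run_threaten, hn₁, hA₁, hx₁]
        exact if_congr ⟨fun hh => ⟨h, hh.2⟩, fun hh => ⟨hz, hh.2⟩⟩ rfl rfl
      · rw [if_neg (c := (_ ∧ _) ∧ _) (fun hh => h hh.1)]
        split_ifs with g1 g2
        · exact absurd ⟨g1, g2⟩ h
        · rfl
        · rfl
    have h3 : (((seq C₁ C₂).run m').tick 12).real 4 z =
        if (0 < j ∧ (j = m.nat 11 0 ∨ m.arrays.OffPath (m.nat 10 0) j)) ∧ m.arrays.Anc j z then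
        m.arrays.value j - m.arrays.pay z else m'.real 4 z := by
      rw [Memory.tick_real, run, h2, h1]
      split_ifs <;> first | rfl | tauto
    rw [h3]
    by_cases h : (0 < j ∧ (j = m.nat 11 0 ∨ m.arrays.OffPath (m.nat 10 0) j)) ∧ m.arrays.Anc j z
    · rw [if_pos h]
      exact .inl ⟨j, h.1.1, Nat.lt_succ_self j, h.1.2, h.2, rfl⟩
    · rw [if_neg h]
      rcases hI z hz with ⟨w, w1, w2, w3⟩ | ⟨h4, h5⟩
      · exact .inl ⟨w, w1, w2.trans (Nat.lt_succ_self j), w3⟩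
      · refine .inr ⟨fun w w1 w2 w3 w4 => ?_, h5⟩
        rcases Nat.lt_succ_iff_lt_or_eq.1 w2 with w2 | rfl
        · exact h4 w w1 w2 w3 w4
        · exact h ⟨⟨w1, w3⟩, w4⟩

open NatExpr in
/-- Output the distribution and the payoff function for the target in the banks `10`, `11`, `13`
and `14` and the probability in bank `9` of real numbers. -/
def output : Cmd :=
  seq (seq computeBottom (loop 12 (setReal 4 (var 12) (.var 32))))
    (seq threatenAll
      (seq (setReal 33 (.const 0) (.add (.mul (.var 9) (.cell 0 (var 13)))
          (.mul (.sub (.const 1) (.var 9)) (.cell 0 (var 14)))))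
        -- The entries for `b` are written before those for `a`, so that for `a = b` the probability
        -- `t` remains, in agreement with `pairDist`.
        (seq (seq (setReal 4 (var 14) (.sub (.var 33) (.cell 0 (var 14))))
            (setReal 4 (var 13) (.sub (.var 33) (.cell 0 (var 13)))))
          (seq (setReal 3 (var 14) (.sub (.const 1) (.var 9)))
            (setReal 3 (var 13) (.var 9))))))

/-- Only two cells of bank `3` are written, so the zeros of all other terminal nodes must be there
beforehand. -/
theorem run_output {m : Memory} {c i a b : ℕ} {t : ℝ} (hA : m.arrays = A) (hn : m.nat 0 0 = n)
    (hc : m.nat 10 0 = c) (hi : m.nat 11 0 = i) (ha : m.nat 13 0 = a) (hb : m.nat 14 0 = b)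
    (ht : m.real 9 0 = t) (h3 : m.real 3 = 0) :
    (output.run m).real 3 = pairDist a b t ∧
      A.IsThreat 0 n c i a b (t * A.pay a + (1 - t) * A.pay b) (A.bottom n)
        ((output.run m).real 4) := by
  set C₁ := seq computeBottom (loop 12 (setReal 4 (.var 12) (.var 32))) with hC₁
  set m₁ := C₁.run m with hm₁
  have hf₁ : C₁.Frame m m₁ := frame_run _ _
  set m₂ := threatenAll.run m₁ with hm₂
  have hf₂ : threatenAll.Frame m₁ m₂ := frame_run _ _
  have hA₁ : m₁.arrays = A := (hf₁.arrays (by decide)).trans hA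
  have hn₁ : m₁.nat 0 0 = n := (hf₁.size (by decide)).trans hn
  have hA₂ : m₂.arrays = A := (hf₂.arrays (by decide)).trans hA₁
  have hU : m₂.real 0 = A.pay := by rw [← hA₂]; rfl
  have hbot : ∀ z < m₁.nat 0 0, m₁.real 4 z = A.bottom n := by
    have hf₀ := frame_run computeBottom m
    have h0 := run_computeBottom m
    rw [hA, hn] at h0
    have : m₁.nat 0 0 = (computeBottom.run m).nat 0 0 := by rw [hn₁, hf₀.size (by decide), hn]
    rw [this]
    refine run_loop_frame (by decide) (computeBottom.run m)
      (fun j m' => ∀ z < j, m'.real 4 z = A.bottom n) (fun z h => absurd h (Nat.not_lt_zero _)) ?_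
    intro j m' _ hf hx hI z hz
    have hK : m'.real 32 0 = A.bottom n := by rw [hf.2 32 (by decide), h0]
    simp only [Memory.tick_real, run, NatExpr.eval_var, RealExpr.eval_var, hx, hK,
      Memory.writeReal_real, true_and]
    split_ifs with h
    · rfl
    · exact hI z (by omega)
  have hthr := run_threatenAll m₁ hbot
  rw [hA₁, hn₁, hf₁.1 10 (by decide), hf₁.1 11 (by decide), hc, hi, ← hm₂] at hthr
  have ha₂ : m₂.nat 13 0 = a := by rw [hf₂.1 13 (by decide), hf₁.1 13 (by decide), ha]
  have hb₂ : m₂.nat 14 0 = b := by rw [hf₂.1 14 (by decide), hf₁.1 14 (by decide), hb]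
  have ht₂ : m₂.real 9 0 = t := by rw [hf₂.2 9 (by decide), hf₁.2 9 (by decide), ht]
  have h3₂ : m₂.real 3 = 0 := by rw [hf₂.2 3 (by decide), hf₁.2 3 (by decide), h3]
  have hrun : output.run m = (seq (setReal 33 (.const 0) (.add (.mul (.var 9) (.cell 0 (.var 13)))
          (.mul (.sub (.const 1) (.var 9)) (.cell 0 (.var 14)))))
        (seq (seq (setReal 4 (.var 14) (.sub (.var 33) (.cell 0 (.var 14))))
            (setReal 4 (.var 13) (.sub (.var 33) (.cell 0 (.var 13)))))
          (seq (setReal 3 (.var 14) (.sub (.const 1) (.var 9)))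
            (setReal 3 (.var 13) (.var 9))))).run m₂ := rfl
  have e3 : ∀ z, (output.run m).real 3 z = if z = a then t else if z = b then 1 - t else 0 := by
    intro z
    rw [hrun]
    simp [run, RealExpr.eval, NatExpr.eval, ha₂, hb₂, ht₂, h3₂]
  have e4 : ∀ z, (output.run m).real 4 z =
      if z = a then t * A.pay a + (1 - t) * A.pay b - A.pay a else
      if z = b then t * A.pay a + (1 - t) * A.pay b - A.pay b else m₂.real 4 z := by
    intro z
    rw [hrun]
    simp [run, RealExpr.eval, NatExpr.eval, ha₂, hb₂, ht₂, hU]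
  refine ⟨funext e3, by rw [e4, if_pos rfl], ?_, fun z _ hz _ za zb => ?_⟩
  · rw [e4]
    by_cases h : b = a <;> simp [h]
  · rw [e4, if_neg za, if_neg zb]
    exact hthr z hz

end Cmd

end Stackelberg

/-! ### Correctness of the four programs -/

namespace Stackelberg

variable {A : Arrays} {F : ℕ → ℝ} {G : Game} {m : Memory}

open GameTree

/-- The memory contains the description of the game and the results of the search. -/
structure Memory.Ready (m : Memory) (A : Arrays) (F : ℕ → ℝ) (G : Game) : Prop where
  describes : A.Describes F G
  state : m.SearchState A F G.size
  beats : ∀ {c i a b k r}, A.IsValue F G.size c i a b k r → m.Beats k r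
  dist : m.real 3 = 0

namespace Memory.Ready

theorem beats_leaf (h : m.Ready A F G) {c i a : ℕ} (hT : A.LeafTarget G.size c i a) :
    m.nat 20 0 = 1 ∧ F a ≤ m.real 20 0 :=
  h.beats (b := 0) (k := false) ⟨hT, rfl⟩

theorem beats_pair (h : m.Ready A F G) {c i a b : ℕ} (hT : A.PairTarget F G.size c i a b) :
    m.nat 30 0 = 1 ∧ A.pairValue F G.size c i a b ≤ m.real 30 0 :=
  h.beats (k := true) ⟨hT, rfl⟩

theorem nonempty_iff (h : m.Ready A F G) : G.SP.Nonempty ↔ m.nat 20 0 = 1 := by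
  rw [h.describes.nonempty_SP_iff]
  constructor
  · rintro ⟨c, i, a, hT⟩
    exact (h.beats_leaf hT).1
  · intro h1
    rcases h.state.leaf with h0 | ⟨-, hT, -⟩
    · omega
    · exact ⟨_, _, _, hT⟩

/-- If the recorded pair value does not exceed the recorded leaf value, then the leaf value bounds
everything that can be strongly induced, and it is attained. -/
theorem isOptimal (h : m.Ready A F G) (h1 : G.SP.Nonempty)
    (h2 : ¬ (m.nat 30 0 = 1 ∧ m.real 20 0 < m.real 30 0)) :
    A.LeafTarget G.size (m.nat 21 0) (m.nat 22 0) (m.nat 23 0) ∧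
      G.IsOptimal (atLeaves (pairDist (m.nat 23 0) (m.nat 23 0) 1) G.tree 0) := by
  rw [h.nonempty_iff] at h1
  rcases h.state.leaf with h0 | ⟨-, hT, hv⟩
  · omega
  · refine ⟨hT, h.describes.isOptimal hT ?_ ?_⟩ <;> rw [← hv]
    · exact fun c i a hT' => (h.beats_leaf hT').2
    · intro c i a b hT'
      obtain ⟨g1, g2⟩ := h.beats_pair hT'
      exact g2.trans (not_lt.1 fun g3 => h2 ⟨g1, g3⟩)

/-- The recorded pair is a best one, and its value exceeds that of every leaf target; this is the
situation of `not_exists_isOptimal` and `isNearOptimal`. -/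
theorem pairTarget (h : m.Ready A F G) (h1 : m.nat 30 0 = 1) (h2 : m.real 20 0 < m.real 30 0) :
    ∃ c i a b, (m.nat 31 0 = c ∧ m.nat 32 0 = i ∧ m.nat 33 0 = a ∧ m.nat 34 0 = b ∧
      m.real 31 0 = A.pairProb G.size c i a b) ∧ A.PairTarget F G.size c i a b ∧
      (∀ c' i' a', A.LeafTarget G.size c' i' a' → F a' < A.pairValue F G.size c i a b) ∧
      ∀ c' i' a' b', A.PairTarget F G.size c' i' a' b' →
        A.pairValue F G.size c' i' a' b' ≤ A.pairValue F G.size c i a b := by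
  rcases h.state.pair with h0 | ⟨-, hT, hv, hp⟩
  · omega
  · refine ⟨_, _, _, _, ⟨rfl, rfl, rfl, rfl, hp⟩, hT, ?_, ?_⟩ <;> rw [← hv]
    · exact fun c i a hT' => (h.beats_leaf hT').2.trans_lt h2
    · exact fun c i a b hT' => (h.beats_pair hT').2

theorem exists_isOptimal_iff (h : m.Ready A F G) (h1 : G.SP.Nonempty) :
    (∃ p, G.IsOptimal p) ↔ ¬ (m.nat 30 0 = 1 ∧ m.real 20 0 < m.real 30 0) := by
  constructor
  · rintro hp ⟨g1, g2⟩
    obtain ⟨c, i, a, b, -, hT, hL, hP⟩ := h.pairTarget g1 g2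
    exact h.describes.not_exists_isOptimal hT hL hP hp
  · exact fun h2 => ⟨_, (h.isOptimal h1 h2).2⟩

end Memory.Ready

namespace Cmd

/-- Compute the tables and search all targets. -/
def prepare : Cmd := seq tables search

theorem ready_run_prepare (G : Game) (ε : ℝ) :
    ∃ A F, (prepare.run (G.input ε)).Ready A F G ∧ (prepare.run (G.input ε)).real 2 0 = ε := by
  have hf := frame_run tables (G.input ε)
  set m₁ := tables.run (G.input ε) with hm₁
  have hK : m₁.arrays.kind = fun i => (G.row i).kind := hf.1 1 (by decide)
  have hP : m₁.arrays.parent = fun i => (G.row i).parent := hf.1 2 (by decide)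
  have hU : m₁.arrays.pay = fun i => (G.row i).uL := hf.2 0 (by decide)
  have hF : m₁.real 1 = fun i => (G.row i).uF := hf.2 1 (by decide)
  have hn : m₁.nat 0 0 = G.size := congrFun (hf.1 0 (by decide)) 0
  obtain ⟨hs, hu, hu'⟩ := Arrays.shape_row hK hP hU
  have hG : m₁.arrays.Describes (m₁.real 1) G := by
    refine ⟨Arrays.fits_of_tableRow (n := G.size) (run_tables (G.input ε)) hs
      (by rw [zero_add]; exact le_rfl) ?_, hu, by rw [hF]; exact hu'⟩
    intro w _ hw _ _
    rw [zero_add]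
    exact hw
  have hS : m₁.SearchState m₁.arrays (m₁.real 1) G.size := by
    refine ⟨rfl, rfl, hn, .inl ?_, .inl ?_⟩
    · rw [hf.1 20 (by decide)]; rfl
    · rw [hf.1 30 (by decide)]; rfl
  have H := searches_search hS
  have hf' := frame_run search m₁
  refine ⟨m₁.arrays, m₁.real 1, ⟨hG, H.state, fun hr => H.beats _ _ ⟨_, _, _, _, hr⟩, ?_⟩, ?_⟩
  · change (search.run m₁).real 3 = 0
    rw [hf'.2 3 (by decide), hf.2 3 (by decide)]
    rfl
  · change (search.run m₁).real 2 0 = ε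
    rw [hf'.2 2 (by decide), hf.2 2 (by decide)]
    rfl

/-- Is there a strongly inducible distribution? -/
def answerNonempty : Cmd := setNat 3 (.const 0) (.var 20)

theorem answers_answerNonempty (h : m.Ready A F G) :
    (answerNonempty.run m).Answers G.SP.Nonempty := by
  have : (answerNonempty.run m).nat 3 0 = m.nat 20 0 := by
    simp [answerNonempty, run, NatExpr.eval]
  rw [Memory.Answers, this, h.nonempty_iff]
  exact ⟨id, fun h1 => h.state.leaf.resolve_right fun h2 => h1 h2.1⟩

/-- Is there an optimal strongly inducible distribution? -/
def answerOptimal : Cmd :=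
  iteNat (.const 1) (.var 30)
    (iteReal (.var 30) (.var 20) (setNat 3 (.const 0) (.const 1))
      (setNat 3 (.const 0) (.const 0)))
    (setNat 3 (.const 0) (.const 1))

theorem answers_answerOptimal (h : m.Ready A F G) (h1 : G.SP.Nonempty) :
    (answerOptimal.run m).Answers (∃ p, G.IsOptimal p) := by
  rw [Memory.Answers, h.exists_isOptimal_iff h1]
  simp only [answerOptimal, run, NatExpr.eval, NatExpr.eval_var, RealExpr.eval_var]
  have h01 : m.nat 30 0 = 0 ∨ m.nat 30 0 = 1 := h.state.pair.imp_right fun h => h.1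
  rcases h01 with h2 | h2
  · simp [h2]
  · by_cases h3 : m.real 30 0 ≤ m.real 20 0
    · simp [h2, h3, not_lt.2 h3]
    · simp [h2, h3, not_le.1 h3]

theorem run_output_ready (h : m.Ready A F G) {C : Cmd} (hC : C.Safe) (h3 : 3 ∉ C.realBanks)
    {c i a b : ℕ} {t : ℝ} (hc : (C.run m).nat 10 0 = c) (hi : (C.run m).nat 11 0 = i)
    (ha : (C.run m).nat 13 0 = a) (hb : (C.run m).nat 14 0 = b) (ht : (C.run m).real 9 0 = t)
    (hT : A.LeafTarget G.size c i a) (hbn : b < G.size) (kb : A.kind b = 0) (hcb : A.Anc c b)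
    (hp : A.IsPair 0 G.size a b t) (ht1 : t ≤ 1)
    (hthr : A.threshold G.size c i < t * A.pay a + (1 - t) * A.pay b) :
    ((seq C output).run m).outDist G.tree = atLeaves (pairDist a b t) G.tree 0 ∧
      StronglyInduces G.uL (((seq C output).run m).outPayoff G.tree)
        (((seq C output).run m).outDist G.tree) := by
  have hf := frame_run C m
  obtain ⟨h1, h2⟩ := run_output ((hf.arrays hC).trans h.state.arrays)
    ((hf.size hC).trans h.state.size) hc hi ha hb ht ((hf.2 3 h3).trans h.dist)
  have hd : ((seq C output).run m).outDist G.tree = atLeaves (pairDist a b t) G.tree 0 := by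
    funext z
    rw [atLeaves, zero_add, ← h1]
    rfl
  have hv : ((seq C output).run m).outPayoff G.tree =
      atLeaves ((output.run (C.run m)).real 4) G.tree 0 := by
    funext z
    rw [atLeaves, zero_add]
    rfl
  rw [hd, hv]
  exact ⟨rfl, h.describes.stronglyInduces hT.1 hbn hT.2.2.1 hT.2.2.2.1 hT.2.2.2.2.1 kb
    hT.2.2.2.2.2.1 hcb hp ht1 hthr h2⟩

open NatExpr in
/-- Choose the best terminal node for the output. -/
def chooseLeaf : Cmd :=
  seq (setNat 10 (.const 0) (var 21)) (seq (setNat 11 (.const 0) (var 22))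
    (seq (setNat 13 (.const 0) (var 23)) (seq (setNat 14 (.const 0) (var 23))
      (setReal 9 (.const 0) (.const 1)))))

theorem isOptimal_run (h : m.Ready A F G) (hp : ∃ p, G.IsOptimal p) :
    G.IsOptimal (((seq chooseLeaf output).run m).outDist G.tree) ∧
      StronglyInduces G.uL (((seq chooseLeaf output).run m).outPayoff G.tree)
        (((seq chooseLeaf output).run m).outDist G.tree) := by
  have hne : G.SP.Nonempty := hp.imp fun p hp => hp.1
  obtain ⟨hT, hopt⟩ := h.isOptimal hne ((h.exists_isOptimal_iff hne).1 hp)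
  obtain ⟨h1, h2⟩ := run_output_ready h (C := chooseLeaf) (by decide) (by decide)
    (c := m.nat 21 0) (i := m.nat 22 0) (a := m.nat 23 0) (b := m.nat 23 0) (t := 1)
    (by simp [chooseLeaf, run, NatExpr.eval]) (by simp [chooseLeaf, run, NatExpr.eval])
    (by simp [chooseLeaf, run, NatExpr.eval]) (by simp [chooseLeaf, run, NatExpr.eval])
    (by simp [chooseLeaf, run, NatExpr.eval, RealExpr.eval]) hT hT.2.2.1 hT.2.2.2.2.1
    hT.2.2.2.2.2.1 Arrays.LeafTarget.isPair le_rfl (by simpa using hT.2.2.2.2.2.2)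
  exact ⟨by rw [h1]; exact hopt, h2⟩

open NatExpr in
/-- Choose the best pair of terminal nodes for the output, and compute two probabilities. -/
def readPair : Cmd :=
  seq (setNat 10 (.const 0) (var 31)) (seq (setNat 11 (.const 0) (var 32))
    (seq (setNat 13 (.const 0) (var 33)) (seq (setNat 14 (.const 0) (var 34))
      (seq (setReal 34 (.const 0) (.add (.var 31)
          (.div (.var 2) (.sub (.cell 1 (var 34)) (.cell 1 (var 33))))))
        (setReal 35 (.const 0) (.div (.add (.var 31) (.const 1)) (.const 2)))))))

/-- Choose the best pair of terminal nodes for the output, with a probability close to the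
infimum of those that the follower can enforce. -/
def choosePair : Cmd :=
  seq readPair (iteReal (.var 34) (.var 35) (setReal 9 (.const 0) (.var 34))
    (setReal 9 (.const 0) (.var 35)))

theorem isNearOptimal_run (h : m.Ready A F G) {ε : ℝ} (hε : 0 < ε) (hm : m.real 2 0 = ε)
    (hne : G.SP.Nonempty) (hp : ¬ ∃ p, G.IsOptimal p) :
    G.IsNearOptimal ε (((seq choosePair output).run m).outDist G.tree) ∧
      StronglyInduces G.uL (((seq choosePair output).run m).outPayoff G.tree)
        (((seq choosePair output).run m).outDist G.tree) := by
  rw [h.exists_isOptimal_iff hne, not_not] at hp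
  obtain ⟨c, i, a, b, ⟨hc, hi, ha, hb, hprob⟩, hT, hL, hP⟩ := h.pairTarget hp.1 hp.2
  have hF : 0 < F b - F a := sub_pos.2 hT.2.2.2.2.2.1
  have hs := hT.pairProb_mem.2.2
  set s := A.pairProb G.size c i a b
  -- Going from `s` up to `t` costs the follower `(t - s) * (F b - F a)`, so the first bound keeps
  -- the loss within `ε`; the second keeps `t` below `1`, where the mixture remains proper.
  have ht : s < min (s + ε / (F b - F a)) ((s + 1) / 2) :=
    lt_min (lt_add_of_pos_right _ (div_pos hε hF)) (by linarith)
  have ht1 : min (s + ε / (F b - F a)) ((s + 1) / 2) < 1 := (min_le_right _ _).trans_lt (by linarith)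
  have hle : (min (s + ε / (F b - F a)) ((s + 1) / 2) - s) * (F b - F a) ≤ ε := by
    rw [← le_div_iff₀ hF]
    linarith [min_le_left (s + ε / (F b - F a)) ((s + 1) / 2)]
  have hrun : choosePair.run m = (readPair.run m).writeReal 9 0
      (min (s + ε / (F b - F a)) ((s + 1) / 2)) := by
    have e1 : (readPair.run m).real 34 0 = s + ε / (F b - F a) := by
      simp [readPair, run, NatExpr.eval, RealExpr.eval, hprob, hm, ha, hb, h.state.payF]
    have e2 : (readPair.run m).real 35 0 = (s + 1) / 2 := by
      simp [readPair, run, NatExpr.eval, RealExpr.eval, hprob]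
    simp only [choosePair, run, RealExpr.eval_var, e1, e2, NatExpr.eval, min_def]
    split_ifs <;> rfl
  obtain ⟨h1, h2⟩ := run_output_ready h (C := choosePair) (by decide) (by decide)
    (c := c) (i := i) (a := a) (b := b) (t := min (s + ε / (F b - F a)) ((s + 1) / 2))
    (by simp [hrun, readPair, run, NatExpr.eval, hc])
    (by simp [hrun, readPair, run, NatExpr.eval, hi])
    (by simp [hrun, readPair, run, NatExpr.eval, ha])
    (by simp [hrun, readPair, run, NatExpr.eval, hb])
    (by simp [hrun])
    hT.1 hT.2.1 hT.2.2.1 hT.2.2.2.1 (hT.isPair ht ht1) ht1.le (hT.threshold_lt ht)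
  exact ⟨by rw [h1]; exact h.describes.isNearOptimal hT hL hP ht ht1 hle, h2⟩

/-- The time bound depends only on the program and the loop bound, which is the size of the
instance; real inputs such as `ε` do not enter. -/
theorem solvableInPolyTime {I : Type} {input : I → Memory} {size : I → ℕ} {pre : I → Prop}
    {post : I → Memory → Prop} (C : Cmd) (hw : C.WellFormed)
    (hsize : ∀ x, (input x).nat 0 0 = size x) (h : ∀ x, pre x → post x (C.run (input x))) :
    SolvableInPolyTime input size pre post := by
  refine ⟨C.toProg, C.timeBound, fun x hx => ?_⟩
  obtain ⟨c, hc, he⟩ := C.exec hw (input x)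
  rw [hsize] at hc
  exact ⟨c, _, he, hc, h x hx⟩

end Cmd

end Stackelberg

theorem mainTheorem9 :
    -- decide whether a strongly inducible distribution exists
    Stackelberg.SolvableInPolyTime (fun G : Stackelberg.Game => G.input 0) (fun G => G.size)
      (fun _ => True)
      (fun G m => m.Answers G.SP.Nonempty) ∧
    -- if so, decide whether an optimal one exists
    Stackelberg.SolvableInPolyTime (fun G : Stackelberg.Game => G.input 0) (fun G => G.size)
      (fun G => G.SP.Nonempty)
      (fun G m => m.Answers (∃ p, G.IsOptimal p)) ∧
    -- if so, find an optimal one, with a payoff function that strongly induces it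
    Stackelberg.SolvableInPolyTime (fun G : Stackelberg.Game => G.input 0) (fun G => G.size)
      (fun G => ∃ p, G.IsOptimal p)
      (fun G m => G.IsOptimal (m.outDist G.tree) ∧
        Stackelberg.GameTree.StronglyInduces G.uL (m.outPayoff G.tree) (m.outDist G.tree)) ∧
    -- if not, find an ε-optimal one for given ε > 0, with a payoff function that strongly induces it
    Stackelberg.SolvableInPolyTime (fun x : Stackelberg.Game × ℝ => x.1.input x.2)
      (fun x => x.1.size)
      (fun x => x.1.SP.Nonempty ∧ (¬ ∃ p, x.1.IsOptimal p) ∧ 0 < x.2)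
      (fun x m => x.1.IsNearOptimal x.2 (m.outDist x.1.tree) ∧
        Stackelberg.GameTree.StronglyInduces x.1.uL (m.outPayoff x.1.tree)
          (m.outDist x.1.tree)) := by
  refine ⟨?_, ?_, ?_, ?_⟩
  · refine Stackelberg.Cmd.solvableInPolyTime (.seq .prepare .answerNonempty)
      (by decide) (fun _ => rfl) fun G _ => ?_
    obtain ⟨A, F, h, -⟩ := Stackelberg.Cmd.ready_run_prepare G 0
    exact Stackelberg.Cmd.answers_answerNonempty h
  · refine Stackelberg.Cmd.solvableInPolyTime (.seq .prepare .answerOptimal)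
      (by decide) (fun _ => rfl) fun G hG => ?_
    obtain ⟨A, F, h, -⟩ := Stackelberg.Cmd.ready_run_prepare G 0
    exact Stackelberg.Cmd.answers_answerOptimal h hG
  · refine Stackelberg.Cmd.solvableInPolyTime (.seq .prepare (.seq .chooseLeaf .output))
      (by decide) (fun _ => rfl) fun G hG => ?_
    obtain ⟨A, F, h, -⟩ := Stackelberg.Cmd.ready_run_prepare G 0
    exact Stackelberg.Cmd.isOptimal_run h hG
  · refine Stackelberg.Cmd.solvableInPolyTime (.seq .prepare (.seq .choosePair .output))
      (by decide) (fun _ => rfl) fun x hx => ?_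
    obtain ⟨A, F, h, hm⟩ := Stackelberg.Cmd.ready_run_prepare x.1 x.2
    exact Stackelberg.Cmd.isNearOptimal_run h hx.2.2 hm hx.1 hx.2.1
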